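/- Let $A_0\in\mathbb R^{2\times2}$ and $B_0\in\mathbb R^2$. For $T>0$ put $Q=(0,\pi)\times(0,T)$ and consider the control system $$y_t-y_{xx}=A_0y\ \text{ in }Q,\qquad y(0,\cdot)=B_0u,\quad y(\pi,\cdot)=0\ \text{ in }(0,T),\qquad y(\cdot,0)=y_0,\tag{1}$$ with $y_0\in L^2(0,\pi)^2$ and $u\in L^2(0,T)$ real. A solution by transposition of (1) is a function $y\in L^2(Q)^2$ such that for every $g\in L^2(Q)^2$ $$\int_Q y\cdot g\,dx\,dt=\langle y_0,\phi(\cdot,0)\rangle+\int_0^T B_0\cdot\phi_x(0,t)\,u(t)\,dt,$$ where $\phi\in L^2(0,T;H^2(0,\pi)^2)\cap C([0,T];H^1_0(0,\pi)^2)$ is the strong solution of $-\phi_t-\phi_{xx}=A_0^*\phi+g$ in $Q$, $\phi(0,\cdot)=\phi(\pi,\cdot)=0$, $\phi(\cdot,T)=0$. Let $H=L^2(0,\pi;\mathbb C)^2$, $U=\mathbb C$, $Af=f''+A_0f$ with $\mathrm{dom}\,A=H^2(0,\pi;\mathbb C)^2\cap H^1_0(0,\pi;\mathbb C)^2$. Give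 $\mathrm{dom}\,A^*$ the graph norm, identify $H$ with a subspace of the dual $(\mathrm{dom}\,A^*)'$ (sesquilinear pairing), and let $\mathcal A=(A^*)':H\to(\mathrm{dom}\,A^*)'$ be the extension of $A$. Then $A$ generates a $C_0$-semigroup $e^{At}$ on $H$, $\mathcal A$ (with domain $H$) generates a $C_0$-semigroup $e^{\mathcal At}$ on $(\mathrm{dom}\,A^*)'$, and there is $B\in\mathcal L(U,(\mathrm{dom}\,A^*)')$ such that the following hold. 1. Let $\omega\in\mathbb C$ be such that no $\omega+k^2$ ($k=1,2,\dots$) is an eigenvalue of $A_0$. Then $\omega\in\rho(A)$; for each $a\in\mathbb C$ the problem $h''+A_0h=\omega h$ in $(0,\pi)$, $h(0)=aB_0$, $h(\pi)=0$ has a unique solution $h=:D_\omega a\in C^2([0,\pi];\mathbb C^2)$; the map $D_\omega:\mathbb C\to H$ is linear and continuous, and $$B=(\omega I-\mathcal A)D_\omega .$$ In particular $B=-\mathcal AC$ with $C=D_0$ whenever no $k^2$, $k\ge1$, is an eigenvalue of $A_0$. Moreover, for all $\theta\in(0,1/4)$ and $T>0$ there is $M$ such that $e^{At}D_\omega a\in\mathrm{dom}\,A$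 and $\|Ae^{At}D_\omega a\|_H\le M|a|\,t^{-(1-\theta)}$ for all $t\in(0,T)$, $a\in\mathbb C$. 2. For all $T>0$, $y_0\in L^2(0,\pi)^2$ and $u\in L^2(0,T)$, system (1) has a unique solution by transposition $y$, and $y$ is the solution of $\dot y=\mathcal Ay+Bu$, $y(0)=y_0$, that is, for a.e. $t\in(0,T)$ $$y(t)=e^{At}y_0+\int_0^te^{\mathcal A(t-s)}Bu(s)\,ds .$$ 3. For every $T>0$ the transformation $u\mapsto\int_0^{\cdot}e^{\mathcal A(\cdot-s)}Bu(s)\,ds$ is linear and continuous from $L^2(0,T;U)$ into $L^2(0,T;H)$. 4. $A$ has compact resolvent, and there are closed subspaces $H_s,H_1$ of $H$ with $H=H_s\oplus H_1$ such that $e^{At}x\to0$ as $t\to+\infty$ for all $x\in H_s$, $H_1$ is invariant for $e^{At}$, and the generalized eigenvectors of $A$ contained in $H_1$ are linearly dense in $H_1$ (with $H_1=\{0\}$ if $\sigma(A)=\emptyset$). -/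

import Mathlib

open MeasureTheory Set Filter Topology

noncomputable section

namespace BoundaryControl

/-! ## Abstract setting: semigroups, generators, resolvents, extrapolation space -/

/-- A strongly continuous semigroup `(S t)_{t ≥ 0}` of bounded operators on `X`
(the values at negative times are irrelevant). -/
structure C0Semigroup (X : Type*) [NormedAddCommGroup X] [NormedSpace ℂ X] where
  op : ℝ → X →L[ℂ] X
  op_zero : op 0 = ContinuousLinearMap.id ℂ X
  op_add : ∀ s t : ℝ, 0 ≤ s → 0 ≤ t → op (s + t) = (op s).comp (op t)
  tendsto_zero : ∀ x : X, Tendsto (fun t : ℝ => op t x) (𝓝[>] 0) (𝓝 x)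

/-- The infinitesimal generator of `S` is the operator whose graph is `G`: one has `(x, y) ∈ G`
if and only if `(S t x - x) / t → y` as `t ↓ 0`. -/
def C0Semigroup.HasGenerator {X : Type*} [NormedAddCommGroup X] [NormedSpace ℂ X]
    (S : C0Semigroup X) (G : Set (X × X)) : Prop :=
  ∀ x y : X, (x, y) ∈ G ↔
    Tendsto (fun t : ℝ => ((t⁻¹ : ℝ) : ℂ) • (S.op t x - x)) (𝓝[>] 0) (𝓝 y)

section Abstract

variable {H : Type*} [NormedAddCommGroup H] [InnerProductSpace ℂ H]

/-- `R` is the bounded everywhere defined inverse of `ω I - A : dom A → H`. -/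
def IsResolventAt (A : H →ₗ.[ℂ] H) (ω : ℂ) (R : H →L[ℂ] H) : Prop :=
  (∀ x : H, ∃ h : R x ∈ A.domain, ω • R x - A ⟨R x, h⟩ = x) ∧
    ∀ x : A.domain, R (ω • (x : H) - A x) = x

/-- The resolvent set `ρ(A)`. -/
def resolventSet (A : H →ₗ.[ℂ] H) : Set ℂ := {ω | ∃ R, IsResolventAt A ω R}

/-- The spectrum `σ(A)`. -/
def spectrumSet (A : H →ₗ.[ℂ] H) : Set ℂ := (resolventSet A)ᶜ

/-- `A` has compact resolvent. -/
def HasCompactResolvent (A : H →ₗ.[ℂ] H) : Prop :=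
  (resolventSet A).Nonempty ∧ ∀ ω R, IsResolventAt A ω R → IsCompactOperator R

/-- `IsInKerPow A lam k x` means `x ∈ Ker (lam I - A)^k` (including `x ∈ dom A^k`). -/
def IsInKerPow (A : H →ₗ.[ℂ] H) (lam : ℂ) : ℕ → H → Prop
  | 0, x => x = 0
  | k + 1, x => ∃ h : x ∈ A.domain, IsInKerPow A lam k (lam • x - A ⟨x, h⟩)

/-- `x` is a generalized eigenvector of `A`. (The zero vector is included; this is harmless since
the notion is only used through linear spans.) -/
def IsGenEigenvector (A : H →ₗ.[ℂ] H) (x : H) : Prop :=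
  ∃ lam : ℂ, ∃ k : ℕ, 1 ≤ k ∧ IsInKerPow A lam k x

/-- The spectral hypothesis on the semigroup `S = e^{At}`: the space `H` is the direct sum of
closed subspaces `Hs` and `H1` such that `e^{At} x → 0` for `x ∈ Hs`, and such that `H1` is
invariant and the generalized eigenvectors contained in `H1` are linearly dense in it;
`H1 = 0` if the spectrum is empty. -/
def SpectralHypothesis (A : H →ₗ.[ℂ] H) (S : C0Semigroup H) : Prop :=
  ∃ Hs H1 : Submodule ℂ H,
    IsClosed (Hs : Set H) ∧ IsClosed (H1 : Set H) ∧ IsCompl Hs H1 ∧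
    (∀ x ∈ Hs, Tendsto (fun t : ℝ => S.op t x) atTop (𝓝 0)) ∧
    (∀ x ∈ H1, ∀ t : ℝ, 0 ≤ t → S.op t x ∈ H1) ∧
    H1 = (Submodule.span ℂ {x | x ∈ H1 ∧ IsGenEigenvector A x}).topologicalClosure ∧
    (spectrumSet A = ∅ → H1 = ⊥)

/-- The domain of an operator `T`, as a space of its own that carries the graph norm. -/
def GraphDom (T : H →ₗ.[ℂ] H) : Type _ := T.domain

namespace GraphDom

variable (T : H →ₗ.[ℂ] H)

instance : AddCommGroup (GraphDom T) := inferInstanceAs (AddCommGroup T.domain)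

instance : Module ℂ (GraphDom T) := inferInstanceAs (Module ℂ T.domain)

/-- The inclusion of `dom T` into `H`. -/
def inclₗ : GraphDom T →ₗ[ℂ] H := T.domain.subtype

/-- `T` as a linear map on its domain. -/
def applyₗ : GraphDom T →ₗ[ℂ] H := T.toFun

/-- The map `v ↦ (v, T v)`. -/
def toGraphₗ : GraphDom T →ₗ[ℂ] WithLp 2 (H × H) :=
  (WithLp.linearEquiv 2 ℂ (H × H)).symm.toLinearMap ∘ₗ (inclₗ T).prod (applyₗ T)

theorem toGraphₗ_injective : Function.Injective (toGraphₗ T) := by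
  intro x y hxy
  have h : ((inclₗ T).prod (applyₗ T)) x = ((inclₗ T).prod (applyₗ T)) y :=
    (WithLp.linearEquiv 2 ℂ (H × H)).symm.injective hxy
  exact Subtype.ext (congrArg Prod.fst h)

/-- The graph norm `‖v‖² = |v|² + |T v|²`. -/
instance : NormedAddCommGroup (GraphDom T) :=
  NormedAddCommGroup.induced (GraphDom T) (WithLp 2 (H × H)) (toGraphₗ T) (toGraphₗ_injective T)

instance : NormedSpace ℂ (GraphDom T) :=
  NormedSpace.induced ℂ (GraphDom T) (WithLp 2 (H × H)) (toGraphₗ T)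

theorem norm_sq (v : GraphDom T) : ‖v‖ ^ 2 = ‖inclₗ T v‖ ^ 2 + ‖applyₗ T v‖ ^ 2 :=
  WithLp.prod_norm_sq_eq_of_L2 (toGraphₗ T v)

/-- The inclusion of `dom T` into `H`, as a bounded operator. -/
def incl : GraphDom T →L[ℂ] H :=
  (inclₗ T).mkContinuous 1 fun v => by
    have h := norm_sq T v
    have h0 := norm_nonneg v
    rw [one_mul]
    exact abs_le_of_sq_le_sq' (by nlinarith [sq_nonneg ‖applyₗ T v‖]) h0 |>.2

/-- `T` as a bounded operator from `dom T` to `H`. -/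
def apply : GraphDom T →L[ℂ] H :=
  (applyₗ T).mkContinuous 1 fun v => by
    have h := norm_sq T v
    have h0 := norm_nonneg v
    rw [one_mul]
    exact abs_le_of_sq_le_sq' (by nlinarith [sq_nonneg ‖inclₗ T v‖]) h0 |>.2

end GraphDom

variable [CompleteSpace H]

/-- The space `(dom A^*)'`, the dual of `dom A^*` with the graph norm. It is realised by continuous
antilinear functionals, so that the embedding of `H` (identified with its dual) is linear. -/
abbrev Extrap (A : H →ₗ.[ℂ] H) : Type _ := GraphDom A.adjoint →L⋆[ℂ] ℂ

/-- The embedding `H → (dom A^*)'`, `(j x)(v) = ⟨v, x⟩` (antilinear in `v`, linear in `x`). -/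
def embed (A : H →ₗ.[ℂ] H) : H →L[ℂ] Extrap A :=
  ((ContinuousLinearMap.compSL (GraphDom A.adjoint) H ℂ (RingHom.id ℂ) (starRingEnd ℂ)).flip
    (GraphDom.incl A.adjoint)).comp (innerSLFlip ℂ)

/-- The extension `𝒜 = (A^*)' : H → (dom A^*)'` of `A`, `(𝒜 x)(v) = ⟨A^* v, x⟩`. -/
def extend (A : H →ₗ.[ℂ] H) : H →L[ℂ] Extrap A :=
  ((ContinuousLinearMap.compSL (GraphDom A.adjoint) H ℂ (RingHom.id ℂ) (starRingEnd ℂ)).flip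
    (GraphDom.apply A.adjoint)).comp (innerSLFlip ℂ)

theorem embed_apply (A : H →ₗ.[ℂ] H) (x : H) (v : GraphDom A.adjoint) :
    embed A x v = inner ℂ (GraphDom.incl A.adjoint v) x := rfl

theorem extend_apply (A : H →ₗ.[ℂ] H) (x : H) (v : GraphDom A.adjoint) :
    extend A x v = inner ℂ (GraphDom.apply A.adjoint v) x := rfl

/-- The graph of `𝒜`, as an unbounded operator in `(dom A^*)'` with domain `H`. -/
def extendGraph (A : H →ₗ.[ℂ] H) : Set (Extrap A × Extrap A) :=
  Set.range fun x : H => (embed A x, extend A x)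

variable {U : Type*} [NormedAddCommGroup U] [InnerProductSpace ℂ U]

/-- The regularity hypothesis on the pair `(A, B)`, where `S' = e^{𝒜t}`: for every `T > 0` the
transformation `u ↦ ∫_0^t e^{𝒜(t-s)} B u(s) ds` is linear and continuous from `L²(0,T;U)` to
`L²(0,T;H)`. (The integral is a Bochner integral in `(dom A^*)'`.) -/
def RegularityHypothesis (A : H →ₗ.[ℂ] H) (S' : C0Semigroup (Extrap A)) (B : U →L[ℂ] Extrap A) :
    Prop :=
  ∀ T : ℝ, 0 < T →
    ∃ L : Lp U 2 (volume.restrict (Ioo 0 T)) →L[ℂ] Lp H 2 (volume.restrict (Ioo 0 T)),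
      ∀ u : Lp U 2 (volume.restrict (Ioo 0 T)), ∀ᵐ t ∂(volume.restrict (Ioo 0 T)),
        IntervalIntegrable (fun s => S'.op (t - s) (B (u s))) volume 0 t ∧
        embed A (L u t) = ∫ s in (0)..t, S'.op (t - s) (B (u s))

/-- `y ∈ L²(0,T;H)` is the solution of `ẏ = 𝒜 y + B u`, `y(0) = y₀` on `(0,T)`:
`y(t) = e^{At} y₀ + ∫_0^t e^{𝒜(t-s)} B u(s) ds` in `(dom A^*)'`. -/
def IsMildSolution (A : H →ₗ.[ℂ] H) (S : C0Semigroup H) (S' : C0Semigroup (Extrap A))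
    (B : U →L[ℂ] Extrap A) (T : ℝ) (y₀ : H) (u : ℝ → U) (y : ℝ → H) : Prop :=
  MemLp y 2 (volume.restrict (Ioo 0 T)) ∧
    ∀ᵐ t ∂(volume.restrict (Ioo 0 T)),
      IntervalIntegrable (fun s => S'.op (t - s) (B (u s))) volume 0 t ∧
      embed A (y t) = embed A (S.op t y₀) + ∫ s in (0)..t, S'.op (t - s) (B (u s))

end Abstract

/-! ## The coupled parabolic system -/

/-- `L²(0,π;E)`. -/
abbrev L2 (E : Type*) [NormedAddCommGroup E] : Type _ :=
  Lp E 2 (volume.restrict (Ioo (0 : ℝ) Real.pi))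

/-- `g ∈ L²(0,π;E)` is the weak derivative of `f ∈ L²(0,π;E)`. -/
def IsWeakDeriv {E : Type*} [NormedAddCommGroup E] [NormedSpace ℝ E] (f g : L2 E) : Prop :=
  ∀ η : ℝ → ℝ, ContDiff ℝ ((⊤ : ℕ∞) : WithTop ℕ∞) η → HasCompactSupport η → tsupport η ⊆ Ioo 0 Real.pi →
    ∫ x in Ioo (0 : ℝ) Real.pi, deriv η x • f x = -∫ x in Ioo (0 : ℝ) Real.pi, η x • g x

/-- `f` has a representative that is continuous on `[0,π]` and takes the value `v` at `x`. -/
def HasTrace {E : Type*} [NormedAddCommGroup E] (f : L2 E) (x : ℝ) (v : E) : Prop :=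
  ∃ F : ℝ → E, ContinuousOn F (Icc 0 Real.pi) ∧
    (f =ᵐ[volume.restrict (Ioo (0 : ℝ) Real.pi)] F) ∧ F x = v

/-- `f ∈ H²(0,π;E) ∩ H¹₀(0,π;E)`, with weak derivatives `f'` and `f''`. -/
structure IsH2H10 {E : Type*} [NormedAddCommGroup E] [NormedSpace ℝ E] (f f' f'' : L2 E) :
    Prop where
  deriv₁ : IsWeakDeriv f f'
  deriv₂ : IsWeakDeriv f' f''
  trace_zero : HasTrace f 0 0
  trace_pi : HasTrace f Real.pi 0

/-- Pointwise multiplication by a constant `2 × 2` matrix on `L²(0,π)²`. -/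
def matMul {𝕜 : Type*} [RCLike 𝕜] (M : Matrix (Fin 2) (Fin 2) 𝕜) :
    L2 (EuclideanSpace 𝕜 (Fin 2)) →L[𝕜] L2 (EuclideanSpace 𝕜 (Fin 2)) :=
  (Matrix.toEuclideanCLM (n := Fin 2) (𝕜 := 𝕜) M).compLpL 2 _

/-- The state space `H = L²(0,π;ℂ)²`. -/
abbrev StateC : Type := L2 (EuclideanSpace ℂ (Fin 2))

/-- The real space `L²(0,π)²`. -/
abbrev StateR : Type := L2 (EuclideanSpace ℝ (Fin 2))

/-- A real matrix, seen as a complex one. -/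
def matC (A₀ : Matrix (Fin 2) (Fin 2) ℝ) : Matrix (Fin 2) (Fin 2) ℂ := A₀.map Complex.ofReal

/-- The inclusion `ℝ² → ℂ²`. -/
def vecC : EuclideanSpace ℝ (Fin 2) →L[ℝ] EuclideanSpace ℂ (Fin 2) :=
  LinearMap.toContinuousLinearMap
    { toFun := fun v => WithLp.toLp 2 fun i => (v i : ℂ)
      map_add' := fun v w => by ext i; simp
      map_smul' := fun c v => by ext i; simp }

/-- The inclusion `L²(0,π)² → L²(0,π;ℂ)²`. -/
def stateC : StateR →L[ℝ] StateC := vecC.compLpL 2 _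

section WeakDeriv

variable {E : Type*} [NormedAddCommGroup E] [NormedSpace ℝ E]

theorem integrableOn_smul {η : ℝ → ℝ} (hη : Continuous η) (hc : HasCompactSupport η) (f : L2 E) :
    Integrable (fun x => η x • f x) (volume.restrict (Ioo (0 : ℝ) Real.pi)) := by
  have hf : Integrable f (volume.restrict (Ioo (0 : ℝ) Real.pi)) :=
    (Lp.memLp f).integrable (by norm_num)
  obtain ⟨C, hC⟩ := hη.bounded_above_of_compact_support hc
  exact hf.bdd_smul C hη.aestronglyMeasurable (Eventually.of_forall hC)

theorem IsWeakDeriv.add {f g f' g' : L2 E} (hf : IsWeakDeriv f f') (hg : IsWeakDeriv g g') :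
    IsWeakDeriv (f + g) (f' + g') := by
  intro η h1 h2 h3
  have hd : Continuous (deriv η) := h1.continuous_deriv (by simp)
  have e1 : ∫ x in Ioo (0 : ℝ) Real.pi, deriv η x • (f + g) x =
      ∫ x in Ioo (0 : ℝ) Real.pi, (deriv η x • f x + deriv η x • g x) := by
    refine integral_congr_ae ?_
    filter_upwards [Lp.coeFn_add f g] with x hx
    rw [hx, Pi.add_apply, smul_add]
  have e2 : ∫ x in Ioo (0 : ℝ) Real.pi, η x • (f' + g') x =
      ∫ x in Ioo (0 : ℝ) Real.pi, (η x • f' x + η x • g' x) := by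
    refine integral_congr_ae ?_
    filter_upwards [Lp.coeFn_add f' g'] with x hx
    rw [hx, Pi.add_apply, smul_add]
  rw [e1, e2, integral_add (integrableOn_smul hd h2.deriv f) (integrableOn_smul hd h2.deriv g),
    integral_add (integrableOn_smul h1.continuous h2 f') (integrableOn_smul h1.continuous h2 g'),
    hf η h1 h2 h3, hg η h1 h2 h3, neg_add]

theorem IsWeakDeriv.smul {𝕜 : Type*} [RCLike 𝕜] [NormedSpace 𝕜 E] [SMulCommClass ℝ 𝕜 E]
    {f f' : L2 E} (hf : IsWeakDeriv f f') (c : 𝕜) : IsWeakDeriv (c • f) (c • f') := by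
  intro η h1 h2 h3
  have e1 : ∫ x in Ioo (0 : ℝ) Real.pi, deriv η x • (c • f) x =
      ∫ x in Ioo (0 : ℝ) Real.pi, c • (deriv η x • f x) := by
    refine integral_congr_ae ?_
    filter_upwards [Lp.coeFn_smul c f] with x hx
    rw [hx, Pi.smul_apply, smul_comm]
  have e2 : ∫ x in Ioo (0 : ℝ) Real.pi, η x • (c • f') x =
      ∫ x in Ioo (0 : ℝ) Real.pi, c • (η x • f' x) := by
    refine integral_congr_ae ?_
    filter_upwards [Lp.coeFn_smul c f'] with x hx
    rw [hx, Pi.smul_apply, smul_comm]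
  rw [e1, e2, integral_smul, integral_smul, hf η h1 h2 h3, smul_neg]

theorem IsWeakDeriv.zero : IsWeakDeriv (0 : L2 E) 0 := by
  have h0 : ∀ ζ : ℝ → ℝ, ∫ x in Ioo (0 : ℝ) Real.pi, ζ x • (0 : L2 E) x = 0 := by
    intro ζ
    refine integral_eq_zero_of_ae ?_
    filter_upwards [Lp.coeFn_zero E 2 (volume.restrict (Ioo (0 : ℝ) Real.pi))] with x hx
    rw [hx]
    simp
  intro η _ _ _
  rw [h0, h0, neg_zero]

/-- A weak derivative of `0` vanishes. -/
theorem IsWeakDeriv.eq_zero [CompleteSpace E] {g : L2 E} (h : IsWeakDeriv (0 : L2 E) g) :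
    g = 0 := by
  have hint : Integrable g (volume.restrict (Ioo (0 : ℝ) Real.pi)) :=
    (Lp.memLp g).integrable (by norm_num)
  have key : ∀ᵐ x : ℝ, x ∈ Ioo (0 : ℝ) Real.pi → g x = 0 := by
    refine isOpen_Ioo.ae_eq_zero_of_integral_contDiff_smul_eq_zero
      (IntegrableOn.locallyIntegrableOn hint) ?_
    intro η h1 h2 h3
    have h4 := h η h1 h2 h3
    have h5 : ∫ x in Ioo (0 : ℝ) Real.pi, deriv η x • (0 : L2 E) x = 0 := by
      refine integral_eq_zero_of_ae ?_
      filter_upwards [Lp.coeFn_zero E 2 (volume.restrict (Ioo (0 : ℝ) Real.pi))] with x hx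
      rw [hx]
      simp
    rw [h5, eq_comm, neg_eq_zero] at h4
    rw [← h4, setIntegral_eq_integral_of_forall_compl_eq_zero]
    intro x hx
    have : η x = 0 := by
      by_contra hne
      exact hx (h3 (subset_tsupport η hne))
    rw [this, zero_smul]
  refine Lp.ext ?_
  have key' := (ae_restrict_iff' (μ := volume) measurableSet_Ioo).2 key
  filter_upwards [key', Lp.coeFn_zero E 2 (volume.restrict (Ioo (0 : ℝ) Real.pi))] with x hx hx0
  rw [hx, hx0, Pi.zero_apply]

end WeakDeriv

section Trace

variable {E : Type*} [NormedAddCommGroup E]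

theorem HasTrace.add {f g : L2 E} {x : ℝ} {v w : E} (hf : HasTrace f x v) (hg : HasTrace g x w) :
    HasTrace (f + g) x (v + w) := by
  obtain ⟨F, hF, hfF, rfl⟩ := hf
  obtain ⟨G, hG, hgG, rfl⟩ := hg
  exact ⟨F + G, hF.add hG, (Lp.coeFn_add f g).trans (hfF.add hgG), rfl⟩

theorem HasTrace.smul {𝕜 : Type*} [RCLike 𝕜] [NormedSpace 𝕜 E] {f : L2 E} {x : ℝ} {v : E}
    (hf : HasTrace f x v) (c : 𝕜) : HasTrace (c • f) x (c • v) := by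
  obtain ⟨F, hF, hfF, rfl⟩ := hf
  exact ⟨c • F, hF.const_smul c, (Lp.coeFn_smul c f).trans (hfF.const_smul c), rfl⟩

theorem HasTrace.zero (x : ℝ) : HasTrace (0 : L2 E) x 0 :=
  ⟨0, continuousOn_const, Lp.coeFn_zero E 2 _, rfl⟩

end Trace

/-- The graph of the operator `A f = f'' + A₀ f` with
`dom A = H²(0,π;ℂ)² ∩ H¹₀(0,π;ℂ)²`. -/
def parabolicGraph (A₀ : Matrix (Fin 2) (Fin 2) ℝ) : Submodule ℂ (StateC × StateC) where
  carrier := {p | ∃ f' f'' : StateC, IsH2H10 p.1 f' f'' ∧ p.2 = f'' + matMul (matC A₀) p.1}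
  add_mem' := by
    rintro p q ⟨f', f'', hf, hp⟩ ⟨g', g'', hg, hq⟩
    refine ⟨f' + g', f'' + g'', ⟨hf.deriv₁.add hg.deriv₁, hf.deriv₂.add hg.deriv₂, ?_, ?_⟩, ?_⟩
    · simpa using hf.trace_zero.add hg.trace_zero
    · simpa using hf.trace_pi.add hg.trace_pi
    · rw [Prod.snd_add, Prod.fst_add, hp, hq, map_add]
      abel
  zero_mem' := ⟨0, 0, ⟨IsWeakDeriv.zero, IsWeakDeriv.zero, HasTrace.zero _, HasTrace.zero _⟩,
    by simp⟩
  smul_mem' := by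
    rintro c p ⟨f', f'', hf, hp⟩
    refine ⟨c • f', c • f'', ⟨hf.deriv₁.smul c, hf.deriv₂.smul c, ?_, ?_⟩, ?_⟩
    · simpa using hf.trace_zero.smul c
    · simpa using hf.trace_pi.smul c
    · rw [Prod.smul_snd, Prod.smul_fst, hp, map_smul, smul_add]

/-- The operator `A f = f'' + A₀ f` in `H = L²(0,π;ℂ)²` with
`dom A = H²(0,π;ℂ)² ∩ H¹₀(0,π;ℂ)²`. -/
def parabolicOp (A₀ : Matrix (Fin 2) (Fin 2) ℝ) : StateC →ₗ.[ℂ] StateC :=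
  (parabolicGraph A₀).toLinearPMap

/-- The graph of `parabolicOp A₀` is the prescribed one. -/
theorem parabolicOp_graph (A₀ : Matrix (Fin 2) (Fin 2) ℝ) :
    (parabolicOp A₀).graph = parabolicGraph A₀ := by
  refine Submodule.toLinearPMap_graph_eq _ ?_
  rintro ⟨f, g⟩ ⟨f', f'', hf, hg⟩ h0
  obtain rfl : f = 0 := h0
  have h1 : f' = 0 := hf.deriv₁.eq_zero
  subst h1
  have h2 : f'' = 0 := hf.deriv₂.eq_zero
  subst h2
  simpa using hg

/-- No number `ω + k²`, `k = 1, 2, …`, is an eigenvalue of `A₀`. -/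
def NonResonant (A₀ : Matrix (Fin 2) (Fin 2) ℝ) (ω : ℂ) : Prop :=
  ∀ k : ℕ, 1 ≤ k → (Matrix.scalar (Fin 2) (ω + (k : ℂ) ^ 2) - matC A₀).det ≠ 0

/-- `h ∈ C²([0,π];ℂ²)` solves `h'' + A₀ h = ω h` in `(0,π)`, `h(0) = a B₀`, `h(π) = 0`. -/
structure IsDirichletLift (A₀ : Matrix (Fin 2) (Fin 2) ℝ) (B₀ : EuclideanSpace ℝ (Fin 2)) (ω a : ℂ)
    (h : ℝ → EuclideanSpace ℂ (Fin 2)) : Prop where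
  contDiffOn : ContDiffOn ℝ 2 h (Icc 0 Real.pi)
  ode : ∀ x ∈ Ioo (0 : ℝ) Real.pi,
    deriv (deriv h) x + Matrix.toEuclideanCLM (n := Fin 2) (𝕜 := ℂ) (matC A₀) (h x) = ω • h x
  at_zero : h 0 = a • vecC B₀
  at_pi : h Real.pi = 0

/-- `φ ∈ L²(0,T;H²(0,π)²) ∩ C([0,T];H¹₀(0,π)²)` is the strong solution of the backward problem
`-φ_t - φ_xx = A₀^* φ + g` in `(0,π) × (0,T)`, `φ(0,·) = φ(π,·) = 0`, `φ(·,T) = 0`,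
with spatial derivative `φx`; functions on `(0,π) × (0,T)` are regarded as functions of
`t` with values in `L²(0,π)²`. -/
structure IsStrongAdjointSolution (A₀ : Matrix (Fin 2) (Fin 2) ℝ) (T : ℝ)
    (g φ φx : ℝ → StateR) : Prop where
  /-- `φ ∈ C([0,T];H¹₀)` -/
  deriv_x : ∀ t ∈ Icc 0 T, IsWeakDeriv (φ t) (φx t)
  trace_zero : ∀ t ∈ Icc 0 T, HasTrace (φ t) 0 0
  trace_pi : ∀ t ∈ Icc 0 T, HasTrace (φ t) Real.pi 0
  cont : ContinuousOn φ (Icc 0 T)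
  cont_x : ContinuousOn φx (Icc 0 T)
  /-- `φ ∈ L²(0,T;H²)`, `φ_t ∈ L²(0,T;L²)` and the equation holds almost everywhere -/
  eqn : ∃ φxx φt : ℝ → StateR,
    MemLp φxx 2 (volume.restrict (Ioo 0 T)) ∧ MemLp φt 2 (volume.restrict (Ioo 0 T)) ∧
    (∀ᵐ t ∂(volume.restrict (Ioo 0 T)), IsWeakDeriv (φx t) (φxx t)) ∧
    (∀ t ∈ Icc 0 T, φ t = φ 0 + ∫ s in (0)..t, φt s) ∧
    ∀ᵐ t ∂(volume.restrict (Ioo 0 T)), -φt t - φxx t = matMul A₀.transpose (φ t) + g t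
  final : φ T = 0

/-- `y ∈ L²(0,T;L²(0,π)²) = L²(Q)²` is a solution by transposition of the boundary control system
`y_t - y_xx = A₀ y` in `Q = (0,π) × (0,T)`, `y(0,·) = B₀ u`, `y(π,·) = 0`, `y(·,0) = y₀`:
`∫_Q y · g dx dt = ⟨y₀, φ(·,0)⟩ + ∫_0^T B₀ · φ_x(0,t) u(t) dt` for every `g ∈ L²(Q)²`, where `φ` is
the strong solution of the backward problem with right-hand side `g`. -/
def IsTranspositionSolution (A₀ : Matrix (Fin 2) (Fin 2) ℝ) (B₀ : EuclideanSpace ℝ (Fin 2))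
    (T : ℝ) (y₀ : StateR) (u : ℝ → ℝ) (y : ℝ → StateR) : Prop :=
  MemLp y 2 (volume.restrict (Ioo 0 T)) ∧
    ∀ g : ℝ → StateR, MemLp g 2 (volume.restrict (Ioo 0 T)) →
      ∀ (φ φx : ℝ → StateR) (p : ℝ → EuclideanSpace ℝ (Fin 2)),
        IsStrongAdjointSolution A₀ T g φ φx →
        (∀ᵐ t ∂(volume.restrict (Ioo 0 T)), HasTrace (φx t) 0 (p t)) →
        ∫ t in Ioo 0 T, inner ℝ (y t) (g t) =
          inner ℝ y₀ (φ 0) + ∫ t in Ioo 0 T, inner ℝ B₀ (p t) * u t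

end BoundaryControl

end

/-!
Everything is diagonal in the sine functions: on the `k`-th coefficient `A` acts as the matrix
`A₀ - (k+1)²`, so the semigroup, the resolvent and the domain are read off coefficientwise and
Parseval's identity reduces each norm estimate to the decay of `e^{-t(k+1)²}`.

The `k`-th coefficient of the Dirichlet lift of `aB₀` is a constant multiple of
`(k+1)(ω - A₀ + (k+1)²)⁻¹ aB₀`, because the boundary value survives the integration by parts that
moves `∂ₓₓ` onto the sine. Hence `(ω - 𝒜)D_ω` does not depend on `ω`, and `A e^{At}D_ω` is, up to
`ω e^{At}D_ω`, the kernel with coefficients `(k+1)e^{t(A₀-(k+1)²)}B₀`. Since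
`∑ (k+1)² e^{-2t(k+1)²}` is `O(t^{-2(1-θ)})` as `t → 0` for `θ < 1/4`, this kernel is integrable in
time with values in `L²`, and Young's inequality gives the `L²` regularity of the control-to-state
map. The isomorphism `ω - 𝒜` from `H` onto `(dom A^*)'` conjugates `e^{At}` into `e^{𝒜t}`, which
carries this over to the extrapolation space.

The mild solution is the solution by transposition by duality on each mode, summed with Parseval;
uniqueness follows by testing against sources supported on a single mode. Finally, `A₀ - (k+1)²` is
stable for all but finitely many `k`; the finitely many remaining modes span `H₁`.
-/

open MeasureTheory Set Filter Topology

noncomputable section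

namespace BoundaryControl

/-! ## Primitives of integrable functions -/

section Primitive

variable {E F G : Type*} [NormedAddCommGroup E] [NormedSpace ℝ E] [NormedAddCommGroup F]
  [NormedSpace ℝ F] [NormedAddCommGroup G] [NormedSpace ℝ G] {a b : ℝ}

/-- `f` is a primitive of the integrable function `f'` on the interval with end points `a`, `b`.
This is how absolutely continuous functions with values in a Banach space are handled: `f'` is the
derivative of `f` almost everywhere, but the integral identity is what the arguments use. -/
structure IsPrimitiveOn (f f' : ℝ → E) (a b : ℝ) : Prop where
  intervalIntegrable : IntervalIntegrable f' volume a b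
  eq_add_integral : ∀ t ∈ uIcc a b, f t = f a + ∫ s in a..t, f' s

theorem isPrimitiveOn_const_add_integral {f' : ℝ → E} (hf' : IntervalIntegrable f' volume a b)
    (c : E) : IsPrimitiveOn (fun t => c + ∫ s in a..t, f' s) f' a b :=
  ⟨hf', fun t _ => by rw [intervalIntegral.integral_same, add_zero]⟩

theorem absolutelyContinuousOnInterval_of_dist_le_integral {X : Type*} [PseudoMetricSpace X]
    {f : ℝ → X} {m : ℝ → ℝ} (hm : IntervalIntegrable m volume a b)
    (h : ∀ x ∈ uIcc a b, ∀ y ∈ uIcc a b, x ≤ y → dist (f x) (f y) ≤ ∫ t in x..y, m t) :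
    AbsolutelyContinuousOnInterval f a b := by
  have hprim := hm.absolutelyContinuousOnInterval_intervalIntegral left_mem_uIcc
  have hdist : ∀ x ∈ uIcc a b, ∀ y ∈ uIcc a b,
      dist (f x) (f y) ≤ dist (∫ t in a..x, m t) (∫ t in a..y, m t) := by
    intro x hx y hy
    rw [Real.dist_eq, intervalIntegral.integral_interval_sub_left
      (hm.mono_set (uIcc_subset_uIcc_left hx)) (hm.mono_set (uIcc_subset_uIcc_left hy))]
    rcases le_total x y with hxy | hyx
    · rw [intervalIntegral.integral_symm, abs_neg]
      exact (h x hx y hy hxy).trans (le_abs_self _)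
    · rw [dist_comm]
      exact (h y hy x hx hyx).trans (le_abs_self _)
  refine squeeze_zero' (Eventually.of_forall fun _ => Finset.sum_nonneg fun _ _ => dist_nonneg)
    ?_ hprim
  filter_upwards [mem_inf_of_right (mem_principal_self _)] with I hI
  exact Finset.sum_le_sum fun i hi => hdist _ (hI.1 i hi).1 _ (hI.1 i hi).2

namespace IsPrimitiveOn

variable {f f' : ℝ → E} {g g' : ℝ → F}

theorem integral_eq_sub (hf : IsPrimitiveOn f f' a b) : ∫ t in a..b, f' t = f b - f a := by
  rw [hf.eq_add_integral b right_mem_uIcc, add_sub_cancel_left]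

theorem mono (hf : IsPrimitiveOn f f' a b) {t : ℝ} (ht : t ∈ uIcc a b) :
    IsPrimitiveOn f f' a t :=
  have hsub : uIcc a t ⊆ uIcc a b := uIcc_subset_uIcc_left ht
  ⟨hf.intervalIntegrable.mono_set hsub, fun s hs => hf.eq_add_integral s (hsub hs)⟩

theorem integral_eq_sub_of_mem (hf : IsPrimitiveOn f f' a b) {x y : ℝ} (hx : x ∈ uIcc a b)
    (hy : y ∈ uIcc a b) : ∫ t in y..x, f' t = f x - f y := by
  rw [← intervalIntegral.integral_interval_sub_left (a := a)
    (hf.mono hx).intervalIntegrable (hf.mono hy).intervalIntegrable,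
    (hf.mono hx).integral_eq_sub, (hf.mono hy).integral_eq_sub, sub_sub_sub_cancel_right]

theorem dist_le_integral_norm (hf : IsPrimitiveOn f f' a b) {x y : ℝ} (hx : x ∈ uIcc a b)
    (hy : y ∈ uIcc a b) (hxy : x ≤ y) : dist (f x) (f y) ≤ ∫ t in x..y, ‖f' t‖ := by
  rw [dist_eq_norm', ← hf.integral_eq_sub_of_mem hy hx]
  exact intervalIntegral.norm_integral_le_integral_norm hxy

theorem absolutelyContinuousOnInterval (hf : IsPrimitiveOn f f' a b) :
    AbsolutelyContinuousOnInterval f a b :=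
  absolutelyContinuousOnInterval_of_dist_le_integral hf.intervalIntegrable.norm
    fun _ hx _ hy => hf.dist_le_integral_norm hx hy

theorem continuousOn (hf : IsPrimitiveOn f f' a b) : ContinuousOn f (uIcc a b) :=
  hf.absolutelyContinuousOnInterval.continuousOn

theorem continuousOn_Icc (hf : IsPrimitiveOn f f' a b) (hab : a ≤ b) :
    ContinuousOn f (Icc a b) :=
  uIcc_of_le hab ▸ hf.continuousOn

theorem ae_hasDerivAt [CompleteSpace E] (hf : IsPrimitiveOn f f' a b) :
    ∀ᵐ t, t ∈ uIoo a b → HasDerivAt f (f' t) t := by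
  filter_upwards [hf.intervalIntegrable.ae_hasDerivAt_integral] with t ht hmem
  have hprim := ht (uIoo_subset_uIcc_self hmem) a left_mem_uIcc
  refine (hprim.const_add (f a)).congr_of_eventuallyEq ?_
  filter_upwards [isOpen_Ioo.mem_nhds hmem] with s hs
  exact hf.eq_add_integral s (uIoo_subset_uIcc_self hs)

theorem of_ae_hasDerivAt [CompleteSpace E] (hac : AbsolutelyContinuousOnInterval f a b)
    (hf' : IntervalIntegrable f' volume a b)
    (hderiv : ∀ᵐ t, t ∈ uIoo a b → HasDerivAt f (f' t) t) : IsPrimitiveOn f f' a b := by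
  have hprim := isPrimitiveOn_const_add_integral hf' (f a)
  have hzero : ∀ᵐ t, t ∈ uIcc a b → HasDerivAt (f - fun t => f a + ∫ s in a..t, f' s) 0 t := by
    filter_upwards [hderiv, hprim.ae_hasDerivAt, Measure.ae_ne volume a, Measure.ae_ne volume b]
      with t hft hpt hta htb ht
    have hmem : t ∈ uIoo a b := by grind [uIoo, uIcc]
    simpa only [sub_self] using (hft hmem).sub (hpt hmem)
  obtain ⟨c, hc⟩ :=
    (hac.sub hprim.absolutelyContinuousOnInterval).const_of_ae_hasDerivAt_zero hzero
  have hc₀ : c = 0 := by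
    rw [← hc a left_mem_uIcc, Pi.sub_apply, intervalIntegral.integral_same, add_zero, sub_self]
  exact ⟨hf', fun t ht => sub_eq_zero.1 ((hc t ht).trans hc₀)⟩

theorem of_continuousOn [CompleteSpace E] (hf : ContinuousOn f (uIcc a b))
    (hf' : ContinuousOn f' (uIcc a b)) (hderiv : ∀ t ∈ uIoo a b, HasDerivAt f (f' t) t) :
    IsPrimitiveOn f f' a b := by
  refine ⟨hf'.intervalIntegrable, fun t ht => ?_⟩
  have hsub : uIcc a t ⊆ uIcc a b := uIcc_subset_uIcc_left ht
  rw [intervalIntegral.integral_eq_sub_of_hasDeriv_right (hf.mono hsub)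
    (fun s hs => (hderiv s (by grind [uIoo, uIcc])).hasDerivWithinAt)
    (hf'.mono hsub).intervalIntegrable, add_sub_cancel]

theorem of_hasDerivAt [CompleteSpace E] (hderiv : ∀ t, HasDerivAt f (f' t) t)
    (hf' : Continuous f') : IsPrimitiveOn f f' a b :=
  of_continuousOn (fun t _ => (hderiv t).continuousAt.continuousWithinAt) hf'.continuousOn
    fun t _ => hderiv t

theorem congr_ae (hf : IsPrimitiveOn f f' a b) {f'' : ℝ → E}
    (h : f' =ᵐ[volume.restrict (uIoc a b)] f'') : IsPrimitiveOn f f'' a b := by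
  refine ⟨hf.intervalIntegrable.congr_ae h, fun t ht => ?_⟩
  rw [hf.eq_add_integral t ht, intervalIntegral.integral_congr_ae_restrict
    (ae_restrict_of_ae_restrict_of_subset
      (uIoc_subset_uIoc_of_uIcc_subset_uIcc (uIcc_subset_uIcc_left ht)) h)]

theorem clm_comp [CompleteSpace E] [CompleteSpace F] (hf : IsPrimitiveOn f f' a b)
    (L : E →L[ℝ] F) : IsPrimitiveOn (fun t => L (f t)) (fun t => L (f' t)) a b := by
  refine ⟨⟨L.integrable_comp hf.intervalIntegrable.1, L.integrable_comp hf.intervalIntegrable.2⟩,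
    fun t ht => ?_⟩
  rw [L.intervalIntegral_comp_comm (hf.mono ht).intervalIntegrable, ← map_add,
    ← hf.eq_add_integral t ht]

end IsPrimitiveOn

theorem intervalIntegrable_bilin (B : E →L[ℝ] F →L[ℝ] G) {f : ℝ → E} {g : ℝ → F}
    (hf : IntervalIntegrable f volume a b) (hg : ContinuousOn g (uIcc a b)) :
    IntervalIntegrable (fun t => B (f t) (g t)) volume a b := by
  rw [intervalIntegrable_iff] at hf ⊢
  obtain ⟨C, hC⟩ := isCompact_uIcc.exists_bound_of_continuousOn hg
  refine B.integrable_of_bilin_of_bdd_right C hf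
    ((hg.mono uIoc_subset_uIcc).aestronglyMeasurable measurableSet_uIoc) ?_
  exact ae_restrict_of_forall_mem measurableSet_uIoc fun t ht => hC t (uIoc_subset_uIcc ht)

theorem dist_bilin_le (B : E →L[ℝ] F →L[ℝ] G) {x₁ x₂ : E} {y₁ y₂ : F} {C D : ℝ}
    (hx : ‖x₂‖ ≤ C) (hy : ‖y₁‖ ≤ D) :
    dist (B x₁ y₁) (B x₂ y₂) ≤ ‖B‖ * D * dist x₁ x₂ + ‖B‖ * C * dist y₁ y₂ := by
  have hsplit : B x₁ y₁ - B x₂ y₂ = B (x₁ - x₂) y₁ + B x₂ (y₁ - y₂) := by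
    simp only [map_sub, sub_apply]
    abel
  rw [dist_eq_norm, dist_eq_norm, dist_eq_norm, hsplit]
  refine norm_add_le_of_le ((B.le_opNorm₂ _ _).trans ?_) ((B.le_opNorm₂ _ _).trans ?_)
  · rw [mul_right_comm]
    gcongr
  · gcongr

namespace IsPrimitiveOn

variable {f f' : ℝ → E} {g g' : ℝ → F}

theorem absolutelyContinuousOnInterval_bilin (hf : IsPrimitiveOn f f' a b)
    (hg : IsPrimitiveOn g g' a b) (B : E →L[ℝ] F →L[ℝ] G) :
    AbsolutelyContinuousOnInterval (fun t => B (f t) (g t)) a b := by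
  obtain ⟨C, hC⟩ := hf.absolutelyContinuousOnInterval.exists_bound
  obtain ⟨D, hD⟩ := hg.absolutelyContinuousOnInterval.exists_bound
  have hC₀ : 0 ≤ C := (norm_nonneg _).trans (hC a left_mem_uIcc)
  have hD₀ : 0 ≤ D := (norm_nonneg _).trans (hD a left_mem_uIcc)
  have hf' := hf.intervalIntegrable.norm.const_mul (‖B‖ * D)
  have hg' := hg.intervalIntegrable.norm.const_mul (‖B‖ * C)
  refine absolutelyContinuousOnInterval_of_dist_le_integral (hf'.add hg') fun x hx y hy hxy => ?_
  have hsub : uIcc x y ⊆ uIcc a b := uIcc_subset_uIcc hx hy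
  rw [intervalIntegral.integral_add (hf'.mono_set hsub) (hg'.mono_set hsub),
    intervalIntegral.integral_const_mul, intervalIntegral.integral_const_mul]
  refine (dist_bilin_le B (hC y hy) (hD x hx)).trans ?_
  gcongr
  exacts [hf.dist_le_integral_norm hx hy hxy, hg.dist_le_integral_norm hx hy hxy]

variable [CompleteSpace E] [CompleteSpace F] [CompleteSpace G]

theorem bilin (hf : IsPrimitiveOn f f' a b) (hg : IsPrimitiveOn g g' a b)
    (B : E →L[ℝ] F →L[ℝ] G) :
    IsPrimitiveOn (fun t => B (f t) (g t)) (fun t => B (f' t) (g t) + B (f t) (g' t)) a b := by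
  refine of_ae_hasDerivAt (hf.absolutelyContinuousOnInterval_bilin hg B)
    ((intervalIntegrable_bilin B hf.intervalIntegrable hg.continuousOn).add
      (intervalIntegrable_bilin B.flip hg.intervalIntegrable hf.continuousOn)) ?_
  filter_upwards [hf.ae_hasDerivAt, hg.ae_hasDerivAt] with t hft hgt ht
  rw [add_comm]
  exact B.hasDerivAt_of_bilinear (fun _ => hft ht) fun _ => hgt ht

theorem integral_deriv_smul {φ φ' : ℝ → ℝ} (hφ : IsPrimitiveOn φ φ' a b)
    (hf : IsPrimitiveOn f f' a b) :
    ∫ t in a..b, φ' t • f t = φ b • f b - φ a • f a - ∫ t in a..b, φ t • f' t := by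
  have hparts := (hφ.bilin hf (ContinuousLinearMap.lsmul ℝ ℝ)).integral_eq_sub
  simp only [ContinuousLinearMap.lsmul_apply] at hparts
  rw [← hparts, intervalIntegral.integral_add
    (hφ.intervalIntegrable.smul_continuousOn hf.continuousOn)
    (hf.intervalIntegrable.continuousOn_smul hφ.continuousOn), add_sub_cancel_right]

theorem integral_deriv_deriv_smul {φ φ' φ'' : ℝ → ℝ} {f'' : ℝ → E} (hφ : IsPrimitiveOn φ φ' a b)
    (hφ' : IsPrimitiveOn φ' φ'' a b) (hf : IsPrimitiveOn f f' a b)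
    (hf' : IsPrimitiveOn f' f'' a b) :
    ∫ t in a..b, φ'' t • f t =
      φ' b • f b - φ' a • f a - (φ b • f' b - φ a • f' a) + ∫ t in a..b, φ t • f'' t := by
  rw [hφ'.integral_deriv_smul hf, hφ.integral_deriv_smul hf']
  abel

end IsPrimitiveOn

end Primitive

/-! ## Completeness of the sine functions -/

section SineComplete

variable {E : Type*} [NormedAddCommGroup E] [NormedSpace ℝ E] {f : ℝ → E}

theorem integrableOn_Ioo_smul {a b : ℝ} {η : ℝ → ℝ} (hη : ContinuousOn η (Icc a b))
    (hf : IntegrableOn f (Ioo a b)) : IntegrableOn (fun x => η x • f x) (Ioo a b) :=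
  IntegrableOn.continuousOn_smul_of_subset hη hf isCompact_Icc measurableSet_Ioo Ioo_subset_Icc_self

theorem cos_mul_sin_natCast_mul {k : ℕ} (hk : 1 ≤ k) (x : ℝ) :
    Real.cos x * Real.sin (k * x) =
      2⁻¹ * (Real.sin ((k + 1 : ℕ) * x) + Real.sin ((k - 1 : ℕ) * x)) := by
  rw [Nat.cast_add, Nat.cast_sub hk, Nat.cast_one, add_mul, sub_mul, one_mul, Real.sin_add,
    Real.sin_sub]
  ring

theorem integral_cos_pow_mul_sin_smul (hf : IntegrableOn f (Ioo 0 Real.pi))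
    (h : ∀ k : ℕ, ∫ x in Ioo 0 Real.pi, Real.sin (k * x) • f x = 0) (n k : ℕ) :
    ∫ x in Ioo 0 Real.pi, (Real.cos x ^ n * Real.sin (k * x)) • f x = 0 := by
  induction n generalizing k with
  | zero => simpa only [pow_zero, one_mul] using h k
  | succ n ih =>
    rcases Nat.eq_zero_or_pos k with rfl | hk
    · simp
    have hsplit : ∀ x : ℝ, (Real.cos x ^ (n + 1) * Real.sin (k * x)) • f x =
        (2⁻¹ : ℝ) • ((Real.cos x ^ n * Real.sin ((k + 1 : ℕ) * x)) • f x +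
          (Real.cos x ^ n * Real.sin ((k - 1 : ℕ) * x)) • f x) := fun x => by
      rw [← add_smul, smul_smul, pow_succ, mul_assoc, cos_mul_sin_natCast_mul hk, ← mul_add,
        mul_left_comm]
    simp_rw [hsplit]
    rw [integral_smul, integral_add (integrableOn_Ioo_smul (by fun_prop) hf)
      (integrableOn_Ioo_smul (by fun_prop) hf), ih, ih, add_zero, smul_zero]

theorem integral_polynomial_cos_mul_sin_smul (hf : IntegrableOn f (Ioo 0 Real.pi))
    (h : ∀ k : ℕ, ∫ x in Ioo 0 Real.pi, Real.sin (k * x) • f x = 0) (p : Polynomial ℝ) :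
    ∫ x in Ioo 0 Real.pi, (p.eval (Real.cos x) * Real.sin x) • f x = 0 := by
  induction p using Polynomial.induction_on' with
  | add p q hp hq =>
    simp_rw [Polynomial.eval_add, add_mul, add_smul]
    rw [integral_add (integrableOn_Ioo_smul (by fun_prop) hf)
      (integrableOn_Ioo_smul (by fun_prop) hf), hp, hq, add_zero]
  | monomial n c =>
    have hmono := integral_cos_pow_mul_sin_smul hf h n 1
    simp only [Nat.cast_one, one_mul] at hmono
    simp_rw [Polynomial.eval_monomial, mul_assoc, mul_smul c]
    rw [integral_smul, hmono, smul_zero]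

theorem norm_integral_smul_le_of_abs_le {a b ε : ℝ} (hf : IntegrableOn f (Ioo a b)) {η : ℝ → ℝ}
    (hη : ∀ x ∈ Ioo a b, |η x| ≤ ε) :
    ‖∫ x in Ioo a b, η x • f x‖ ≤ ε * ∫ x in Ioo a b, ‖f x‖ := by
  rw [← integral_const_mul]
  refine norm_integral_le_of_norm_le (hf.norm.const_mul ε) ?_
  filter_upwards [ae_restrict_mem measurableSet_Ioo] with x hx
  rw [norm_smul, Real.norm_eq_abs]
  gcongr
  exact hη x hx

theorem integral_continuous_mul_sin_smul (hf : IntegrableOn f (Ioo 0 Real.pi))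
    (h : ∀ k : ℕ, ∫ x in Ioo 0 Real.pi, Real.sin (k * x) • f x = 0) {η : ℝ → ℝ}
    (hη : Continuous η) : ∫ x in Ioo 0 Real.pi, (η x * Real.sin x) • f x = 0 := by
  have hbound : ∀ ε > 0, ‖∫ x in Ioo 0 Real.pi, (η x * Real.sin x) • f x‖ ≤
      ε * ∫ x in Ioo 0 Real.pi, ‖f x‖ := by
    intro ε hε
    -- Weierstrass approximation of `η ∘ arccos`, since polynomials in `cos` are already handled
    obtain ⟨p, hp⟩ := exists_polynomial_near_of_continuousOn (-1) 1 (fun y => η (Real.arccos y))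
      (by fun_prop) ε hε
    have hsub : ∫ x in Ioo 0 Real.pi, (η x * Real.sin x) • f x =
        ∫ x in Ioo 0 Real.pi, ((η x - p.eval (Real.cos x)) * Real.sin x) • f x := by
      simp_rw [sub_mul, sub_smul]
      rw [integral_sub (integrableOn_Ioo_smul (by fun_prop) hf)
        (integrableOn_Ioo_smul (by fun_prop) hf),
        integral_polynomial_cos_mul_sin_smul hf h, sub_zero]
    rw [hsub]
    refine norm_integral_smul_le_of_abs_le hf fun x hx => ?_
    have hnear := hp (Real.cos x) ⟨Real.neg_one_le_cos x, Real.cos_le_one x⟩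
    rw [Real.arccos_cos hx.1.le hx.2.le, abs_sub_comm] at hnear
    rw [abs_mul]
    exact (mul_le_of_le_one_right (abs_nonneg _) (Real.abs_sin_le_one x)).trans hnear.le
  have hlim : Tendsto (fun ε : ℝ => ε * ∫ x in Ioo 0 Real.pi, ‖f x‖) (𝓝[>] 0) (𝓝 0) := by
    have hcont : Continuous fun ε : ℝ => ε * ∫ x in Ioo 0 Real.pi, ‖f x‖ := by fun_prop
    simpa only [zero_mul] using (hcont.tendsto 0).mono_left nhdsWithin_le_nhds
  exact norm_le_zero_iff.1 (ge_of_tendsto hlim (eventually_nhdsWithin_of_forall hbound))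

theorem ae_eq_zero_of_integral_sin_smul_eq_zero [CompleteSpace E]
    (hf : IntegrableOn f (Ioo 0 Real.pi))
    (h : ∀ k : ℕ, ∫ x in Ioo 0 Real.pi, Real.sin (k * x) • f x = 0) :
    f =ᵐ[volume.restrict (Ioo 0 Real.pi)] 0 := by
  have hsin : IntegrableOn (fun x => Real.sin x • f x) (Ioo 0 Real.pi) :=
    integrableOn_Ioo_smul (by fun_prop) hf
  have hzero : ∀ᵐ x : ℝ, x ∈ Ioo (0 : ℝ) Real.pi → Real.sin x • f x = 0 := by
    refine isOpen_Ioo.ae_eq_zero_of_integral_contDiff_smul_eq_zero hsin.locallyIntegrableOn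
      fun η hη _ hsupp => ?_
    rw [← integral_continuous_mul_sin_smul hf h hη.continuous,
      setIntegral_eq_integral_of_forall_compl_eq_zero]
    · simp_rw [mul_smul]
    · intro x hx
      rw [image_eq_zero_of_notMem_tsupport (fun hmem => hx (hsupp hmem)), zero_mul, zero_smul]
  filter_upwards [(ae_restrict_iff' measurableSet_Ioo).2 hzero,
    ae_restrict_mem measurableSet_Ioo] with x hx hmem
  exact (smul_eq_zero.1 hx).resolve_left (Real.sin_pos_of_pos_of_lt_pi hmem.1 hmem.2).ne'

end SineComplete

/-! ## Weak derivatives and absolutely continuous representatives -/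

section Interval

variable {E : Type*} [NormedAddCommGroup E] {a b : ℝ}

theorem integral_Ioo_eq_intervalIntegral [NormedSpace ℝ E] (hab : a ≤ b) (f : ℝ → E) :
    ∫ x in Ioo a b, f x = ∫ x in a..b, f x := by
  rw [intervalIntegral.integral_of_le hab, integral_Ioc_eq_integral_Ioo]

theorem intervalIntegrable_of_integrableOn_Ioo {f : ℝ → E} (hab : a ≤ b)
    (hf : IntegrableOn f (Ioo a b)) : IntervalIntegrable f volume a b :=
  (intervalIntegrable_iff_integrableOn_Ioo_of_le hab).2 hf

theorem L2_integrableOn (f : L2 E) : IntegrableOn f (Ioo 0 Real.pi) :=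
  (Lp.memLp f).integrable one_le_two

theorem L2_intervalIntegrable (f : L2 E) : IntervalIntegrable f volume 0 Real.pi :=
  intervalIntegrable_of_integrableOn_Ioo Real.pi_pos.le (L2_integrableOn f)

theorem memLp_of_continuousOn_Icc {F : ℝ → E} (hF : ContinuousOn F (Icc a b)) :
    MemLp F 2 (volume.restrict (Ioo a b)) := by
  obtain ⟨C, hC⟩ := isCompact_Icc.exists_bound_of_continuousOn hF
  exact MemLp.of_bound ((hF.mono Ioo_subset_Icc_self).aestronglyMeasurable measurableSet_Ioo) C
    (ae_restrict_of_forall_mem measurableSet_Ioo fun x hx => hC x (Ioo_subset_Icc_self hx))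

theorem eq_of_ae_eq_of_continuousOn {F G : ℝ → E} (hab : a < b) (hF : ContinuousOn F (Icc a b))
    (hG : ContinuousOn G (Icc a b)) (h : F =ᵐ[volume.restrict (Ioo a b)] G) :
    EqOn F G (Icc a b) := by
  have hIoo : EqOn F G (Ioo a b) := Measure.eqOn_open_of_ae_eq h isOpen_Ioo
    (hF.mono Ioo_subset_Icc_self) (hG.mono Ioo_subset_Icc_self)
  exact hIoo.of_subset_closure hF hG Ioo_subset_Icc_self (closure_Ioo hab.ne).ge

theorem HasTrace.eq_of_ae_eq {f : L2 E} {x : ℝ} {v : E} (h : HasTrace f x v)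
    (hx : x ∈ Icc 0 Real.pi) {F : ℝ → E} (hF : ContinuousOn F (Icc 0 Real.pi))
    (hfF : f =ᵐ[volume.restrict (Ioo 0 Real.pi)] F) : F x = v := by
  obtain ⟨G, hG, hfG, rfl⟩ := h
  exact eq_of_ae_eq_of_continuousOn Real.pi_pos hF hG (hfF.symm.trans hfG) hx

end Interval

section TestFunction

variable {a b : ℝ} {η θ : ℝ → ℝ}

/-- Smooth functions with compact support in the open interval with end points `a` and `b`; these
are the functions against which `IsWeakDeriv` tests. -/
structure IsTestFunction (η : ℝ → ℝ) (a b : ℝ) : Prop where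
  contDiff : ContDiff ℝ ((⊤ : ℕ∞) : WithTop ℕ∞) η
  hasCompactSupport : HasCompactSupport η
  tsupport_subset : tsupport η ⊆ Ioo a b

namespace IsTestFunction

theorem eq_zero_of_notMem (hη : IsTestFunction η a b) {x : ℝ} (hx : x ∉ Ioo a b) : η x = 0 :=
  image_eq_zero_of_notMem_tsupport fun hmem => hx (hη.tsupport_subset hmem)

theorem integrable (hη : IsTestFunction η a b) : Integrable η :=
  hη.contDiff.continuous.integrable_of_hasCompactSupport hη.hasCompactSupport

theorem setIntegral_smul_eq_integral {E : Type*} [NormedAddCommGroup E] [NormedSpace ℝ E]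
    (hη : IsTestFunction η a b) (f : ℝ → E) :
    ∫ x in Ioo a b, η x • f x = ∫ x, η x • f x :=
  setIntegral_eq_integral_of_forall_compl_eq_zero fun x hx => by
    rw [hη.eq_zero_of_notMem hx, zero_smul]

theorem sub_const_smul (hη : IsTestFunction η a b) (hθ : IsTestFunction θ a b) (c : ℝ) :
    IsTestFunction (η - c • θ) a b where
  contDiff := hη.contDiff.sub (hθ.contDiff.const_smul c)
  hasCompactSupport := hη.hasCompactSupport.sub hθ.hasCompactSupport.smul_left
  tsupport_subset := (tsupport_sub η (c • θ)).trans (union_subset hη.tsupport_subset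
    ((tsupport_smul_subset_right (fun _ => c) θ).trans hθ.tsupport_subset))

theorem exists_integral_eq_one (hab : a < b) : ∃ θ, IsTestFunction θ a b ∧ ∫ x, θ x = 1 := by
  let bump : ContDiffBump ((a + b) / 2) :=
    ⟨(b - a) / 8, (b - a) / 4, by linarith, by linarith⟩
  refine ⟨bump.normed volume, ⟨bump.contDiff_normed, bump.hasCompactSupport_normed, ?_⟩,
    bump.integral_normed⟩
  rw [bump.tsupport_normed_eq, Real.closedBall_eq_Icc]
  exact Icc_subset_Ioo (by simp only [bump]; linarith) (by simp only [bump]; linarith)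

theorem exists_tsupport_subset_Icc (hη : IsTestFunction η a b) :
    ∃ α β, tsupport η ⊆ Icc α β ∧ Icc α β ⊆ Ioo a b := by
  rcases (tsupport η).eq_empty_or_nonempty with hempty | hne
  · exact ⟨1, 0, by simp [hempty], by simp⟩
  · obtain ⟨α, hα, hα_le⟩ := hη.hasCompactSupport.isCompact.exists_isLeast hne
    obtain ⟨β, hβ, hβ_le⟩ := hη.hasCompactSupport.isCompact.exists_isGreatest hne
    exact ⟨α, β, fun x hx => ⟨hα_le hx, hβ_le hx⟩,
      Icc_subset_Ioo (hη.tsupport_subset hα).1 (hη.tsupport_subset hβ).2⟩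

theorem setIntegral_Iic_eq_zero {K : Set ℝ} (hK : K.OrdConnected) (hθK : tsupport θ ⊆ K)
    (h₀ : ∫ x, θ x = 0) {x : ℝ} (hx : x ∉ K) : ∫ s in Iic x, θ s = 0 := by
  have hside : (∀ s ∈ tsupport θ, x < s) ∨ ∀ s ∈ tsupport θ, s < x := by
    by_contra! h
    obtain ⟨⟨s₁, hs₁, h₁⟩, s₂, hs₂, h₂⟩ := h
    exact hx (hK.out (hθK hs₁) (hθK hs₂) ⟨h₁, h₂⟩)
  rcases hside with hright | hleft
  · exact setIntegral_eq_zero_of_forall_eq_zero fun s hs =>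
      image_eq_zero_of_notMem_tsupport fun hmem => (hright s hmem).not_ge hs
  · rw [← h₀]
    exact setIntegral_eq_integral_of_forall_compl_eq_zero fun s hs =>
      image_eq_zero_of_notMem_tsupport fun hmem => hs (hleft s hmem).le

theorem exists_deriv_eq_of_integral_eq_zero (hθ : IsTestFunction θ a b) (h₀ : ∫ x, θ x = 0) :
    ∃ η, IsTestFunction η a b ∧ deriv η = θ := by
  set η : ℝ → ℝ := fun x => ∫ s in Iic x, θ s
  have hη_eq : η = fun x => (∫ s in Iic 0, θ s) + ∫ s in (0)..x, θ s := by
    funext x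
    rw [← intervalIntegral.integral_Iic_sub_Iic hθ.integrable.integrableOn
      hθ.integrable.integrableOn, add_sub_cancel]
  have hderiv : ∀ x, HasDerivAt η (θ x) x := fun x => by
    rw [hη_eq]
    exact ((hθ.contDiff.continuous.integral_hasStrictDerivAt 0 x).hasDerivAt).const_add _
  obtain ⟨α, β, hsupp, hsub⟩ := hθ.exists_tsupport_subset_Icc
  have hzero : ∀ x ∉ Icc α β, η x = 0 := fun x hx =>
    setIntegral_Iic_eq_zero ordConnected_Icc hsupp h₀ hx
  refine ⟨η, ⟨?_, HasCompactSupport.intro isCompact_Icc hzero, ?_⟩,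
    funext fun x => (hderiv x).deriv⟩
  · rw [contDiff_infty_iff_deriv, funext fun x => (hderiv x).deriv]
    exact ⟨fun x => (hderiv x).differentiableAt, hθ.contDiff⟩
  · exact (closure_minimal (Function.support_subset_iff'.2 hzero) isClosed_Icc).trans hsub

end IsTestFunction

end TestFunction

section WeakDeriv

variable {E : Type*} [NormedAddCommGroup E] [NormedSpace ℝ E] {f g : L2 E}

theorem IsWeakDeriv.integral_smul_eq_zero (h : IsWeakDeriv f 0) {θ : ℝ → ℝ}
    (hθ : IsTestFunction θ 0 Real.pi) (h₀ : ∫ x, θ x = 0) :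
    ∫ x in Ioo 0 Real.pi, θ x • f x = 0 := by
  obtain ⟨η, hη, rfl⟩ := hθ.exists_deriv_eq_of_integral_eq_zero h₀
  rw [h η hη.contDiff hη.hasCompactSupport hη.tsupport_subset, neg_eq_zero]
  refine integral_eq_zero_of_ae ?_
  filter_upwards [Lp.coeFn_zero E 2 (volume.restrict (Ioo 0 Real.pi))] with x hx
  rw [hx, Pi.zero_apply, smul_zero]

variable [CompleteSpace E]

theorem IsWeakDeriv.ae_eq_const (h : IsWeakDeriv f 0) :
    ∃ c : E, f =ᵐ[volume.restrict (Ioo 0 Real.pi)] fun _ => c := by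
  obtain ⟨θ₀, hθ₀, hθ₀_int⟩ := IsTestFunction.exists_integral_eq_one Real.pi_pos
  set c := ∫ x in Ioo 0 Real.pi, θ₀ x • f x with hc
  refine ⟨c, ?_⟩
  have hf := L2_integrableOn f
  have hzero : ∀ᵐ x : ℝ, x ∈ Ioo 0 Real.pi → f x - c = 0 := by
    refine isOpen_Ioo.ae_eq_zero_of_integral_contDiff_smul_eq_zero
      (hf.sub (integrableOn_const measure_Ioo_lt_top.ne)).locallyIntegrableOn
      fun θ hθ_smooth hθ_compact hθ_supp => ?_
    have hθ : IsTestFunction θ 0 Real.pi := ⟨hθ_smooth, hθ_compact, hθ_supp⟩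
    have hmean : ∫ x, (θ - (∫ s, θ s) • θ₀) x = 0 := by
      simp only [Pi.sub_apply, Pi.smul_apply, smul_eq_mul]
      rw [integral_sub hθ.integrable (hθ₀.integrable.const_mul _), integral_const_mul, hθ₀_int,
        mul_one, sub_self]
    have htest := h.integral_smul_eq_zero (hθ.sub_const_smul hθ₀ _) hmean
    have hθf := integrableOn_Ioo_smul hθ_smooth.continuous.continuousOn hf
    have hθ₀f := integrableOn_Ioo_smul hθ₀.contDiff.continuous.continuousOn hf
    simp only [Pi.sub_apply, Pi.smul_apply, sub_smul, smul_assoc] at htest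
    rw [integral_sub hθf (hθ₀f.fun_smul _), integral_smul, ← hc] at htest
    rw [← hθ.setIntegral_smul_eq_integral]
    simp_rw [smul_sub]
    rw [integral_sub hθf (hθ.integrable.integrableOn.smul_const c),
      hθ.setIntegral_smul_eq_integral fun _ => c, integral_smul_const, htest]
  filter_upwards [(ae_restrict_iff' measurableSet_Ioo).2 hzero] with x hx using sub_eq_zero.1 hx

theorem IsPrimitiveOn.isWeakDeriv {F : ℝ → E} (hF : IsPrimitiveOn F g 0 Real.pi)
    (hfF : f =ᵐ[volume.restrict (Ioo 0 Real.pi)] F) : IsWeakDeriv f g := by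
  intro η hη_smooth hη_compact hη_supp
  have hη : IsTestFunction η 0 Real.pi := ⟨hη_smooth, hη_compact, hη_supp⟩
  have hηprim : IsPrimitiveOn η (deriv η) 0 Real.pi := .of_hasDerivAt
    (fun x => (hη_smooth.differentiable (by simp) x).hasDerivAt)
    (hη_smooth.continuous_deriv (by simp))
  have hparts := hηprim.integral_deriv_smul hF
  rw [hη.eq_zero_of_notMem left_notMem_Ioo, hη.eq_zero_of_notMem right_notMem_Ioo, zero_smul,
    zero_smul, sub_self, zero_sub, ← integral_Ioo_eq_intervalIntegral Real.pi_pos.le,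
    ← integral_Ioo_eq_intervalIntegral Real.pi_pos.le] at hparts
  rw [← hparts]
  refine integral_congr_ae ?_
  filter_upwards [hfF] with x hx
  rw [hx]

theorem IsWeakDeriv.exists_isPrimitiveOn (h : IsWeakDeriv f g) :
    ∃ F : ℝ → E, IsPrimitiveOn F g 0 Real.pi ∧ f =ᵐ[volume.restrict (Ioo 0 Real.pi)] F := by
  have hG := isPrimitiveOn_const_add_integral (L2_intervalIntegrable g) (0 : E)
  have hG_cont := hG.continuousOn_Icc Real.pi_pos.le
  have hG_eq := (memLp_of_continuousOn_Icc hG_cont).coeFn_toLp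
  set G : L2 E := (memLp_of_continuousOn_Icc hG_cont).toLp
  have hdiff : IsWeakDeriv (f + (-1 : ℝ) • G) 0 := by
    simpa only [neg_smul, one_smul, add_neg_cancel] using
      h.add ((hG.isWeakDeriv hG_eq).smul (-1 : ℝ))
  obtain ⟨c, hc⟩ := hdiff.ae_eq_const
  refine ⟨_, isPrimitiveOn_const_add_integral (L2_intervalIntegrable g) c, ?_⟩
  filter_upwards [hc, hG_eq, Lp.coeFn_add f ((-1 : ℝ) • G), Lp.coeFn_smul (-1 : ℝ) G]
    with x hcx hGx hadd hsmul
  rw [hadd, Pi.add_apply, hsmul, Pi.smul_apply, hGx, zero_add, neg_one_smul] at hcx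
  rw [← hcx, neg_add_cancel_right]

end WeakDeriv

/-! ## Green's formulas -/

section Green

variable {E : Type*} [NormedAddCommGroup E] [NormedSpace ℝ E] {f f' f'' : L2 E}

theorem integral_Ioo_smul_congr_ae {F : ℝ → E} (h : f =ᵐ[volume.restrict (Ioo 0 Real.pi)] F)
    (η : ℝ → ℝ) : ∫ x in Ioo 0 Real.pi, η x • f x = ∫ x in (0)..Real.pi, η x • F x := by
  rw [← integral_Ioo_eq_intervalIntegral Real.pi_pos.le]
  refine integral_congr_ae ?_
  filter_upwards [h] with x hx
  rw [hx]

theorem hasDerivAt_sin_const_mul (k x : ℝ) :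
    HasDerivAt (fun x => Real.sin (k * x)) (k * Real.cos (k * x)) x := by
  simpa only [id, mul_one, mul_comm] using ((hasDerivAt_id x).const_mul k).sin

theorem hasDerivAt_const_mul_cos_const_mul (k x : ℝ) :
    HasDerivAt (fun x => k * Real.cos (k * x)) (-k ^ 2 * Real.sin (k * x)) x := by
  refine ((((hasDerivAt_id x).const_mul k).cos).const_mul k).congr_deriv ?_
  simp only [id]
  ring

variable [CompleteSpace E]

theorem IsPrimitiveOn.integral_sin_smul {F F' F'' : ℝ → E} (hF : IsPrimitiveOn F F' 0 Real.pi)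
    (hF' : IsPrimitiveOn F' F'' 0 Real.pi) (hπ : F Real.pi = 0) (k : ℕ) :
    ∫ x in (0)..Real.pi, Real.sin (k * x) • F'' x =
      (k : ℝ) • F 0 - (k : ℝ) ^ 2 • ∫ x in (0)..Real.pi, Real.sin (k * x) • F x := by
  have hgreen := integral_deriv_deriv_smul
    (.of_hasDerivAt (hasDerivAt_sin_const_mul k) (by fun_prop))
    (.of_hasDerivAt (hasDerivAt_const_mul_cos_const_mul k) (by fun_prop)) hF hF'
  simp only [hπ, neg_mul, neg_smul, mul_smul, Real.sin_nat_mul_pi, mul_zero, Real.sin_zero,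
    Real.cos_zero, one_smul, smul_zero, zero_smul, zero_sub, sub_zero,
    intervalIntegral.integral_neg, intervalIntegral.integral_smul] at hgreen
  rw [sub_eq_add_neg, hgreen, add_neg_cancel_left]

theorem IsPrimitiveOn.isH2H10 {F F' : ℝ → E} (hF : IsPrimitiveOn F F' 0 Real.pi)
    (hF' : IsPrimitiveOn F' f'' 0 Real.pi) (h₀ : F 0 = 0) (hπ : F Real.pi = 0)
    (hf : f =ᵐ[volume.restrict (Ioo 0 Real.pi)] F)
    (hf' : f' =ᵐ[volume.restrict (Ioo 0 Real.pi)] F') : IsH2H10 f f' f'' := by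
  have hcont := hF.continuousOn_Icc Real.pi_pos.le
  refine ⟨(hF.congr_ae ?_).isWeakDeriv hf, hF'.isWeakDeriv hf', ⟨F, hcont, hf, h₀⟩,
    ⟨F, hcont, hf, hπ⟩⟩
  rw [uIoc_of_le Real.pi_pos.le, ← restrict_Ioo_eq_restrict_Ioc]
  exact hf'.symm

theorem IsH2H10.exists_isPrimitiveOn (h : IsH2H10 f f' f'') :
    ∃ F F' : ℝ → E, IsPrimitiveOn F F' 0 Real.pi ∧ IsPrimitiveOn F' f'' 0 Real.pi ∧ F 0 = 0 ∧
      F Real.pi = 0 ∧ f =ᵐ[volume.restrict (Ioo 0 Real.pi)] F ∧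
      f' =ᵐ[volume.restrict (Ioo 0 Real.pi)] F' := by
  obtain ⟨F, hF, hfF⟩ := h.deriv₁.exists_isPrimitiveOn
  obtain ⟨F', hF', hfF'⟩ := h.deriv₂.exists_isPrimitiveOn
  have hcont := hF.continuousOn_Icc Real.pi_pos.le
  refine ⟨F, F', hF.congr_ae ?_, hF',
    h.trace_zero.eq_of_ae_eq (left_mem_Icc.2 Real.pi_pos.le) hcont hfF,
    h.trace_pi.eq_of_ae_eq (right_mem_Icc.2 Real.pi_pos.le) hcont hfF, hfF, hfF'⟩
  rwa [uIoc_of_le Real.pi_pos.le, ← restrict_Ioo_eq_restrict_Ioc]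

theorem IsH2H10.trace_deriv_eq (h : IsH2H10 f f' f'') {p : E} (hp : HasTrace f' 0 p) :
    p = -∫ x in Ioo 0 Real.pi, (1 - x / Real.pi) • f'' x := by
  obtain ⟨F, F', hF, hF', h₀, hπ, -, hfF'⟩ := h.exists_isPrimitiveOn
  have hcont := hF'.continuousOn_Icc Real.pi_pos.le
  have hweight : IsPrimitiveOn (fun x => 1 - x / Real.pi) (fun _ => -(1 / Real.pi)) 0 Real.pi :=
    .of_hasDerivAt (fun x => ((hasDerivAt_id x).div_const Real.pi).const_sub 1) continuous_const
  have hgreen := hweight.integral_deriv_deriv_smul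
    (.of_hasDerivAt (fun x => hasDerivAt_const x _) continuous_const) hF hF'
  simp only [h₀, hπ, div_self Real.pi_pos.ne', zero_div, sub_self, sub_zero, zero_smul, one_smul,
    smul_zero, zero_sub, neg_neg, intervalIntegral.integral_zero] at hgreen
  rw [← hp.eq_of_ae_eq (left_mem_Icc.2 Real.pi_pos.le) hcont hfF',
    integral_Ioo_eq_intervalIntegral Real.pi_pos.le]
  exact eq_neg_of_add_eq_zero_left hgreen.symm

theorem exists_isH2H10 (h : L2 E) : ∃ f f' : L2 E, IsH2H10 f f' h := by
  have hprim := isPrimitiveOn_const_add_integral (L2_intervalIntegrable h) (0 : E)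
  -- the initial slope for which the second primitive vanishes at `π`
  set d : E := -(Real.pi⁻¹ • ∫ x in (0)..Real.pi, ∫ s in (0)..x, h s) with hd
  have hF' := isPrimitiveOn_const_add_integral (L2_intervalIntegrable h) d
  have hF := isPrimitiveOn_const_add_integral hF'.continuousOn.intervalIntegrable (0 : E)
  refine ⟨_, _, hF.isH2H10 hF' (by simp) ?_
    (memLp_of_continuousOn_Icc (hF.continuousOn_Icc Real.pi_pos.le)).coeFn_toLp
    (memLp_of_continuousOn_Icc (hF'.continuousOn_Icc Real.pi_pos.le)).coeFn_toLp⟩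
  have hint : IntervalIntegrable (fun x => ∫ s in (0)..x, h s) volume 0 Real.pi := by
    simpa only [zero_add] using hprim.continuousOn.intervalIntegrable
  rw [zero_add, intervalIntegral.integral_add intervalIntegrable_const hint,
    intervalIntegral.integral_const, hd, sub_zero, smul_neg, smul_inv_smul₀ Real.pi_pos.ne',
    neg_add_cancel]

end Green

/-! ## The sine decomposition of `L²(0,π;E)` -/

section Sine

theorem integral_cos_int_mul {m : ℤ} (hm : m ≠ 0) : ∫ x in (0)..Real.pi, Real.cos (m * x) = 0 := by
  rw [intervalIntegral.integral_comp_mul_left (fun x => Real.cos x) (Int.cast_ne_zero.2 hm),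
    integral_cos, Real.sin_int_mul_pi, mul_zero, Real.sin_zero, sub_zero, smul_zero]

theorem integral_sin_mul_sin (j k : ℕ) :
    ∫ x in (0)..Real.pi, Real.sin ((j + 1 : ℕ) * x) * Real.sin ((k + 1 : ℕ) * x) =
      if j = k then Real.pi / 2 else 0 := by
  have hprod : ∀ x : ℝ, Real.sin ((j + 1 : ℕ) * x) * Real.sin ((k + 1 : ℕ) * x) =
      2⁻¹ * (Real.cos ((j - k : ℤ) * x) - Real.cos ((j + k + 2 : ℤ) * x)) := fun x => by
    have hdiff : ((j - k : ℤ) : ℝ) * x = (j + 1 : ℕ) * x - (k + 1 : ℕ) * x := by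
      push_cast
      ring
    have hsum : ((j + k + 2 : ℤ) : ℝ) * x = (j + 1 : ℕ) * x + (k + 1 : ℕ) * x := by
      push_cast
      ring
    rw [hdiff, hsum, Real.cos_sub, Real.cos_add]
    ring
  have hcos : ∀ m : ℤ, IntervalIntegrable (fun x : ℝ => Real.cos (m * x)) volume 0 Real.pi :=
    fun m => (by fun_prop : Continuous fun x : ℝ => Real.cos (m * x)).intervalIntegrable _ _
  simp_rw [hprod]
  rw [intervalIntegral.integral_const_mul, intervalIntegral.integral_sub (hcos _) (hcos _),
    integral_cos_int_mul (m := j + k + 2) (by omega)]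
  split_ifs with h
  · subst h
    simp
    ring
  · rw [integral_cos_int_mul (by omega)]
    simp

/-- The normalised Dirichlet eigenfunction with frequency `k + 1`: modes are numbered from `0`, so
that `sineFun k` is the paper's mode `k + 1`. -/
def sineFun (k : ℕ) (x : ℝ) : ℝ := √(2 / Real.pi) * Real.sin ((k + 1 : ℕ) * x)

theorem continuous_sineFun (k : ℕ) : Continuous (sineFun k) := by
  unfold sineFun
  fun_prop

theorem integral_sineFun_mul (j k : ℕ) :
    ∫ x in Ioo 0 Real.pi, sineFun j x * sineFun k x = if j = k then 1 else 0 := by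
  have hprod : ∀ x : ℝ, sineFun j x * sineFun k x =
      2 / Real.pi * (Real.sin ((j + 1 : ℕ) * x) * Real.sin ((k + 1 : ℕ) * x)) := fun x => by
    rw [sineFun, sineFun, mul_mul_mul_comm, Real.mul_self_sqrt (by positivity)]
  simp_rw [hprod]
  rw [integral_Ioo_eq_intervalIntegral Real.pi_pos.le, intervalIntegral.integral_const_mul,
    integral_sin_mul_sin]
  split_ifs
  · field_simp
  · simp

variable (𝕜 : Type*) [RCLike 𝕜] {E : Type*} [NormedAddCommGroup E] [InnerProductSpace 𝕜 E]
  [NormedSpace ℝ E] [IsScalarTower ℝ 𝕜 E]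

/-- The map sending `c` to the function `x ↦ η x • c` in `L²(0,π;E)`. -/
def smulConst (η : ℝ → ℝ) (hη : Continuous η) : E →ₗ[𝕜] L2 E where
  toFun c := (memLp_of_continuousOn_Icc (F := fun x => η x • c)
    (hη.continuousOn.smul continuousOn_const)).toLp
  map_add' c d := by
    rw [← MemLp.toLp_add]
    congr 1
    ext x
    simp
  map_smul' a c := by
    rw [RingHom.id_apply, ← MemLp.toLp_const_smul]
    congr 1
    ext x
    exact smul_comm _ _ _

theorem coeFn_smulConst {η : ℝ → ℝ} (hη : Continuous η) (c : E) :
    smulConst 𝕜 η hη c =ᵐ[volume.restrict (Ioo 0 Real.pi)] fun x => η x • c :=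
  MemLp.coeFn_toLp (memLp_of_continuousOn_Icc (hη.continuousOn.smul continuousOn_const))

theorem integral_mul_smulConst {η θ : ℝ → ℝ} (hη : Continuous η) (c : E) :
    ∫ x in Ioo 0 Real.pi, θ x • smulConst 𝕜 η hη c x =
      ∫ x in Ioo 0 Real.pi, (θ x * η x) • c := by
  refine integral_congr_ae ?_
  filter_upwards [coeFn_smulConst 𝕜 hη c] with x hx
  rw [hx, smul_smul]

variable [CompleteSpace E]

theorem inner_smulConst_left {η : ℝ → ℝ} (hη : Continuous η) (c : E) (f : L2 E) :
    inner 𝕜 (smulConst 𝕜 η hη c) f = inner 𝕜 c (∫ x in Ioo 0 Real.pi, η x • f x) := by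
  have hi : IntegrableOn (fun x => η x • f x) (Ioo 0 Real.pi) :=
    integrableOn_Ioo_smul hη.continuousOn (L2_integrableOn f)
  rw [L2.inner_def, ← integral_inner hi]
  refine integral_congr_ae ?_
  filter_upwards [coeFn_smulConst 𝕜 hη c] with x hx
  rw [hx, ← algebraMap_smul 𝕜 (η x) c, ← algebraMap_smul 𝕜 (η x) (f x), inner_smul_left,
    inner_smul_right, RCLike.algebraMap_eq_ofReal, RCLike.conj_ofReal]

/-- The isometric embedding of `E` into `L²(0,π;E)` as the `k`-th sine mode. -/
def sineEmb (k : ℕ) : E →ₗᵢ[𝕜] L2 E :=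
  (smulConst 𝕜 (sineFun k) (continuous_sineFun k)).isometryOfInner fun c d => by
    rw [inner_smulConst_left, integral_mul_smulConst, integral_smul_const, integral_sineFun_mul,
      if_pos rfl, one_smul]

/-- The `k`-th sine coefficient of an `L²` function, in integral form in `coef_apply`. -/
def coef (k : ℕ) : L2 E →L[𝕜] E := (sineEmb 𝕜 k).toContinuousLinearMap.adjoint

theorem inner_sineEmb_left (k : ℕ) (c : E) (f : L2 E) :
    inner 𝕜 (sineEmb 𝕜 k c) f = inner 𝕜 c (coef 𝕜 k f) :=
  (ContinuousLinearMap.adjoint_inner_right (sineEmb 𝕜 k).toContinuousLinearMap c f).symm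

theorem inner_sineEmb_right (k : ℕ) (c : E) (f : L2 E) :
    inner 𝕜 f (sineEmb 𝕜 k c) = inner 𝕜 (coef 𝕜 k f) c :=
  (ContinuousLinearMap.adjoint_inner_left (sineEmb 𝕜 k).toContinuousLinearMap c f).symm

theorem coef_apply (k : ℕ) (f : L2 E) :
    coef 𝕜 k f = ∫ x in Ioo 0 Real.pi, sineFun k x • f x := by
  refine ext_inner_left 𝕜 fun c => ?_
  rw [← inner_sineEmb_left, ← inner_smulConst_left 𝕜 (continuous_sineFun k)]
  rfl

theorem coef_eq_smul (k : ℕ) (f : L2 E) :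
    coef 𝕜 k f = √(2 / Real.pi) • ∫ x in Ioo 0 Real.pi, Real.sin ((k + 1 : ℕ) * x) • f x := by
  rw [coef_apply, ← integral_smul]
  simp_rw [sineFun, mul_smul]

theorem coef_sineEmb (j k : ℕ) (c : E) :
    coef 𝕜 j (sineEmb 𝕜 k c) = if j = k then c else 0 := by
  rw [coef_apply]
  refine (integral_mul_smulConst 𝕜 (continuous_sineFun k) c).trans ?_
  rw [integral_smul_const, integral_sineFun_mul, ite_smul, one_smul, zero_smul]

theorem L2_ext_coef {f g : L2 E} (h : ∀ k, coef 𝕜 k f = coef 𝕜 k g) : f = g := by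
  have hcoef : ∀ k, coef 𝕜 k (f - g) = 0 := fun k => by rw [map_sub, h, sub_self]
  rw [← sub_eq_zero, Lp.eq_zero_iff_ae_eq_zero]
  refine ae_eq_zero_of_integral_sin_smul_eq_zero (L2_integrableOn (f - g)) fun k => ?_
  rcases k with _ | k
  · simp
  · have hk := hcoef k
    rw [coef_eq_smul] at hk
    exact (smul_eq_zero.1 hk).resolve_left (by positivity)

theorem isHilbertSum_sineEmb : IsHilbertSum 𝕜 (fun _ : ℕ => E) fun k => sineEmb (E := E) 𝕜 k := by
  refine IsHilbertSum.mk (fun j k hjk c d => ?_) ?_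
  · rw [inner_sineEmb_left, coef_sineEmb, if_neg hjk, inner_zero_right]
  · rw [top_le_iff, Submodule.topologicalClosure_eq_top_iff, Submodule.eq_bot_iff]
    intro f hf
    refine L2_ext_coef 𝕜 fun k => ?_
    rw [map_zero]
    refine ext_inner_left 𝕜 fun c => ?_
    rw [inner_zero_right, ← inner_sineEmb_left]
    exact hf _ (Submodule.mem_iSup_of_mem k ⟨c, rfl⟩)

/-- The isometry of `L²(0,π;E)` with `ℓ²(E)` whose components are the sine coefficients. -/
def sineEquiv : L2 E ≃ₗᵢ[𝕜] lp (fun _ : ℕ => E) 2 := (isHilbertSum_sineEmb 𝕜).linearIsometryEquiv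

theorem sineEquiv_apply (f : L2 E) (k : ℕ) : sineEquiv 𝕜 f k = coef 𝕜 k f := by
  obtain ⟨w, rfl⟩ := (sineEquiv 𝕜).symm.surjective f
  rw [LinearIsometryEquiv.apply_symm_apply]
  have hsum := ((isHilbertSum_sineEmb (E := E) 𝕜).hasSum_linearIsometryEquiv_symm w).mapL
    (coef 𝕜 k)
  simp only [coef_sineEmb] at hsum
  refine HasSum.unique ?_ hsum
  convert hasSum_single k fun j hj => if_neg (Ne.symm hj)
  rw [if_pos rfl]

theorem hasSum_norm_sq_coef (f : L2 E) : HasSum (fun k => ‖coef 𝕜 k f‖ ^ 2) (‖f‖ ^ 2) := by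
  have hsum := lp.hasSum_norm (p := 2) (by norm_num) (sineEquiv 𝕜 f)
  rw [LinearIsometryEquiv.norm_map] at hsum
  simpa only [sineEquiv_apply, ENNReal.toReal_ofNat, Real.rpow_ofNat] using hsum

theorem hasSum_inner_coef (f g : L2 E) :
    HasSum (fun k => inner 𝕜 (coef 𝕜 k f) (coef 𝕜 k g)) (inner 𝕜 f g) := by
  have hsum := lp.hasSum_inner (𝕜 := 𝕜) (sineEquiv 𝕜 f) (sineEquiv 𝕜 g)
  rw [LinearIsometryEquiv.inner_map_map] at hsum
  simpa only [sineEquiv_apply] using hsum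

theorem exists_coef_eq {c : ℕ → E} (hc : Summable fun k => ‖c k‖ ^ 2) :
    ∃ f : L2 E, ∀ k, coef 𝕜 k f = c k := by
  have hmem : Memℓp c 2 := memℓp_gen (by simpa using hc)
  refine ⟨(sineEquiv 𝕜).symm ⟨c, hmem⟩, fun k => ?_⟩
  rw [← sineEquiv_apply, LinearIsometryEquiv.apply_symm_apply]

theorem norm_sq_le_tsum_of_norm_coef_le {f : L2 E} {b : ℕ → ℝ} (hb : Summable fun k => b k ^ 2)
    (h : ∀ k, ‖coef 𝕜 k f‖ ≤ b k) : ‖f‖ ^ 2 ≤ ∑' k, b k ^ 2 := by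
  rw [← (hasSum_norm_sq_coef 𝕜 f).tsum_eq]
  exact (hasSum_norm_sq_coef 𝕜 f).summable.tsum_le_tsum
    (fun k => pow_le_pow_left₀ (norm_nonneg _) (h k) 2) hb

theorem tendsto_of_tendsto_coef {ι : Type*} {l : Filter ι} {F : ι → L2 E} {f : L2 E} {b : ℕ → ℝ}
    (hb : Summable fun k => b k ^ 2)
    (hF : ∀ᶠ i in l, ∀ k, ‖coef 𝕜 k (F i) - coef 𝕜 k f‖ ≤ b k)
    (hlim : ∀ k, Tendsto (fun i => coef 𝕜 k (F i)) l (𝓝 (coef 𝕜 k f))) :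
    Tendsto F l (𝓝 f) := by
  have hparseval : ∀ i, ∑' k, ‖coef 𝕜 k (F i) - coef 𝕜 k f‖ ^ 2 = ‖F i - f‖ ^ 2 := fun i => by
    simp_rw [← (hasSum_norm_sq_coef 𝕜 (F i - f)).tsum_eq, map_sub]
  have hsq : Tendsto (fun i => ∑' k, ‖coef 𝕜 k (F i) - coef 𝕜 k f‖ ^ 2) l
      (𝓝 (∑' _ : ℕ, 0)) := by
    refine tendsto_tsum_of_dominated_convergence hb (fun k => ?_) ?_
    · simpa using (tendsto_iff_norm_sub_tendsto_zero.1 (hlim k)).pow 2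
    · filter_upwards [hF] with i hi k
      rw [norm_pow, norm_norm]
      exact pow_le_pow_left₀ (norm_nonneg _) (hi k) 2
  simp_rw [hparseval, tsum_zero] at hsq
  rw [tendsto_iff_norm_sub_tendsto_zero]
  simpa [Real.sqrt_sq (norm_nonneg _)] using hsq.sqrt

end Sine

/-! ## Exponentials of bounded operators -/

section Exponential

variable {𝕜 : Type*} [RCLike 𝕜] {E : Type*} [NormedAddCommGroup E] [NormedSpace 𝕜 E]

/-- The group `e^{ta}` generated by a bounded operator `a`, at real times: real and complex
systems share it. -/
def expOp (a : E →L[𝕜] E) (t : ℝ) : E →L[𝕜] E := NormedSpace.exp ((t : 𝕜) • a)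

theorem expOp_zero (a : E →L[𝕜] E) : expOp a 0 = 1 := by simp [expOp]

theorem commute_expOp (a : E →L[𝕜] E) (t : ℝ) : Commute a (expOp a t) :=
  ((Commute.refl a).smul_right _).exp_right

theorem apply_expOp_apply (a : E →L[𝕜] E) (c : E) (t : ℝ) : a (expOp a t c) = expOp a t (a c) :=
  DFunLike.congr_fun (commute_expOp a t).eq c

theorem inv_factorial_mul_ofReal_pow_smul [NormedSpace ℝ E] [IsScalarTower ℝ 𝕜 E] (n : ℕ) (t : ℝ)
    (c : E) :
    ((n.factorial : 𝕜)⁻¹ * (t : 𝕜) ^ n) • c = ((n.factorial : ℝ)⁻¹ * t ^ n) • c := by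
  rw [← algebraMap_smul 𝕜 ((n.factorial : ℝ)⁻¹ * t ^ n) c]
  simp

variable [CompleteSpace E]

theorem expOp_add (a : E →L[𝕜] E) (s t : ℝ) : expOp a (s + t) = expOp a s * expOp a t := by
  unfold expOp
  rw [RCLike.ofReal_add, add_smul]
  refine NormedSpace.exp_add_of_commute_of_mem_ball (𝕂 := 𝕜)
    (((Commute.refl a).smul_left _).smul_right _) ?_ ?_
  all_goals exact (NormedSpace.expSeries_radius_eq_top 𝕜 (E →L[𝕜] E)).symm ▸ edist_lt_top _ _

theorem hasSum_expOp (a : E →L[𝕜] E) (t : ℝ) (c : E) :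
    HasSum (fun n : ℕ => ((n.factorial : 𝕜)⁻¹ * (t : 𝕜) ^ n) • (a ^ n) c) (expOp a t c) := by
  have hsum := (NormedSpace.exp_series_hasSum_exp' (𝕂 := 𝕜) ((t : 𝕜) • a)).mapL
    (ContinuousLinearMap.apply 𝕜 E c)
  refine (congrArg (HasSum · _) (funext fun n => ?_)).mpr hsum
  rw [ContinuousLinearMap.apply_apply, smul_pow, smul_smul, smul_apply]

theorem norm_expOp_le (a : E →L[𝕜] E) (t : ℝ) : ‖expOp a t‖ ≤ Real.exp (|t| * ‖a‖) := by
  have hexp : HasSum (fun n : ℕ => (|t| * ‖a‖) ^ n / n.factorial) (Real.exp (|t| * ‖a‖)) := by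
    rw [Real.exp_eq_exp_ℝ]
    exact NormedSpace.expSeries_div_hasSum_exp _
  refine (NormedSpace.exp_series_hasSum_exp' (𝕂 := 𝕜) ((t : 𝕜) • a)).norm_le_of_bounded hexp
    fun n => ?_
  have hpow : ‖((t : 𝕜) • a) ^ n‖ ≤ (|t| * ‖a‖) ^ n := by
    rcases n with _ | n
    · rw [pow_zero, pow_zero]
      exact ContinuousLinearMap.norm_id_le
    · refine (norm_pow_le' _ n.succ_pos).trans_eq ?_
      rw [norm_smul, RCLike.norm_ofReal]
  rw [norm_smul, norm_inv, RCLike.norm_natCast, div_eq_inv_mul]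
  gcongr

theorem hasDerivAt_expOp_apply [NormedSpace ℝ E] [IsScalarTower ℝ 𝕜 E] (a : E →L[𝕜] E) (c : E)
    (t : ℝ) : HasDerivAt (fun t => expOp a t c) (a (expOp a t c)) t := by
  have hexp : HasDerivAt (fun u : 𝕜 => NormedSpace.exp (u • a) c) (a (expOp a t c)) (t : 𝕜) :=
    ((hasDerivAt_exp_smul_const' a (t : 𝕜)).clm_apply (hasDerivAt_const _ c)).congr_deriv
      (by simp [expOp])
  have hcoe : HasDerivAt (fun t : ℝ => (t : 𝕜)) 1 t := by
    simpa using (RCLike.ofRealCLM (K := 𝕜)).hasDerivAt (x := t)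
  exact (hexp.scomp t hcoe).congr_deriv (one_smul _ _)

theorem contDiff_expOp_apply [NormedSpace ℝ E] [IsScalarTower ℝ 𝕜 E] (a : E →L[𝕜] E) (n : ℕ)
    (c : E) : ContDiff ℝ n fun t => expOp a t c := by
  induction n generalizing c with
  | zero =>
    exact contDiff_zero.2 (continuous_iff_continuousAt.2 fun t =>
      (hasDerivAt_expOp_apply a c t).continuousAt)
  | succ n ih =>
    have hderiv : deriv (fun t => expOp a t c) = fun t => expOp a t (a c) :=
      funext fun t => by rw [(hasDerivAt_expOp_apply a c t).deriv, apply_expOp_apply]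
    rw [Nat.cast_succ, contDiff_succ_iff_deriv, hderiv]
    exact ⟨fun t => (hasDerivAt_expOp_apply a c t).differentiableAt, by simp, ih _⟩

theorem map_expOp_of_intertwine [NormedSpace ℝ E] [IsScalarTower ℝ 𝕜 E] {𝕜' : Type*}
    [RCLike 𝕜'] {E' : Type*} [NormedAddCommGroup E'] [NormedSpace 𝕜' E'] [CompleteSpace E']
    [NormedSpace ℝ E'] [IsScalarTower ℝ 𝕜' E'] {a : E →L[𝕜] E} {b : E' →L[𝕜'] E'}
    {J : E →L[ℝ] E'} (hJ : ∀ c, J (a c) = b (J c)) (t : ℝ) (c : E) :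
    J (expOp a t c) = expOp b t (J c) := by
  have hJ_pow : ∀ n : ℕ, J ((a ^ n) c) = (b ^ n) (J c) := fun n => by
    induction n with
    | zero => simp
    | succ n ih => rw [pow_succ', pow_succ', mul_apply_eq_comp, mul_apply_eq_comp, hJ, ih]
  refine ((hasSum_expOp a t c).mapL J).unique ?_
  convert hasSum_expOp b t (J c) using 2 with n
  rw [inv_factorial_mul_ofReal_pow_smul, inv_factorial_mul_ofReal_pow_smul, map_smul, hJ_pow]

end Exponential

/-! ## Block diagonal operators -/

section BlockDiag

variable {𝕜 : Type*} [RCLike 𝕜] {E : Type*} [NormedAddCommGroup E] [InnerProductSpace 𝕜 E]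
  [NormedSpace ℝ E] [IsScalarTower ℝ 𝕜 E] [CompleteSpace E]

theorem norm_le_mul_of_coef_le {f g : L2 E} {C : ℝ} (hC : 0 ≤ C)
    (h : ∀ k, ‖coef 𝕜 k g‖ ≤ C * ‖coef 𝕜 k f‖) : ‖g‖ ≤ C * ‖f‖ := by
  have hf := (hasSum_norm_sq_coef 𝕜 f).mul_left (C ^ 2)
  simp_rw [← mul_pow] at hf
  exact le_of_sq_le_sq
    ((norm_sq_le_tsum_of_norm_coef_le 𝕜 hf.summable h).trans_eq hf.tsum_eq) (by positivity)

theorem exists_coef_eq_apply {m : ℕ → E →L[𝕜] E} {C : ℝ} (hm : ∀ k, ‖m k‖ ≤ C) (f : L2 E) :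
    ∃ g : L2 E, ∀ k, coef 𝕜 k g = m k (coef 𝕜 k f) := by
  refine exists_coef_eq 𝕜 ?_
  refine Summable.of_nonneg_of_le (fun _ => by positivity) (fun k => ?_)
    ((hasSum_norm_sq_coef 𝕜 f).summable.mul_left (C ^ 2))
  rw [← mul_pow]
  exact pow_le_pow_left₀ (norm_nonneg _) ((m k).le_of_opNorm_le (hm k) _) 2

/-- The block diagonal operator that acts on the `k`-th sine coefficient as `m k`; the bound `C`
on the blocks makes it bounded. -/
def blockDiag (m : ℕ → E →L[𝕜] E) (C : ℝ) (hm : ∀ k, ‖m k‖ ≤ C) : L2 E →L[𝕜] L2 E :=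
  LinearMap.mkContinuous
    { toFun := fun f => (exists_coef_eq_apply hm f).choose
      map_add' := fun f g => L2_ext_coef 𝕜 fun k => by
        rw [(exists_coef_eq_apply hm (f + g)).choose_spec, map_add, map_add, map_add,
          (exists_coef_eq_apply hm f).choose_spec, (exists_coef_eq_apply hm g).choose_spec]
      map_smul' := fun c f => L2_ext_coef 𝕜 fun k => by
        rw [(exists_coef_eq_apply hm (c • f)).choose_spec, map_smul, map_smul, RingHom.id_apply,
          map_smul, (exists_coef_eq_apply hm f).choose_spec] }
    C fun f => norm_le_mul_of_coef_le (𝕜 := 𝕜) ((norm_nonneg _).trans (hm 0)) fun k => by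
      rw [LinearMap.coe_mk, AddHom.coe_mk, (exists_coef_eq_apply hm f).choose_spec]
      exact (m k).le_of_opNorm_le (hm k) _

theorem coef_blockDiag {m : ℕ → E →L[𝕜] E} {C : ℝ} (hm : ∀ k, ‖m k‖ ≤ C) (k : ℕ) (f : L2 E) :
    coef 𝕜 k (blockDiag m C hm f) = m k (coef 𝕜 k f) :=
  (exists_coef_eq_apply hm f).choose_spec k

end BlockDiag

section Mode

variable {𝕜 : Type*} [RCLike 𝕜] {E : Type*} [NormedAddCommGroup E] [NormedSpace 𝕜 E]

/-- The squared frequency of the `k`-th mode, that is, of `sineFun k`. -/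
def freqSq (k : ℕ) : ℝ := ((k : ℝ) + 1) ^ 2

theorem one_le_freqSq (k : ℕ) : 1 ≤ freqSq k :=
  one_le_pow₀ (le_add_of_nonneg_left k.cast_nonneg)

theorem le_freqSq (k : ℕ) : (k : ℝ) ≤ freqSq k := by
  rw [freqSq]
  nlinarith [(k.cast_nonneg : (0 : ℝ) ≤ k)]

theorem freqSq_pos (k : ℕ) : 0 < freqSq k := one_pos.trans_le (one_le_freqSq k)

/-- The restriction of `∂ₓₓ + a` to the `k`-th mode. -/
def modeOp (a : E →L[𝕜] E) (k : ℕ) : E →L[𝕜] E := a - ((freqSq k : ℝ) : 𝕜) • 1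

/-- The exponential of `t • modeOp a k`, written with its scalar factor split off. -/
def modeExp (a : E →L[𝕜] E) (k : ℕ) (t : ℝ) : E →L[𝕜] E :=
  ((Real.exp (-(freqSq k * t)) : ℝ) : 𝕜) • expOp a t

theorem modeOp_apply [NormedSpace ℝ E] [IsScalarTower ℝ 𝕜 E] (a : E →L[𝕜] E) (k : ℕ) (c : E) :
    modeOp a k c = a c - freqSq k • c := by
  simp only [modeOp, sub_apply, smul_apply, one_apply_eq_self]
  rw [← algebraMap_smul 𝕜 (freqSq k) c]

theorem mul_norm_le_norm_smul_sub_modeOp [NormedSpace ℝ E] [IsScalarTower ℝ 𝕜 E] (a : E →L[𝕜] E)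
    (ω : 𝕜) (k : ℕ) (c : E) :
    (freqSq k - (‖ω‖ + ‖a‖)) * ‖c‖ ≤ ‖ω • c - modeOp a k c‖ := by
  have hsplit : freqSq k • c = (ω • c - modeOp a k c) - (ω • c - a c) := by
    rw [modeOp_apply]
    abel
  rw [sub_mul, sub_le_iff_le_add]
  calc freqSq k * ‖c‖ = ‖freqSq k • c‖ := by
        rw [norm_smul, Real.norm_of_nonneg (freqSq_pos k).le]
    _ ≤ ‖ω • c - modeOp a k c‖ + (‖ω • c‖ + ‖a c‖) := by
        rw [hsplit]
        exact (norm_sub_le _ _).trans (add_le_add_right (norm_sub_le _ _) _)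
    _ ≤ ‖ω • c - modeOp a k c‖ + (‖ω‖ + ‖a‖) * ‖c‖ := by
        rw [add_mul, norm_smul]
        gcongr
        exact a.le_opNorm c

theorem modeExp_apply [NormedSpace ℝ E] [IsScalarTower ℝ 𝕜 E] (a : E →L[𝕜] E) (k : ℕ) (t : ℝ)
    (c : E) : modeExp a k t c = Real.exp (-(freqSq k * t)) • expOp a t c := by
  rw [modeExp, smul_apply, ← algebraMap_smul 𝕜 (Real.exp _) (expOp a t c)]

theorem modeExp_zero (a : E →L[𝕜] E) (k : ℕ) : modeExp a k 0 = 1 := by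
  simp [modeExp, expOp_zero]

theorem modeOp_modeExp_comm (a : E →L[𝕜] E) (k : ℕ) (c : E) (t : ℝ) :
    modeOp a k (modeExp a k t c) = modeExp a k t (modeOp a k c) := by
  simp only [modeOp, modeExp, sub_apply, smul_apply, one_apply_eq_self, map_sub, map_smul,
    apply_expOp_apply, smul_sub, smul_comm _ ((freqSq k : ℝ) : 𝕜)]

variable [CompleteSpace E]

theorem modeExp_add (a : E →L[𝕜] E) (k : ℕ) (s t : ℝ) :
    modeExp a k (s + t) = modeExp a k s * modeExp a k t := by
  rw [modeExp, modeExp, modeExp, smul_mul_smul_comm, ← RCLike.ofReal_mul, ← Real.exp_add, expOp_add]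
  ring_nf

theorem modeExp_add_apply (a : E →L[𝕜] E) (k : ℕ) (s t : ℝ) (c : E) :
    modeExp a k (s + t) c = modeExp a k s (modeExp a k t c) := by
  rw [modeExp_add, mul_apply_eq_comp]

theorem norm_modeExp_le (a : E →L[𝕜] E) (k : ℕ) {t : ℝ} (ht : 0 ≤ t) :
    ‖modeExp a k t‖ ≤ Real.exp (-(freqSq k * t)) * Real.exp (t * ‖a‖) := by
  rw [modeExp, norm_smul, RCLike.norm_ofReal, abs_of_pos (Real.exp_pos _)]
  gcongr
  simpa only [abs_of_nonneg ht] using norm_expOp_le a t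

theorem norm_modeExp_le_exp (a : E →L[𝕜] E) (k : ℕ) {t : ℝ} (ht : 0 ≤ t) :
    ‖modeExp a k t‖ ≤ Real.exp (t * ‖a‖) := by
  refine (norm_modeExp_le a k ht).trans ?_
  exact mul_le_of_le_one_left (Real.exp_pos _).le
    (Real.exp_le_one_iff.2 (neg_nonpos.2 (mul_nonneg (freqSq_pos k).le ht)))

variable [NormedSpace ℝ E] [IsScalarTower ℝ 𝕜 E]

theorem hasDerivAt_modeExp_apply (a : E →L[𝕜] E) (k : ℕ) (c : E) (t : ℝ) :
    HasDerivAt (fun t => modeExp a k t c) (modeOp a k (modeExp a k t c)) t := by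
  simp_rw [modeExp_apply, modeOp_apply]
  have hdecay : HasDerivAt (fun t => Real.exp (-(freqSq k * t)))
      (Real.exp (-(freqSq k * t)) * (-(freqSq k))) t := by
    simpa using ((hasDerivAt_id t).const_mul (freqSq k)).neg.exp
  refine (hdecay.smul (hasDerivAt_expOp_apply a c t)).congr_deriv ?_
  rw [← algebraMap_smul 𝕜 (Real.exp _) (expOp a t c), map_smul, algebraMap_smul, algebraMap_smul,
    smul_smul, mul_neg, neg_smul, mul_comm (freqSq k) (Real.exp _), sub_eq_add_neg]

theorem continuous_modeExp_apply (a : E →L[𝕜] E) (k : ℕ) (c : E) :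
    Continuous fun t => modeExp a k t c :=
  continuous_iff_continuousAt.2 fun t => (hasDerivAt_modeExp_apply a k c t).continuousAt

theorem norm_modeExp_sub_le (a : E →L[𝕜] E) (k : ℕ) (c : E) {t : ℝ} (ht : 0 ≤ t) :
    ‖modeExp a k t c - c‖ ≤ t * (Real.exp (t * ‖a‖) * ‖modeOp a k c‖) := by
  have hderiv : ∀ s ∈ Ico 0 t,
      ‖modeOp a k (modeExp a k s c)‖ ≤ Real.exp (t * ‖a‖) * ‖modeOp a k c‖ := fun s hs => by
    rw [modeOp_modeExp_comm]
    refine ((modeExp a k s).le_of_opNorm_le (norm_modeExp_le_exp a k hs.1) _).trans ?_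
    have hst := hs.2.le
    gcongr
  simpa only [modeExp_zero, one_apply_eq_self, sub_zero, mul_comm t] using
    norm_image_sub_le_of_norm_deriv_le_segment'
      (fun s _ => (hasDerivAt_modeExp_apply a k c s).hasDerivWithinAt) hderiv t
      (right_mem_Icc.2 ht)

theorem norm_slope_modeExp_le (a : E →L[𝕜] E) (k : ℕ) (c : E) {t : ℝ} (ht : 0 < t) (ht1 : t ≤ 1) :
    ‖t⁻¹ • (modeExp a k t c - c)‖ ≤ Real.exp ‖a‖ * ‖modeOp a k c‖ := by
  rw [norm_smul, norm_inv, Real.norm_of_nonneg ht.le, inv_mul_le_iff₀ ht]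
  refine (norm_modeExp_sub_le a k c ht.le).trans ?_
  have hta : t * ‖a‖ ≤ ‖a‖ := mul_le_of_le_one_left (norm_nonneg _) ht1
  gcongr

end Mode

/-! ## The semigroup -/

section Semigroup

variable {𝕜 : Type*} [RCLike 𝕜] {E : Type*} [NormedAddCommGroup E] [InnerProductSpace 𝕜 E]
  [NormedSpace ℝ E] [IsScalarTower ℝ 𝕜 E] [CompleteSpace E]

/-- The semigroup on `L²(0,π;E)` generated by `∂ₓₓ + a` with Dirichlet boundary conditions,
extended by the identity to negative times. -/
def heatOp (a : E →L[𝕜] E) (t : ℝ) : L2 E →L[𝕜] L2 E :=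
  blockDiag (fun k => modeExp a k (max t 0)) (Real.exp (max t 0 * ‖a‖))
    fun k => norm_modeExp_le_exp a k (le_max_right t 0)

theorem coef_heatOp (a : E →L[𝕜] E) {t : ℝ} (ht : 0 ≤ t) (k : ℕ) (f : L2 E) :
    coef 𝕜 k (heatOp a t f) = modeExp a k t (coef 𝕜 k f) := by
  rw [heatOp, coef_blockDiag, max_eq_left ht]

theorem heatOp_zero (a : E →L[𝕜] E) : heatOp a 0 = ContinuousLinearMap.id 𝕜 (L2 E) := by
  ext1 f
  refine L2_ext_coef 𝕜 fun k => ?_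
  rw [coef_heatOp a le_rfl, modeExp_zero]
  rfl

theorem heatOp_add (a : E →L[𝕜] E) {s t : ℝ} (hs : 0 ≤ s) (ht : 0 ≤ t) :
    heatOp a (s + t) = (heatOp a s).comp (heatOp a t) := by
  ext1 f
  refine L2_ext_coef 𝕜 fun k => ?_
  rw [coef_heatOp a (add_nonneg hs ht), ContinuousLinearMap.comp_apply, coef_heatOp a hs,
    coef_heatOp a ht, modeExp_add_apply]

theorem summable_mul_norm_coef_sq (C : ℝ) (f : L2 E) :
    Summable fun k => (C * ‖coef 𝕜 k f‖) ^ 2 := by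
  simp_rw [mul_pow]
  exact (hasSum_norm_sq_coef 𝕜 f).summable.mul_left _

theorem continuousOn_heatOp_apply (a : E →L[𝕜] E) (f : L2 E) :
    ContinuousOn (fun t => heatOp a t f) (Ici 0) := by
  intro t₀ (ht₀ : 0 ≤ t₀)
  have hbound : ∀ t, 0 ≤ t → t ≤ t₀ + 1 → ∀ k,
      ‖coef 𝕜 k (heatOp a t f)‖ ≤ Real.exp ((t₀ + 1) * ‖a‖) * ‖coef 𝕜 k f‖ := fun t ht ht' k => by
    rw [coef_heatOp a ht]
    refine (modeExp a k t).le_of_opNorm_le ((norm_modeExp_le_exp a k ht).trans ?_) _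
    gcongr
  refine tendsto_of_tendsto_coef 𝕜
    (summable_mul_norm_coef_sq (𝕜 := 𝕜) (2 * Real.exp ((t₀ + 1) * ‖a‖)) f) ?_ fun k => ?_
  · filter_upwards [self_mem_nhdsWithin,
      mem_nhdsWithin_of_mem_nhds (Iic_mem_nhds (lt_add_one t₀))] with t ht ht' k
    refine (norm_sub_le _ _).trans ?_
    linarith [hbound t ht ht' k, hbound t₀ ht₀ (by linarith) k]
  · rw [coef_heatOp a ht₀]
    refine (((continuous_modeExp_apply a k _).tendsto t₀).mono_left nhdsWithin_le_nhds).congr' ?_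
    filter_upwards [self_mem_nhdsWithin] with t ht
    rw [coef_heatOp a ht]

theorem tendsto_heatOp (a : E →L[𝕜] E) (f : L2 E) :
    Tendsto (fun t => heatOp a t f) (𝓝[>] 0) (𝓝 f) := by
  have hlim : Tendsto (fun t => heatOp a t f) (𝓝[≥] 0) (𝓝 (heatOp a 0 f)) :=
    continuousOn_heatOp_apply a f 0 self_mem_Ici
  rw [heatOp_zero, ContinuousLinearMap.id_apply] at hlim
  exact hlim.mono_left (nhdsWithin_mono 0 Ioi_subset_Ici_self)

theorem coef_slope_heatOp (a : E →L[𝕜] E) (f : L2 E) (k : ℕ) {t : ℝ} (ht : 0 < t) :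
    coef 𝕜 k (((t⁻¹ : ℝ) : 𝕜) • (heatOp a t f - f)) =
      t⁻¹ • (modeExp a k t (coef 𝕜 k f) - coef 𝕜 k f) := by
  rw [map_smul, map_sub, coef_heatOp a ht.le, ← algebraMap_smul 𝕜 (t⁻¹)]

theorem tendsto_coef_slope_heatOp (a : E →L[𝕜] E) (f : L2 E) (k : ℕ) :
    Tendsto (fun t : ℝ => coef 𝕜 k (((t⁻¹ : ℝ) : 𝕜) • (heatOp a t f - f))) (𝓝[>] 0)
      (𝓝 (modeOp a k (coef 𝕜 k f))) := by
  have hslope := (hasDerivAt_modeExp_apply a k (coef 𝕜 k f) 0).tendsto_slope_zero_right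
  simp only [zero_add, modeExp_zero, one_apply_eq_self] at hslope
  refine hslope.congr' ?_
  filter_upwards [self_mem_nhdsWithin] with t ht
  rw [coef_slope_heatOp a f k ht]

theorem tendsto_slope_heatOp_iff (a : E →L[𝕜] E) (f g : L2 E) :
    Tendsto (fun t : ℝ => ((t⁻¹ : ℝ) : 𝕜) • (heatOp a t f - f)) (𝓝[>] 0) (𝓝 g) ↔
      ∀ k, coef 𝕜 k g = modeOp a k (coef 𝕜 k f) := by
  constructor
  · intro h k
    exact tendsto_nhds_unique (((coef 𝕜 k).continuous.tendsto g).comp h)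
      (tendsto_coef_slope_heatOp a f k)
  · intro h
    refine tendsto_of_tendsto_coef 𝕜 (summable_mul_norm_coef_sq (𝕜 := 𝕜) (Real.exp ‖a‖ + 1) g) ?_
      fun k => h k ▸ tendsto_coef_slope_heatOp a f k
    filter_upwards [Ioc_mem_nhdsGT (zero_lt_one (α := ℝ))] with t ht k
    rw [coef_slope_heatOp a f k ht.1, add_mul, one_mul, h k]
    exact norm_sub_le_of_le (norm_slope_modeExp_le a k _ ht.1 ht.2) le_rfl

theorem norm_heatOp_apply_le (a : E →L[𝕜] E) {N : ℕ} {f : L2 E} (hf : ∀ k < N, coef 𝕜 k f = 0)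
    {t : ℝ} (ht : 0 ≤ t) : ‖heatOp a t f‖ ≤ Real.exp (-((N - ‖a‖) * t)) * ‖f‖ := by
  refine norm_le_mul_of_coef_le (𝕜 := 𝕜) (Real.exp_pos _).le fun k => ?_
  rw [coef_heatOp a ht]
  rcases lt_or_ge k N with hk | hk
  · simp only [hf k hk, map_zero, norm_zero, mul_zero, le_refl]
  · refine (modeExp a k t).le_of_opNorm_le ((norm_modeExp_le a k ht).trans ?_) _
    rw [← Real.exp_add, Real.exp_le_exp]
    have hNk : (N : ℝ) ≤ freqSq k := (Nat.cast_le.2 hk).trans (le_freqSq k)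
    nlinarith

theorem tendsto_heatOp_atTop_zero (a : E →L[𝕜] E) {N : ℕ} (hN : ‖a‖ < N) {f : L2 E}
    (hf : ∀ k < N, coef 𝕜 k f = 0) : Tendsto (fun t => heatOp a t f) atTop (𝓝 0) := by
  have hdecay : Tendsto (fun t : ℝ => Real.exp (-((N - ‖a‖) * t)) * ‖f‖) atTop (𝓝 0) := by
    simpa only [zero_mul, Function.comp_def, id_eq] using (Real.tendsto_exp_neg_atTop_nhds_zero.comp
      (tendsto_id.const_mul_atTop (sub_pos.2 hN))).mul_const ‖f‖
  refine squeeze_zero_norm' ?_ hdecay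
  filter_upwards [eventually_ge_atTop 0] with t ht using norm_heatOp_apply_le a hf ht

end Semigroup

/-! ## The graph of the parabolic operator -/

section Coefficients

variable {𝕜 : Type*} [RCLike 𝕜] {E : Type*} [NormedAddCommGroup E] [InnerProductSpace 𝕜 E]
  [NormedSpace ℝ E] [IsScalarTower ℝ 𝕜 E] [CompleteSpace E]

theorem coef_of_ae_eq {𝕜' : Type*} [RCLike 𝕜'] {E' : Type*} [NormedAddCommGroup E']
    [InnerProductSpace 𝕜' E'] [NormedSpace ℝ E'] [IsScalarTower ℝ 𝕜' E'] [CompleteSpace E']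
    (J : E →L[ℝ] E') {f : L2 E} {g : L2 E'}
    (h : g =ᵐ[volume.restrict (Ioo 0 Real.pi)] fun x => J (f x)) (k : ℕ) :
    coef 𝕜' k g = J (coef 𝕜 k f) := by
  rw [coef_apply, coef_apply, ← J.integral_comp_comm
    (integrableOn_Ioo_smul (continuous_sineFun k).continuousOn (L2_integrableOn f))]
  refine integral_congr_ae ?_
  filter_upwards [h] with x hx
  rw [hx, map_smul]

/-- The weight of a boundary value at `0` in the `k`-th sine coefficient of a second derivative. -/
def sineAmp (k : ℕ) : ℝ := √(2 / Real.pi) * ((k : ℝ) + 1)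

theorem IsPrimitiveOn.coef_add_freqSq_smul_coef {F F' F'' : ℝ → E}
    (hF : IsPrimitiveOn F F' 0 Real.pi) (hF' : IsPrimitiveOn F' F'' 0 Real.pi)
    (hπ : F Real.pi = 0) {f g : L2 E} (hf : f =ᵐ[volume.restrict (Ioo 0 Real.pi)] F)
    (hg : g =ᵐ[volume.restrict (Ioo 0 Real.pi)] F'') (k : ℕ) :
    coef 𝕜 k g + freqSq k • coef 𝕜 k f = sineAmp k • F 0 := by
  rw [coef_eq_smul, coef_eq_smul, integral_Ioo_smul_congr_ae hf, integral_Ioo_smul_congr_ae hg,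
    hF.integral_sin_smul hF' hπ, smul_comm (freqSq k), ← smul_add, freqSq, ← Nat.cast_succ,
    sub_add_cancel, smul_smul, sineAmp, Nat.cast_succ]

theorem IsH2H10.coef_deriv₂ {f f' f'' : L2 E} (h : IsH2H10 f f' f'') (k : ℕ) :
    coef 𝕜 k f'' = -(freqSq k • coef 𝕜 k f) := by
  obtain ⟨F, F', hF, hF', h₀, hπ, hfF, -⟩ := h.exists_isPrimitiveOn
  rw [eq_neg_iff_add_eq_zero, hF.coef_add_freqSq_smul_coef hF' hπ hfF (ae_eq_refl _), h₀,
    smul_zero]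

end Coefficients

section Graph

/-- The endomorphism of `𝕜²` given by a matrix. -/
def matOp {𝕜 : Type*} [RCLike 𝕜] (M : Matrix (Fin 2) (Fin 2) 𝕜) :
    EuclideanSpace 𝕜 (Fin 2) →L[𝕜] EuclideanSpace 𝕜 (Fin 2) :=
  Matrix.toEuclideanCLM (n := Fin 2) (𝕜 := 𝕜) M

theorem coef_matMul {𝕜 : Type*} [RCLike 𝕜] (M : Matrix (Fin 2) (Fin 2) 𝕜) (k : ℕ)
    (f : L2 (EuclideanSpace 𝕜 (Fin 2))) : coef 𝕜 k (matMul M f) = matOp M (coef 𝕜 k f) :=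
  coef_of_ae_eq (𝕜 := 𝕜) (𝕜' := 𝕜) ((matOp M).restrictScalars ℝ)
    (ContinuousLinearMap.coeFn_compLpL _ _) k

theorem coef_stateC (k : ℕ) (f : StateR) : coef ℂ k (stateC f) = vecC (coef ℝ k f) :=
  coef_of_ae_eq (𝕜 := ℝ) (𝕜' := ℂ) vecC (ContinuousLinearMap.coeFn_compLpL _ _) k

theorem mem_parabolicGraph_iff (A₀ : Matrix (Fin 2) (Fin 2) ℝ) (f g : StateC) :
    (f, g) ∈ parabolicGraph A₀ ↔
      ∀ k, coef ℂ k g = modeOp (matOp (matC A₀)) k (coef ℂ k f) := by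
  constructor
  · rintro ⟨f', f'', hf, hg⟩ k
    simp only at hg hf
    rw [hg, map_add, coef_matMul, modeOp_apply, hf.coef_deriv₂]
    abel
  · intro h
    obtain ⟨F, F', hF⟩ := exists_isH2H10 (g - matMul (matC A₀) f)
    have hFf : F = f := L2_ext_coef ℂ fun k => by
      have hcoef := hF.coef_deriv₂ (𝕜 := ℂ) k
      rw [map_sub, h, coef_matMul, modeOp_apply, sub_sub_cancel_left, neg_inj] at hcoef
      exact (smul_right_injective _ (freqSq_pos k).ne' hcoef).symm
    subst hFf
    exact ⟨F', _, hF, by simp⟩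

end Graph

/-! ## Dirichlet lifts -/

section Lift

variable {𝕜 : Type*} [RCLike 𝕜] {E : Type*} [NormedAddCommGroup E] [NormedSpace 𝕜 E]

/-- The first order system equivalent to `f'' = N f`. -/
def firstOrder (N : E →L[𝕜] E) : E × E →L[𝕜] E × E :=
  (ContinuousLinearMap.snd 𝕜 E E).prod (N.comp (ContinuousLinearMap.fst 𝕜 E E))

/-- The solution of `f'' = N f`, `f(0) = 0`, `f'(0) = c` at the point `x`, paired with its
derivative: for `N = ν²` this is `(ν⁻¹ sinh (νx) c, cosh (νx) c)`. -/
def sinhOp (N : E →L[𝕜] E) (x : ℝ) : E →L[𝕜] E × E :=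
  (expOp (firstOrder N) x).comp (ContinuousLinearMap.inr 𝕜 E E)

theorem sinhOp_zero (N : E →L[𝕜] E) (c : E) : sinhOp N 0 c = (0, c) := by
  simp [sinhOp, expOp_zero]

variable [CompleteSpace E] [NormedSpace ℝ E] [IsScalarTower ℝ 𝕜 E]

theorem contDiff_sinhOp (N : E →L[𝕜] E) (n : ℕ) (c : E) : ContDiff ℝ n fun x => sinhOp N x c :=
  contDiff_expOp_apply _ n _

theorem hasDerivAt_sinhOp_fst (N : E →L[𝕜] E) (c : E) (x : ℝ) :
    HasDerivAt (fun x => (sinhOp N x c).1) (sinhOp N x c).2 x :=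
  (ContinuousLinearMap.fst ℝ E E).hasFDerivAt.comp_hasDerivAt x
    (hasDerivAt_expOp_apply (firstOrder N) ((0 : E), c) x)

theorem hasDerivAt_sinhOp_snd (N : E →L[𝕜] E) (c : E) (x : ℝ) :
    HasDerivAt (fun x => (sinhOp N x c).2) (N (sinhOp N x c).1) x :=
  (ContinuousLinearMap.snd ℝ E E).hasFDerivAt.comp_hasDerivAt x
    (hasDerivAt_expOp_apply (firstOrder N) ((0 : E), c) x)

-- The reflection `x ↦ π - x` preserves the equation and moves the zero of the solution to `π`.
theorem hasDerivAt_sinhOp_reflect_fst (N : E →L[𝕜] E) (c : E) (x : ℝ) :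
    HasDerivAt (fun x => (sinhOp N (Real.pi - x) c).1) (-(sinhOp N (Real.pi - x) c).2) x :=
  (hasDerivAt_sinhOp_fst N c (Real.pi - x)).comp_const_sub Real.pi x

theorem hasDerivAt_sinhOp_reflect_snd (N : E →L[𝕜] E) (c : E) (x : ℝ) :
    HasDerivAt (fun x => -(sinhOp N (Real.pi - x) c).2) (N (sinhOp N (Real.pi - x) c).1) x := by
  simpa using ((hasDerivAt_sinhOp_snd N c (Real.pi - x)).comp_const_sub Real.pi x).fun_neg

theorem continuous_sinhOp_reflect (N : E →L[𝕜] E) (c : E) :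
    Continuous fun x => sinhOp N (Real.pi - x) c :=
  (contDiff_sinhOp N 0 c).continuous.comp (continuous_const.sub continuous_id)

end Lift

section LiftCoefficients

variable {𝕜 : Type*} [RCLike 𝕜] {E : Type*} [NormedAddCommGroup E] [InnerProductSpace 𝕜 E]
  [NormedSpace ℝ E] [IsScalarTower ℝ 𝕜 E] [CompleteSpace E]

theorem coef_of_dirichlet {h h' : ℝ → E} {N : E →L[𝕜] E} (hc : ContinuousOn h (Icc 0 Real.pi))
    (hc' : ContinuousOn h' (Icc 0 Real.pi)) (hd : ∀ x ∈ Ioo 0 Real.pi, HasDerivAt h (h' x) x)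
    (hd' : ∀ x ∈ Ioo 0 Real.pi, HasDerivAt h' (N (h x)) x) (hπ : h Real.pi = 0)
    {f : L2 E} (hf : f =ᵐ[volume.restrict (Ioo 0 Real.pi)] h) (k : ℕ) :
    N (coef 𝕜 k f) + freqSq k • coef 𝕜 k f = sineAmp k • h 0 := by
  have hNf : N.compLpL 2 _ f =ᵐ[volume.restrict (Ioo 0 Real.pi)] fun x => N (f x) :=
    N.coeFn_compLpL _
  have hNh : N.compLpL 2 _ f =ᵐ[volume.restrict (Ioo 0 Real.pi)] fun x => N (h x) := by
    filter_upwards [hNf, hf] with x hx hfx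
    rw [hx, hfx]
  have hcoef : coef 𝕜 k (N.compLpL 2 _ f) = N (coef 𝕜 k f) :=
    coef_of_ae_eq (𝕜 := 𝕜) (𝕜' := 𝕜) (N.restrictScalars ℝ) hNf k
  rw [← uIcc_of_le Real.pi_pos.le] at hc hc'
  rw [← uIoo_of_le Real.pi_pos.le] at hd hd'
  rw [← hcoef]
  exact IsPrimitiveOn.coef_add_freqSq_smul_coef (.of_continuousOn hc hc' hd)
    (.of_continuousOn hc' (N.continuous.comp_continuousOn hc) hd') hπ hf hNh k

theorem coef_of_sinhOp_reflect (N : E →L[𝕜] E) (c : E) {f : L2 E}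
    (hf : f =ᵐ[volume.restrict (Ioo 0 Real.pi)] fun x => (sinhOp N (Real.pi - x) c).1) (k : ℕ) :
    N (coef 𝕜 k f) + freqSq k • coef 𝕜 k f = sineAmp k • (sinhOp N Real.pi c).1 := by
  have hcont := continuous_sinhOp_reflect N c
  simpa only [sub_zero] using coef_of_dirichlet hcont.fst.continuousOn hcont.snd.neg.continuousOn
    (fun x _ => hasDerivAt_sinhOp_reflect_fst N c x)
    (fun x _ => hasDerivAt_sinhOp_reflect_snd N c x) (by simp [sinhOp_zero]) hf k

theorem eqOn_zero_of_sinhOp_pi_fst_eq_zero {N : E →L[𝕜] E}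
    (hN : ∀ k c, N c + freqSq k • c = 0 → c = 0) {c : E} (hc : (sinhOp N Real.pi c).1 = 0) :
    EqOn (fun x => (sinhOp N (Real.pi - x) c).1) 0 (Icc 0 Real.pi) := by
  have hcont := (continuous_sinhOp_reflect N c).fst.continuousOn (s := Icc 0 Real.pi)
  have hmem := memLp_of_continuousOn_Icc hcont
  have hzero : hmem.toLp = (0 : L2 E) := L2_ext_coef 𝕜 fun k => by
    have hcoef := coef_of_sinhOp_reflect N c hmem.coeFn_toLp k
    rw [hc, smul_zero] at hcoef
    rw [hN k _ hcoef, map_zero]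
  exact eq_of_ae_eq_of_continuousOn Real.pi_pos hcont continuousOn_const
    ((hzero ▸ hmem.coeFn_toLp).symm.trans (Lp.coeFn_zero E 2 _))

theorem injective_sinhOp_pi_fst {N : E →L[𝕜] E} (hN : ∀ k c, N c + freqSq k • c = 0 → c = 0) :
    Function.Injective ((ContinuousLinearMap.fst 𝕜 E E).comp (sinhOp N Real.pi)) := by
  refine (injective_iff_map_eq_zero _).2 fun c hc => ?_
  have hπ : Real.pi ∈ Icc 0 Real.pi := right_mem_Icc.2 Real.pi_pos.le
  have hzero := eqOn_zero_of_sinhOp_pi_fst_eq_zero hN hc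
  have hderiv := (hasDerivAt_sinhOp_reflect_fst N c Real.pi).hasDerivWithinAt (s := Icc 0 Real.pi)
  have hderiv₀ : HasDerivWithinAt (fun x => (sinhOp N (Real.pi - x) c).1) 0 (Icc 0 Real.pi)
      Real.pi := (hasDerivWithinAt_const _ _ 0).congr hzero (hzero hπ)
  simpa [sinhOp_zero] using (uniqueDiffOn_Icc Real.pi_pos _ hπ).eq_deriv _ hderiv hderiv₀

end LiftCoefficients

section DirichletLift

variable {A₀ : Matrix (Fin 2) (Fin 2) ℝ} {B₀ : EuclideanSpace ℝ (Fin 2)} {ω : ℂ}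

/-- The matrix `A₀` as an operator on `ℂ²`. -/
abbrev opC (A₀ : Matrix (Fin 2) (Fin 2) ℝ) :
    EuclideanSpace ℂ (Fin 2) →L[ℂ] EuclideanSpace ℂ (Fin 2) := matOp (matC A₀)

theorem smul_sub_modeOp (ω : ℂ) (k : ℕ) (c : EuclideanSpace ℂ (Fin 2)) :
    ω • c - modeOp (opC A₀) k c = (ω • 1 - opC A₀ : _ →L[ℂ] _) c + freqSq k • c := by
  rw [modeOp_apply, sub_apply, smul_apply, one_apply_eq_self, sub_sub_eq_add_sub,
    add_sub_right_comm]

theorem NonResonant.eq_zero (h : NonResonant A₀ ω) (k : ℕ) (c : EuclideanSpace ℂ (Fin 2))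
    (hc : ω • c - modeOp (opC A₀) k c = 0) : c = 0 := by
  refine (WithLp.ofLp_eq_zero 2).1
    (Matrix.eq_zero_of_mulVec_eq_zero (h (k + 1) k.succ_pos) ?_)
  rw [← WithLp.ofLp_zero 2, ← hc, modeOp_apply]
  ext i
  simp only [matOp, WithLp.ofLp_sub, WithLp.ofLp_smul, Matrix.ofLp_toEuclideanCLM,
    Matrix.sub_mulVec, Matrix.scalar_apply, Pi.sub_apply, Matrix.mulVec_diagonal, Pi.smul_apply,
    freqSq, Complex.real_smul, smul_eq_mul]
  push_cast
  ring

theorem NonResonant.exists_isDirichletLift (h : NonResonant A₀ ω) (B₀ : EuclideanSpace ℝ (Fin 2))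
    (a : ℂ) : ∃ f, IsDirichletLift A₀ B₀ ω a f := by
  set N : EuclideanSpace ℂ (Fin 2) →L[ℂ] EuclideanSpace ℂ (Fin 2) := ω • 1 - opC A₀ with hN
  have hinj := injective_sinhOp_pi_fst (N := N) fun k c hc => h.eq_zero k c (by
    rw [smul_sub_modeOp, ← hN, hc])
  obtain ⟨c, hc⟩ := LinearMap.surjective_of_injective
    (f := ((ContinuousLinearMap.fst ℂ _ _).comp (sinhOp N Real.pi)).toLinearMap) hinj (a • vecC B₀)
  refine ⟨fun x => (sinhOp N (Real.pi - x) c).1, ?_, fun x _ => ?_, ?_, ?_⟩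
  · exact (contDiff_fst.comp
      ((contDiff_sinhOp N 2 c).comp (contDiff_const.sub contDiff_id))).contDiffOn
  · have hderiv : deriv (fun x => (sinhOp N (Real.pi - x) c).1) =
        fun x => -(sinhOp N (Real.pi - x) c).2 :=
      funext fun x => (hasDerivAt_sinhOp_reflect_fst N c x).deriv
    rw [hderiv, (hasDerivAt_sinhOp_reflect_snd N c x).deriv, hN]
    simp [opC, matOp]
  · simpa using hc
  · simp [sinhOp_zero]

theorem IsDirichletLift.coef_eq {a : ℂ} {h : ℝ → EuclideanSpace ℂ (Fin 2)}
    (hh : IsDirichletLift A₀ B₀ ω a h) {f : StateC}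
    (hf : f =ᵐ[volume.restrict (Ioo 0 Real.pi)] h) (k : ℕ) :
    ω • coef ℂ k f - modeOp (opC A₀) k (coef ℂ k f) = a • sineAmp k • vecC B₀ := by
  have hC1 : ContDiffOn ℝ 1 (derivWithin h (Icc 0 Real.pi)) (Icc 0 Real.pi) :=
    hh.contDiffOn.derivWithin (uniqueDiffOn_Icc Real.pi_pos) (by norm_num)
  have hev : ∀ x ∈ Ioo 0 Real.pi, derivWithin h (Icc 0 Real.pi) =ᶠ[𝓝 x] deriv h := fun x hx => by
    filter_upwards [isOpen_Ioo.mem_nhds hx] with y hy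
    exact derivWithin_of_mem_nhds (Icc_mem_nhds hy.1 hy.2)
  rw [smul_sub_modeOp, smul_comm, ← hh.at_zero]
  refine coef_of_dirichlet hh.contDiffOn.continuousOn hC1.continuousOn (fun x hx => ?_)
    (fun x hx => ?_) hh.at_pi hf k
  · rw [(hev x hx).eq_of_nhds]
    exact ((hh.contDiffOn.differentiableOn (by norm_num)).differentiableAt
      (Icc_mem_nhds hx.1 hx.2)).hasDerivAt
  · refine ((hC1.differentiableOn one_ne_zero).differentiableAt
      (Icc_mem_nhds hx.1 hx.2)).hasDerivAt.congr_deriv ?_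
    rw [(hev x hx).deriv_eq, sub_apply, smul_apply, one_apply_eq_self, ← hh.ode x hx]
    exact (add_sub_cancel_right _ _).symm

theorem NonResonant.eqOn_of_isDirichletLift (hω : NonResonant A₀ ω) {a : ℂ}
    {h h' : ℝ → EuclideanSpace ℂ (Fin 2)} (hh : IsDirichletLift A₀ B₀ ω a h)
    (hh' : IsDirichletLift A₀ B₀ ω a h') : EqOn h' h (Icc 0 Real.pi) := by
  have hmem := memLp_of_continuousOn_Icc hh.contDiffOn.continuousOn
  have hmem' := memLp_of_continuousOn_Icc hh'.contDiffOn.continuousOn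
  have heq : (hmem.toLp : StateC) = hmem'.toLp := L2_ext_coef ℂ fun k => by
    rw [← sub_eq_zero]
    refine hω.eq_zero k _ ?_
    rw [map_sub, smul_sub, sub_sub_sub_comm, hh.coef_eq hmem.coeFn_toLp,
      hh'.coef_eq hmem'.coeFn_toLp, sub_self]
  exact eq_of_ae_eq_of_continuousOn Real.pi_pos hh'.contDiffOn.continuousOn
    hh.contDiffOn.continuousOn (hmem'.coeFn_toLp.symm.trans (heq ▸ hmem.coeFn_toLp))

theorem IsDirichletLift.smul {a : ℂ} {h : ℝ → EuclideanSpace ℂ (Fin 2)}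
    (hh : IsDirichletLift A₀ B₀ ω 1 h) : IsDirichletLift A₀ B₀ ω a (fun x => a • h x) where
  contDiffOn := hh.contDiffOn.const_smul a
  ode x hx := by
    have hderiv : deriv (fun x => a • h x) = fun x => a • deriv h x :=
      funext fun x => deriv_const_smul_field a h
    rw [hderiv, deriv_fun_const_smul_field a (deriv h), map_smul, ← smul_add, hh.ode x hx,
      smul_comm]
  at_zero := by rw [hh.at_zero, one_smul]
  at_pi := by rw [hh.at_pi, smul_zero]

/-- `D` is the Dirichlet map at `ω`, written in sine coefficients: the boundary value `aB₀` of
`h = D a` enters the `k`-th coefficient of `ωh - (h'' + A₀h) = 0` with the weight `sineAmp k`. -/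
def IsDirichletMap (A₀ : Matrix (Fin 2) (Fin 2) ℝ) (B₀ : EuclideanSpace ℝ (Fin 2)) (ω : ℂ)
    (D : ℂ →L[ℂ] StateC) : Prop :=
  ∀ a k, ω • coef ℂ k (D a) - modeOp (opC A₀) k (coef ℂ k (D a)) = a • sineAmp k • vecC B₀

theorem NonResonant.exists_dirichletMap (hω : NonResonant A₀ ω) (B₀ : EuclideanSpace ℝ (Fin 2)) :
    ∃ D : ℂ →L[ℂ] StateC,
      (∀ a h, IsDirichletLift A₀ B₀ ω a h → D a =ᵐ[volume.restrict (Ioo 0 Real.pi)] h) ∧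
      IsDirichletMap A₀ B₀ ω D := by
  obtain ⟨h, hh⟩ := hω.exists_isDirichletLift B₀ 1
  have hmem := memLp_of_continuousOn_Icc hh.contDiffOn.continuousOn
  set f : StateC := hmem.toLp with hf
  have hD : ∀ a h', IsDirichletLift A₀ B₀ ω a h' →
      ContinuousLinearMap.toSpanSingleton ℂ f a =ᵐ[volume.restrict (Ioo 0 Real.pi)] h' := by
    intro a h' hh'
    have heq := hω.eqOn_of_isDirichletLift hh' (hh.smul (a := a))
    rw [ContinuousLinearMap.toSpanSingleton_apply]
    filter_upwards [Lp.coeFn_smul a f, hmem.coeFn_toLp, ae_restrict_mem measurableSet_Ioo]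
      with x hsmul hfx hx
    rw [hsmul, Pi.smul_apply, hf, hfx, ← heq (Ioo_subset_Icc_self hx)]
  exact ⟨_, hD, fun a k => hh.smul.coef_eq (hD a _ hh.smul) k⟩

end DirichletLift

/-! ## Truncation to finitely many modes -/

section Cutoff

variable (𝕜 : Type*) [RCLike 𝕜] {E : Type*} [NormedAddCommGroup E] [InnerProductSpace 𝕜 E]
  [NormedSpace ℝ E] [IsScalarTower ℝ 𝕜 E] [CompleteSpace E]

/-- The projection onto the first `N` modes. -/
def cutoff (N : ℕ) : L2 E →L[𝕜] L2 E :=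
  ∑ k ∈ Finset.range N, (sineEmb 𝕜 k).toContinuousLinearMap.comp (coef 𝕜 k)

theorem cutoff_apply (N : ℕ) (f : L2 E) :
    cutoff 𝕜 N f = ∑ k ∈ Finset.range N, sineEmb 𝕜 k (coef 𝕜 k f) := by
  simp [cutoff]

theorem coef_cutoff (N j : ℕ) (f : L2 E) :
    coef 𝕜 j (cutoff 𝕜 N f) = if j < N then coef 𝕜 j f else 0 := by
  rw [cutoff_apply, map_sum]
  simp_rw [coef_sineEmb]
  rw [Finset.sum_ite_eq]
  simp

theorem norm_cutoff_apply_le (N : ℕ) (f : L2 E) : ‖cutoff 𝕜 N f‖ ≤ ‖f‖ := by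
  have := norm_le_mul_of_coef_le (𝕜 := 𝕜) (f := f) (g := cutoff 𝕜 N f) zero_le_one fun k => by
    rw [coef_cutoff]
    split_ifs <;> simp
  simpa using this

theorem tendsto_cutoff (f : L2 E) : Tendsto (fun N => cutoff 𝕜 N f) atTop (𝓝 f) := by
  refine tendsto_of_tendsto_coef 𝕜 (hasSum_norm_sq_coef 𝕜 f).summable
    (Eventually.of_forall fun N k => ?_) fun k => ?_
  · rw [coef_cutoff]
    split_ifs <;> simp
  · refine tendsto_const_nhds.congr' ?_
    filter_upwards [eventually_gt_atTop k] with N hN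
    rw [coef_cutoff, if_pos hN]

theorem isCompactOperator_cutoff [FiniteDimensional 𝕜 E] (N : ℕ) :
    IsCompactOperator (cutoff (E := E) 𝕜 N) := by
  have : ProperSpace E := FiniteDimensional.proper_rclike 𝕜 E
  unfold cutoff
  induction N with
  | zero => simpa using isCompactOperator_zero
  | succ N ih =>
    rw [Finset.sum_range_succ]
    have h : IsCompactOperator ((sineEmb 𝕜 N).toContinuousLinearMap ∘ coef (E := E) 𝕜 N) :=
      (isCompactOperator_of_locallyCompactSpace_dom (coef 𝕜 N)).clm_comp _
    exact ih.add h

theorem isCompactOperator_blockDiag [FiniteDimensional 𝕜 E] {m : ℕ → E →L[𝕜] E} {C : ℝ}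
    (hm : ∀ k, ‖m k‖ ≤ C) (hm₀ : Tendsto (fun k => ‖m k‖) atTop (𝓝 0)) :
    IsCompactOperator (blockDiag m C hm) := by
  refine isCompactOperator_of_tendsto (F := fun N => (blockDiag m C hm).comp (cutoff 𝕜 N))
    (l := atTop) ?_
    (Eventually.of_forall fun N => (isCompactOperator_cutoff 𝕜 N).clm_comp (blockDiag m C hm))
  rw [Metric.tendsto_atTop]
  intro ε hε
  obtain ⟨N₀, hN₀⟩ := eventually_atTop.1 (hm₀.eventually (ge_mem_nhds (half_pos hε)))
  refine ⟨N₀, fun N hN => ?_⟩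
  rw [dist_eq_norm]
  refine (ContinuousLinearMap.opNorm_le_bound _ (half_pos hε).le fun f => ?_).trans_lt
    (half_lt_self hε)
  refine norm_le_mul_of_coef_le (𝕜 := 𝕜) (half_pos hε).le fun k => ?_
  rw [sub_apply, map_sub, ContinuousLinearMap.comp_apply, coef_blockDiag, coef_blockDiag,
    coef_cutoff]
  split_ifs with hk
  · rw [sub_self, norm_zero]
    positivity
  · rw [map_zero, zero_sub, norm_neg]
    exact (m k).le_of_opNorm_le (hN₀ k (hN.trans (not_lt.1 hk))) _

theorem isIdempotentElem_cutoff (N : ℕ) : IsIdempotentElem (cutoff (E := E) 𝕜 N) := by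
  refine ContinuousLinearMap.ext fun f => L2_ext_coef 𝕜 fun k => ?_
  rw [mul_apply_eq_comp, coef_cutoff, coef_cutoff]
  split_ifs <;> rfl

theorem isClosed_range_cutoff (N : ℕ) :
    IsClosed ((cutoff (E := E) 𝕜 N).range : Set (L2 E)) :=
  ContinuousLinearMap.IsIdempotentElem.isClosed_range (isIdempotentElem_cutoff 𝕜 N)

theorem isCompl_ker_range_cutoff (N : ℕ) :
    IsCompl (cutoff (E := E) 𝕜 N).ker (cutoff (E := E) 𝕜 N).range :=
  (LinearMap.IsIdempotentElem.isCompl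
    (ContinuousLinearMap.IsIdempotentElem.toLinearMap (isIdempotentElem_cutoff 𝕜 N))).symm

variable {𝕜}

theorem mem_ker_cutoff_iff {N : ℕ} {f : L2 E} :
    f ∈ (cutoff 𝕜 N).ker ↔ ∀ k < N, coef 𝕜 k f = 0 := by
  refine ⟨fun hf k hk => ?_, fun h => L2_ext_coef 𝕜 fun k => ?_⟩
  · have hcoef := coef_cutoff 𝕜 N k f
    rwa [if_pos hk, show cutoff 𝕜 N f = 0 from hf, map_zero, eq_comm] at hcoef
  · refine (coef_cutoff 𝕜 N k f).trans ?_
    rw [map_zero, ite_eq_right_iff]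
    exact h k

theorem mem_range_cutoff_iff {N : ℕ} {f : L2 E} :
    f ∈ (cutoff 𝕜 N).range ↔ ∀ k, N ≤ k → coef 𝕜 k f = 0 := by
  constructor
  · rintro ⟨f, rfl⟩ k hk
    exact (coef_cutoff 𝕜 N k f).trans (if_neg hk.not_gt)
  · refine fun h => ⟨f, L2_ext_coef 𝕜 fun k => ?_⟩
    refine (coef_cutoff 𝕜 N k f).trans ?_
    split_ifs with hk
    exacts [rfl, (h k (not_lt.1 hk)).symm]

theorem heatOp_mem_range_cutoff (a : E →L[𝕜] E) {t : ℝ} (ht : 0 ≤ t) {N : ℕ} {f : L2 E}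
    (hf : f ∈ (cutoff 𝕜 N).range) : heatOp a t f ∈ (cutoff 𝕜 N).range := by
  rw [mem_range_cutoff_iff] at hf ⊢
  intro k hk
  rw [coef_heatOp a ht, hf k hk, map_zero]

end Cutoff

/-! ## The resolvent -/

section Resolvent

variable {A₀ : Matrix (Fin 2) (Fin 2) ℝ} {ω : ℂ}

theorem coef_parabolicOp (x : (parabolicOp A₀).domain) (k : ℕ) :
    coef ℂ k (parabolicOp A₀ x) = modeOp (opC A₀) k (coef ℂ k (x : StateC)) := by
  have hgraph := (parabolicOp A₀).mem_graph x
  rw [parabolicOp_graph, mem_parabolicGraph_iff] at hgraph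
  exact hgraph k

theorem exists_mem_domain {x y : StateC} (h : ∀ k, coef ℂ k y = modeOp (opC A₀) k (coef ℂ k x)) :
    ∃ hx : x ∈ (parabolicOp A₀).domain, parabolicOp A₀ ⟨x, hx⟩ = y := by
  have hgraph := (mem_parabolicGraph_iff A₀ x y).2 h
  rw [← parabolicOp_graph, LinearPMap.mem_graph_iff] at hgraph
  obtain ⟨z, rfl, hz⟩ := hgraph
  exact ⟨z.2, hz⟩

theorem sineEmb_mem_domain (k : ℕ) (c : EuclideanSpace ℂ (Fin 2)) :
    ∃ hx : sineEmb ℂ k c ∈ (parabolicOp A₀).domain,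
      parabolicOp A₀ ⟨sineEmb ℂ k c, hx⟩ = sineEmb ℂ k (modeOp (opC A₀) k c) := by
  refine exists_mem_domain fun j => ?_
  rw [coef_sineEmb, coef_sineEmb]
  split_ifs with h
  · rw [h]
  · rw [map_zero]

theorem dense_domain_parabolicOp : Dense ((parabolicOp A₀).domain : Set StateC) := by
  intro f
  refine mem_closure_of_tendsto (tendsto_cutoff ℂ f) (Eventually.of_forall fun N => ?_)
  rw [cutoff_apply]
  exact Submodule.sum_mem _ fun k _ => (sineEmb_mem_domain k _).1

/-- The restriction of `ω - A` to the `k`-th mode, invertible when `ω` is nonresonant. -/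
def NonResonant.blockEquiv (hω : NonResonant A₀ ω) (k : ℕ) :
    EuclideanSpace ℂ (Fin 2) ≃L[ℂ] EuclideanSpace ℂ (Fin 2) :=
  (LinearEquiv.ofInjectiveEndo (ω • 1 - modeOp (opC A₀) k : _ →L[ℂ] _).toLinearMap
    ((injective_iff_map_eq_zero _).2
      fun c hc => hω.eq_zero k c (by simpa using hc))).toContinuousLinearEquiv

theorem NonResonant.blockEquiv_apply (hω : NonResonant A₀ ω) (k : ℕ)
    (c : EuclideanSpace ℂ (Fin 2)) :
    hω.blockEquiv k c = ω • c - modeOp (opC A₀) k c := by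
  simp [blockEquiv]

/-- The restriction of the resolvent `(ω - A)⁻¹` to the `k`-th mode. -/
def NonResonant.resolventBlock (hω : NonResonant A₀ ω) (k : ℕ) :
    EuclideanSpace ℂ (Fin 2) →L[ℂ] EuclideanSpace ℂ (Fin 2) :=
  (hω.blockEquiv k).symm

theorem NonResonant.smul_resolventBlock_sub (hω : NonResonant A₀ ω) (k : ℕ)
    (c : EuclideanSpace ℂ (Fin 2)) :
    ω • hω.resolventBlock k c - modeOp (opC A₀) k (hω.resolventBlock k c) = c := by
  rw [← hω.blockEquiv_apply]
  exact (hω.blockEquiv k).apply_symm_apply c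

theorem NonResonant.resolventBlock_smul_sub (hω : NonResonant A₀ ω) (k : ℕ)
    (c : EuclideanSpace ℂ (Fin 2)) :
    hω.resolventBlock k (ω • c - modeOp (opC A₀) k c) = c := by
  rw [← hω.blockEquiv_apply]
  exact (hω.blockEquiv k).symm_apply_apply c

theorem NonResonant.norm_resolventBlock_le (hω : NonResonant A₀ ω) {k : ℕ}
    (hk : ‖ω‖ + ‖opC A₀‖ < freqSq k) :
    ‖hω.resolventBlock k‖ ≤ (freqSq k - (‖ω‖ + ‖opC A₀‖))⁻¹ := by
  refine ContinuousLinearMap.opNorm_le_bound _ (inv_nonneg.2 (sub_pos.2 hk).le) fun c => ?_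
  rw [le_inv_mul_iff₀ (sub_pos.2 hk)]
  refine (mul_norm_le_norm_smul_sub_modeOp (opC A₀) ω k _).trans_eq ?_
  rw [hω.smul_resolventBlock_sub]

theorem NonResonant.tendsto_norm_resolventBlock (hω : NonResonant A₀ ω) :
    Tendsto (fun k => ‖hω.resolventBlock k‖) atTop (𝓝 0) := by
  have hfreq : Tendsto freqSq atTop atTop :=
    tendsto_atTop_mono le_freqSq tendsto_natCast_atTop_atTop
  refine squeeze_zero' (Eventually.of_forall fun _ => norm_nonneg _) ?_
    (tendsto_inv_atTop_zero.comp (tendsto_atTop_add_const_right _ (-(‖ω‖ + ‖opC A₀‖)) hfreq))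
  filter_upwards [hfreq.eventually_gt_atTop (‖ω‖ + ‖opC A₀‖)] with k hk
  exact hω.norm_resolventBlock_le hk

theorem NonResonant.exists_resolvent (hω : NonResonant A₀ ω) :
    ∃ R, IsResolventAt (parabolicOp A₀) ω R ∧ IsCompactOperator R := by
  obtain ⟨C, hC⟩ := hω.tendsto_norm_resolventBlock.bddAbove_range
  have hm := forall_mem_range.1 hC
  refine ⟨blockDiag _ C hm, ⟨fun x => ?_, fun x => L2_ext_coef ℂ fun k => ?_⟩,
    isCompactOperator_blockDiag ℂ hm hω.tendsto_norm_resolventBlock⟩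
  · obtain ⟨hd, hy⟩ := exists_mem_domain (A₀ := A₀) (x := blockDiag _ C hm x)
      (y := ω • blockDiag _ C hm x - x) fun k => by
        rw [map_sub, map_smul, coef_blockDiag, sub_eq_iff_eq_add, ← sub_eq_iff_eq_add',
          hω.smul_resolventBlock_sub]
    exact ⟨hd, by rw [hy, sub_sub_cancel]⟩
  · rw [coef_blockDiag, map_sub, map_smul, coef_parabolicOp, hω.resolventBlock_smul_sub]

theorem IsResolventAt.isCompactOperator {H : Type*} [NormedAddCommGroup H] [InnerProductSpace ℂ H]
    {A : H →ₗ.[ℂ] H} {ω μ : ℂ} {R S : H →L[ℂ] H} (hR : IsResolventAt A ω R)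
    (hc : IsCompactOperator R) (hS : IsResolventAt A μ S) : IsCompactOperator S := by
  have hidentity : S = R.comp (1 + (ω - μ) • S) := by
    ext1 x
    obtain ⟨hd, hx⟩ := hS.1 x
    have hRS := hR.2 ⟨S x, hd⟩
    simp only [ContinuousLinearMap.comp_apply, add_apply, one_apply_eq_self, smul_apply]
    refine hRS.symm.trans (congrArg R ?_)
    nth_rw 3 [← hx]
    simp only [sub_smul]
    abel
  rw [hidentity]
  exact hc.comp_clm _

theorem nonResonant_of_norm_lt {r : ℝ} (hr : ‖opC A₀‖ < r) : NonResonant A₀ r := by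
  intro k _ hdet
  have hmem : ((r : ℂ) + (k : ℂ) ^ 2) ∈ spectrum ℂ (matC A₀) := by
    rw [Matrix.mem_spectrum_iff_isRoot_charpoly, Polynomial.IsRoot, Matrix.eval_charpoly, hdet]
  rw [← AlgEquiv.spectrum_eq (Matrix.toEuclideanCLM (n := Fin 2) (𝕜 := ℂ))] at hmem
  have hle : r + (k : ℝ) ^ 2 ≤ ‖opC A₀‖ := by
    refine le_trans (Eq.le ?_) (spectrum.norm_le_norm_of_mem hmem)
    rw [← Complex.ofReal_natCast, ← Complex.ofReal_pow, ← Complex.ofReal_add, Complex.norm_real,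
      Real.norm_of_nonneg (add_nonneg ((norm_nonneg _).trans hr.le) (sq_nonneg _))]
  nlinarith [sq_nonneg (k : ℝ)]

theorem exists_nonResonant (A₀ : Matrix (Fin 2) (Fin 2) ℝ) : ∃ ω, NonResonant A₀ ω :=
  ⟨_, nonResonant_of_norm_lt (lt_add_one ‖opC A₀‖)⟩

theorem hasCompactResolvent_parabolicOp (A₀ : Matrix (Fin 2) (Fin 2) ℝ) :
    HasCompactResolvent (parabolicOp A₀) := by
  obtain ⟨ω, hω⟩ := exists_nonResonant A₀
  obtain ⟨R, hR, hc⟩ := hω.exists_resolvent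
  exact ⟨⟨ω, R, hR⟩, fun μ S hS => hR.isCompactOperator hc hS⟩

end Resolvent

/-! ## The spectral decomposition -/

section Spectral

variable {A₀ : Matrix (Fin 2) (Fin 2) ℝ}

theorem isInKerPow_sineEmb {lam : ℂ} (j n : ℕ) (c : EuclideanSpace ℂ (Fin 2))
    (h : (((opC A₀).toLinearMap - lam • 1 : Module.End ℂ _) ^ n) c = 0) :
    IsInKerPow (parabolicOp A₀) (lam - (freqSq j : ℝ)) n (sineEmb ℂ j c) := by
  induction n generalizing c with
  | zero =>
    have hc : c = 0 := by simpa using h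
    simp [IsInKerPow, hc]
  | succ n ih =>
    obtain ⟨hd, hy⟩ := sineEmb_mem_domain (A₀ := A₀) j c
    refine ⟨hd, ?_⟩
    have hmode : (lam - (freqSq j : ℝ)) • sineEmb ℂ j c - parabolicOp A₀ ⟨sineEmb ℂ j c, hd⟩ =
        sineEmb ℂ j (-(((opC A₀).toLinearMap - lam • 1 : Module.End ℂ _) c)) := by
      rw [hy, ← map_smul, ← map_sub]
      congr 1
      rw [modeOp_apply]
      simp only [LinearMap.sub_apply, LinearMap.smul_apply, Module.End.one_apply,
        ContinuousLinearMap.coe_coe, sub_smul, Complex.coe_smul]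
      abel
    rw [hmode]
    refine ih _ ?_
    rw [map_neg, ← Module.End.mul_apply, ← pow_succ, h, neg_zero]

theorem sineEmb_mem_span (j : ℕ) (c : EuclideanSpace ℂ (Fin 2)) {H₁ : Submodule ℂ StateC}
    (h : ∀ c, sineEmb ℂ j c ∈ H₁) :
    sineEmb ℂ j c ∈ Submodule.span ℂ {x | x ∈ H₁ ∧ IsGenEigenvector (parabolicOp A₀) x} := by
  have hc : c ∈ ⨆ lam : ℂ, Module.End.maxGenEigenspace (opC A₀).toLinearMap lam := by
    rw [Module.End.iSup_maxGenEigenspace_eq_top]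
    trivial
  induction hc using Submodule.iSup_induction' with
  | mem lam c hc =>
    rw [Module.End.mem_maxGenEigenspace] at hc
    obtain ⟨n, hn⟩ := hc
    refine Submodule.subset_span
      ⟨h c, _, n + 1, n.succ_pos, isInKerPow_sineEmb (lam := lam) j (n + 1) c ?_⟩
    rw [pow_succ', Module.End.mul_apply, hn, map_zero]
  | zero => rw [map_zero]; exact Submodule.zero_mem _
  | add c d _ _ hc hd => rw [map_add]; exact Submodule.add_mem _ hc hd

theorem range_cutoff_eq_closure_span (N : ℕ) :
    (cutoff ℂ N).range = (Submodule.span ℂ {x : StateC | x ∈ (cutoff ℂ N).range ∧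
      IsGenEigenvector (parabolicOp A₀) x}).topologicalClosure := by
  refine le_antisymm ?_ (Submodule.topologicalClosure_minimal _
    (Submodule.span_le.2 fun x hx => hx.1) (isClosed_range_cutoff ℂ N))
  rintro _ ⟨x, rfl⟩
  refine Submodule.le_topologicalClosure _ ?_
  rw [ContinuousLinearMap.coe_coe, cutoff_apply]
  refine Submodule.sum_mem _ fun k hk => sineEmb_mem_span k _ fun c => ?_
  refine mem_range_cutoff_iff.2 fun j hj => ?_
  rw [coef_sineEmb, if_neg]
  exact ((Finset.mem_range.1 hk).trans_le hj).ne'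

theorem sub_freqSq_mem_spectrumSet {lam : ℂ} (hlam : Module.End.HasEigenvalue
    (opC A₀).toLinearMap lam) (k : ℕ) : lam - (freqSq k : ℝ) ∈ spectrumSet (parabolicOp A₀) := by
  rintro ⟨R, hR⟩
  obtain ⟨c, hc⟩ := hlam.exists_hasEigenvector
  obtain ⟨hd, hz⟩ := isInKerPow_sineEmb (A₀ := A₀) (lam := lam) k 1 c (by simp [hc.apply_eq_smul])
  have hzero : sineEmb ℂ k c = 0 :=
    (hR.2 ⟨_, hd⟩).symm.trans ((congrArg R hz).trans (map_zero R))
  exact hc.2 ((sineEmb ℂ k).injective (hzero.trans (map_zero _).symm))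

theorem spectrumSet_parabolicOp_ne_empty : spectrumSet (parabolicOp A₀) ≠ ∅ := by
  obtain ⟨lam, hlam⟩ := Module.End.exists_eigenvalue (opC A₀).toLinearMap
  exact nonempty_iff_ne_empty.1 ⟨_, sub_freqSq_mem_spectrumSet hlam 0⟩

/-- The semigroup `e^{At}`. -/
def heatSemigroup (A₀ : Matrix (Fin 2) (Fin 2) ℝ) : C0Semigroup StateC where
  op := heatOp (opC A₀)
  op_zero := heatOp_zero _
  op_add _ _ hs ht := heatOp_add _ hs ht
  tendsto_zero := tendsto_heatOp _

theorem heatSemigroup_hasGenerator (A₀ : Matrix (Fin 2) (Fin 2) ℝ) :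
    (heatSemigroup A₀).HasGenerator (parabolicOp A₀).graph := by
  intro x y
  rw [parabolicOp_graph, SetLike.mem_coe, mem_parabolicGraph_iff]
  exact (tendsto_slope_heatOp_iff _ x y).symm

theorem spectralHypothesis_parabolicOp (A₀ : Matrix (Fin 2) (Fin 2) ℝ) :
    SpectralHypothesis (parabolicOp A₀) (heatSemigroup A₀) := by
  obtain ⟨N, hN⟩ := exists_nat_gt ‖opC A₀‖
  exact ⟨(cutoff ℂ N).ker, (cutoff ℂ N).range, (cutoff ℂ N).isClosed_ker,
    isClosed_range_cutoff ℂ N, isCompl_ker_range_cutoff ℂ N,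
    fun x hx => tendsto_heatOp_atTop_zero _ hN (mem_ker_cutoff_iff.1 hx),
    fun x hx t ht => heatOp_mem_range_cutoff _ ht hx,
    range_cutoff_eq_closure_span N,
    fun h => absurd h spectrumSet_parabolicOp_ne_empty⟩

end Spectral

/-! ## The extrapolation space -/

section Extrapolation

variable {H : Type*} [NormedAddCommGroup H] [InnerProductSpace ℂ H]

theorem GraphDom.norm_le_add {T : H →ₗ.[ℂ] H} (v : GraphDom T) :
    ‖v‖ ≤ ‖GraphDom.inclₗ T v‖ + ‖GraphDom.applyₗ T v‖ := by
  refine le_of_sq_le_sq ?_ (by positivity)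
  rw [GraphDom.norm_sq]
  nlinarith [mul_nonneg (norm_nonneg (GraphDom.inclₗ T v)) (norm_nonneg (GraphDom.applyₗ T v))]

variable [CompleteSpace H] {A : H →ₗ.[ℂ] H} {ω : ℂ} {R : H →L[ℂ] H}

theorem extend_eq_embed (hA : Dense (A.domain : Set H)) (x : A.domain) :
    extend A x = embed A (A x) := by
  ext v
  rw [extend_apply, embed_apply]
  exact LinearPMap.adjoint_isFormalAdjoint hA v x

/-- The operator `ω - 𝒜 : H → (dom A^*)'`. -/
def shift (A : H →ₗ.[ℂ] H) (ω : ℂ) : H →L[ℂ] Extrap A := ω • embed A - extend A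

theorem shift_apply (x : H) (v : GraphDom A.adjoint) :
    shift A ω x v = inner ℂ
      ((starRingEnd ℂ) ω • GraphDom.incl A.adjoint v - GraphDom.apply A.adjoint v) x := by
  rw [inner_sub_left, inner_smul_left, starRingEnd_self_apply, ← embed_apply, ← extend_apply]
  rfl

theorem shift_eq_embed (hA : Dense (A.domain : Set H)) (x : A.domain) :
    shift A ω x = embed A (ω • (x : H) - A x) := by
  rw [shift, sub_apply, smul_apply, extend_eq_embed hA, map_sub, map_smul]

theorem IsResolventAt.adjoint_mem_domain (hA : Dense (A.domain : Set H)) (hR : IsResolventAt A ω R)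
    (w : H) : ∃ h : R.adjoint w ∈ A.adjoint.domain,
      A.adjoint ⟨R.adjoint w, h⟩ = (starRingEnd ℂ) ω • R.adjoint w - w := by
  have hformal : ∀ x : A.domain, inner ℂ ((starRingEnd ℂ) ω • R.adjoint w - w) (x : H) =
      inner ℂ (R.adjoint w) (A x) := fun x => by
    have hRx := hR.2 x
    rw [map_sub, map_smul, sub_eq_iff_eq_add] at hRx
    rw [ContinuousLinearMap.adjoint_inner_left, inner_sub_left, inner_smul_left,
      starRingEnd_self_apply, ContinuousLinearMap.adjoint_inner_left, ← inner_smul_right, hRx,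
      inner_add_right, add_sub_cancel_left]
  have hd := LinearPMap.mem_adjoint_domain_of_exists _ ⟨_, hformal⟩
  exact ⟨hd, LinearPMap.adjoint_apply_eq hA ⟨_, hd⟩ hformal⟩

theorem IsResolventAt.adjoint_apply (hA : Dense (A.domain : Set H)) (hR : IsResolventAt A ω R)
    (v : A.adjoint.domain) : R.adjoint ((starRingEnd ℂ) ω • (v : H) - A.adjoint v) = v := by
  refine ext_inner_right ℂ fun y => ?_
  obtain ⟨hd, hy⟩ := hR.1 y
  have hformal : inner ℂ (A.adjoint v) (R y) = inner ℂ (v : H) (A ⟨R y, hd⟩) :=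
    LinearPMap.adjoint_isFormalAdjoint hA v ⟨R y, hd⟩
  rw [ContinuousLinearMap.adjoint_inner_left, inner_sub_left, inner_smul_left,
    starRingEnd_self_apply, hformal]
  nth_rw 3 [← hy]
  rw [inner_sub_right, inner_smul_right]

/-- The inverse of `ω̄ - A^*`, as a linear map into `dom A^*`. -/
def adjointResolventₗ (hA : Dense (A.domain : Set H)) (hR : IsResolventAt A ω R) :
    H →ₗ[ℂ] GraphDom A.adjoint :=
  LinearMap.codRestrict A.adjoint.domain R.adjoint.toLinearMap
    fun w => (hR.adjoint_mem_domain hA w).1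

theorem applyₗ_adjointResolventₗ (hA : Dense (A.domain : Set H)) (hR : IsResolventAt A ω R)
    (w : H) : GraphDom.applyₗ A.adjoint (adjointResolventₗ hA hR w) =
      (starRingEnd ℂ) ω • R.adjoint w - w :=
  (hR.adjoint_mem_domain hA w).2

/-- The inverse of `ω̄ - A^*`, as a bounded operator into `dom A^*` with the graph norm. -/
def adjointResolvent (hA : Dense (A.domain : Set H)) (hR : IsResolventAt A ω R) :
    H →L[ℂ] GraphDom A.adjoint :=
  (adjointResolventₗ hA hR).mkContinuous (‖R.adjoint‖ + (‖ω‖ * ‖R.adjoint‖ + 1)) fun w => by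
    refine (GraphDom.norm_le_add _).trans ?_
    rw [add_mul, applyₗ_adjointResolventₗ]
    refine add_le_add (R.adjoint.le_opNorm w) ((norm_sub_le _ _).trans ?_)
    rw [norm_smul, RCLike.norm_conj, add_mul, one_mul, mul_assoc]
    gcongr
    exact R.adjoint.le_opNorm w

theorem incl_adjointResolvent (hA : Dense (A.domain : Set H)) (hR : IsResolventAt A ω R) (w : H) :
    GraphDom.incl A.adjoint (adjointResolvent hA hR w) = R.adjoint w := rfl

theorem apply_adjointResolvent (hA : Dense (A.domain : Set H)) (hR : IsResolventAt A ω R) (w : H) :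
    GraphDom.apply A.adjoint (adjointResolvent hA hR w) = (starRingEnd ℂ) ω • R.adjoint w - w :=
  (hR.adjoint_mem_domain hA w).2

theorem adjointResolvent_apply (hA : Dense (A.domain : Set H)) (hR : IsResolventAt A ω R)
    (v : GraphDom A.adjoint) :
    adjointResolvent hA hR
      ((starRingEnd ℂ) ω • GraphDom.incl A.adjoint v - GraphDom.apply A.adjoint v) = v :=
  Subtype.ext (hR.adjoint_apply hA v)

theorem shift_injective (hA : Dense (A.domain : Set H)) (hR : IsResolventAt A ω R) :
    Function.Injective (shift A ω) := by
  rw [injective_iff_map_eq_zero]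
  intro x hx
  have hxx := congrArg (fun z : Extrap A => z (adjointResolvent hA hR x)) hx
  simp only [shift_apply, incl_adjointResolvent, apply_adjointResolvent, sub_sub_cancel] at hxx
  exact inner_self_eq_zero.1 hxx

theorem shift_surjective (hA : Dense (A.domain : Set H)) (hR : IsResolventAt A ω R) :
    Function.Surjective (shift A ω) := by
  intro z
  let ℓ : StrongDual ℂ H :=
    (starL ℂ : ℂ ≃L⋆[ℂ] ℂ).toContinuousLinearMap.comp (z.comp (adjointResolvent hA hR))
  refine ⟨(InnerProductSpace.toDual ℂ H).symm ℓ, ?_⟩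
  ext v
  rw [shift_apply, ← inner_conj_symm, InnerProductSpace.toDual_symm_apply]
  have hℓ : ℓ ((starRingEnd ℂ) ω • GraphDom.incl A.adjoint v - GraphDom.apply A.adjoint v) =
      (starRingEnd ℂ) (z v) := by
    rw [← congrArg z (adjointResolvent_apply hA hR v)]
    rfl
  rw [hℓ, starRingEnd_self_apply]

/-- `ω - 𝒜` is an isomorphism of `H` onto `(dom A^*)'`. -/
def shiftEquiv (hA : Dense (A.domain : Set H)) (hR : IsResolventAt A ω R) : H ≃L[ℂ] Extrap A :=
  ContinuousLinearEquiv.ofBijective (shift A ω) (LinearMap.ker_eq_bot.2 (shift_injective hA hR))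
    (LinearMap.range_eq_top.2 (shift_surjective hA hR))

theorem shiftEquiv_apply (hA : Dense (A.domain : Set H)) (hR : IsResolventAt A ω R) (x : H) :
    shiftEquiv hA hR x = shift A ω x := rfl

theorem mem_extendGraph_shiftEquiv_iff (hA : Dense (A.domain : Set H)) (hR : IsResolventAt A ω R)
    (p q : H) :
    (shiftEquiv hA hR p, shiftEquiv hA hR q) ∈ extendGraph A ↔ (p, q) ∈ A.graph := by
  have hextend : ∀ x, extend A x = ω • embed A x - shiftEquiv hA hR x := fun x => by
    rw [shiftEquiv_apply, shift, sub_apply, smul_apply, sub_sub_cancel]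
  have hembed : ∀ x : A.domain, shiftEquiv hA hR x = embed A (ω • (x : H) - A x) := fun x => by
    rw [shiftEquiv_apply, shift_eq_embed hA x]
  rw [LinearPMap.mem_graph_iff]
  constructor
  · rintro ⟨x, hx⟩
    obtain ⟨hd, hy⟩ := hR.1 x
    obtain ⟨hxp, hxq⟩ := Prod.mk.inj hx
    have hRx : shiftEquiv hA hR (R x) = embed A x := by rw [← hy, ← hembed ⟨R x, hd⟩, hy]
    have hp : R x = p := (shiftEquiv hA hR).injective (by rw [hRx, hxp])
    have hq : ω • R x - x = q := (shiftEquiv hA hR).injective (by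
      rw [map_sub, map_smul, hRx, ← hextend, hxq])
    refine ⟨⟨R x, hd⟩, hp, ?_⟩
    rw [← hq]
    exact (sub_eq_of_eq_add' (sub_eq_iff_eq_add.1 hy)).symm
  · rintro ⟨x, rfl, rfl⟩
    refine ⟨ω • (x : H) - A x, Prod.ext (hembed x).symm ?_⟩
    simp only [hextend]
    rw [← hembed x, map_sub, map_smul, sub_sub_cancel]

end Extrapolation

section Conjugation

variable {X Y : Type*} [NormedAddCommGroup X] [NormedSpace ℂ X] [NormedAddCommGroup Y]
  [NormedSpace ℂ Y]

/-- The conjugate `t ↦ e ∘ S(t) ∘ e⁻¹` of a semigroup by an isomorphism. For `e = ω - 𝒜` this is the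
semigroup `e^{𝒜t}` on the extrapolation space. -/
def C0Semigroup.conj (S : C0Semigroup X) (e : X ≃L[ℂ] Y) : C0Semigroup Y where
  op t := (e : X →L[ℂ] Y).comp ((S.op t).comp (e.symm : Y →L[ℂ] X))
  op_zero := by
    ext1 y
    simp [S.op_zero]
  op_add s t hs ht := by
    ext1 y
    simp [S.op_add s t hs ht]
  tendsto_zero y := by
    have hlim := (e.continuous.tendsto _).comp (S.tendsto_zero (e.symm y))
    simpa [Function.comp_def] using hlim

theorem C0Semigroup.conj_op_apply (S : C0Semigroup X) (e : X ≃L[ℂ] Y) (t : ℝ) (x : X) :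
    (S.conj e).op t (e x) = e (S.op t x) := by
  simp [C0Semigroup.conj]

theorem C0Semigroup.HasGenerator.conj {S : C0Semigroup X} {G : Set (X × X)} {G' : Set (Y × Y)}
    (hS : S.HasGenerator G) (e : X ≃L[ℂ] Y) (hG : ∀ p q, (e p, e q) ∈ G' ↔ (p, q) ∈ G) :
    (S.conj e).HasGenerator G' := by
  intro y z
  obtain ⟨p, rfl⟩ := e.surjective y
  obtain ⟨q, rfl⟩ := e.surjective z
  have hslope : ∀ t : ℝ, ((t⁻¹ : ℝ) : ℂ) • ((S.conj e).op t (e p) - e p) =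
      e (((t⁻¹ : ℝ) : ℂ) • (S.op t p - p)) := fun t => by
    rw [C0Semigroup.conj_op_apply, map_smul, map_sub]
  simp_rw [hG, hS p q, hslope]
  exact e.toHomeomorph.isInducing.tendsto_nhds_iff

end Conjugation

/-! ## The boundary kernel -/

section Kernel

theorem exp_neg_le_rpow {x s : ℝ} (hx : 0 < x) (hs₀ : 0 ≤ s) (hs₁ : s ≤ 1) :
    Real.exp (-x) ≤ x ^ (-s) := by
  rw [Real.exp_neg, Real.rpow_neg hx.le]
  refine inv_anti₀ (Real.rpow_pos_of_pos hx s) ?_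
  rcases le_total x 1 with hx₁ | hx₁
  · exact (Real.rpow_le_one hx.le hx₁ hs₀).trans (Real.one_le_exp hx.le)
  · calc x ^ s ≤ x ^ (1 : ℝ) := Real.rpow_le_rpow_of_exponent_le hx₁ hs₁
      _ = x := Real.rpow_one x
      _ ≤ Real.exp x := by linarith [Real.add_one_le_exp x]

/-- The weight `(k+1)^{-1+2θ}` of the `k`-th coefficient of the boundary kernel; it is square
summable exactly when `θ < 1/4`. -/
def modeWeight (θ : ℝ) (k : ℕ) : ℝ := ((k : ℝ) + 1) ^ (-1 + 2 * θ)

theorem modeWeight_nonneg (θ : ℝ) (k : ℕ) : 0 ≤ modeWeight θ k :=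
  Real.rpow_nonneg (by positivity) _

theorem summable_mul_modeWeight_sq {θ : ℝ} (hθ : θ < 1 / 4) (C : ℝ) :
    Summable fun k => (C * modeWeight θ k) ^ 2 := by
  have hsum := (summable_nat_add_iff 1).2
    (Real.summable_nat_rpow (p := -2 + 4 * θ) |>.2 (by linarith))
  refine (hsum.mul_left (C ^ 2)).congr fun k => ?_
  rw [mul_pow, modeWeight, ← Real.rpow_natCast (_ ^ _), ← Real.rpow_mul (by positivity)]
  push_cast
  congr 2
  ring

theorem exp_neg_freqSq_mul_le {θ : ℝ} (hθ₀ : 0 ≤ θ) (hθ₁ : θ ≤ 1) (k : ℕ) {t : ℝ} (ht : 0 < t) :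
    Real.exp (-(freqSq k * t)) * ((k : ℝ) + 1) ≤ t ^ (-(1 - θ)) * modeWeight θ k := by
  have hk : (0 : ℝ) < (k : ℝ) + 1 := by positivity
  have hexp := exp_neg_le_rpow (mul_pos (freqSq_pos k) ht) (s := 1 - θ) (by linarith)
    (by linarith)
  refine (mul_le_mul_of_nonneg_right hexp hk.le).trans_eq ?_
  rw [Real.mul_rpow (freqSq_pos k).le ht.le, freqSq, ← Real.rpow_natCast, ← Real.rpow_mul hk.le,
    mul_comm _ (t ^ _), mul_assoc, modeWeight, ← Real.rpow_add_one hk.ne']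
  congr 2
  push_cast
  ring

variable {𝕜 : Type*} [RCLike 𝕜] {E : Type*} [NormedAddCommGroup E] [InnerProductSpace 𝕜 E]
  [NormedSpace ℝ E] [CompleteSpace E]

theorem norm_modeExp_sineAmp_le (a : E →L[𝕜] E) (b : E) {θ : ℝ} (hθ₀ : 0 ≤ θ) (hθ₁ : θ ≤ 1)
    (k : ℕ) {t T : ℝ} (ht : 0 < t) (htT : t ≤ T) :
    ‖modeExp a k t (sineAmp k • b)‖ ≤
      Real.exp (T * ‖a‖) * √(2 / Real.pi) * ‖b‖ * t ^ (-(1 - θ)) * modeWeight θ k := by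
  have hamp : ‖sineAmp k • b‖ = √(2 / Real.pi) * ((k : ℝ) + 1) * ‖b‖ := by
    rw [norm_smul, sineAmp, Real.norm_of_nonneg (by positivity)]
  calc ‖modeExp a k t (sineAmp k • b)‖
      ≤ Real.exp (-(freqSq k * t)) * Real.exp (t * ‖a‖) *
          (√(2 / Real.pi) * ((k : ℝ) + 1) * ‖b‖) :=
        hamp ▸ (modeExp a k t).le_of_opNorm_le (norm_modeExp_le a k ht.le) _
    _ = Real.exp (t * ‖a‖) * √(2 / Real.pi) * ‖b‖ *
          (Real.exp (-(freqSq k * t)) * ((k : ℝ) + 1)) := by ring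
    _ ≤ Real.exp (T * ‖a‖) * √(2 / Real.pi) * ‖b‖ * (t ^ (-(1 - θ)) * modeWeight θ k) := by
        gcongr ?_ * √(2 / Real.pi) * ‖b‖ * ?_
        · gcongr
        · exact exp_neg_freqSq_mul_le hθ₀ hθ₁ k ht
    _ = _ := by ring

variable [IsScalarTower ℝ 𝕜 E]

theorem exists_coef_eq_modeExp_sineAmp (a : E →L[𝕜] E) (b : E) {t : ℝ} (ht : 0 < t) :
    ∃ f : L2 E, ∀ k, coef 𝕜 k f = modeExp a k t (sineAmp k • b) :=
  exists_coef_eq 𝕜 <| Summable.of_nonneg_of_le (fun _ => by positivity)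
    (fun k => pow_le_pow_left₀ (norm_nonneg _)
      (norm_modeExp_sineAmp_le a b le_rfl zero_le_one k ht le_rfl) 2)
    (summable_mul_modeWeight_sq (by norm_num) _)

/-- The state at time `t > 0` produced by a unit impulse at the boundary; it is `0` for `t ≤ 0`. -/
def boundaryKernel (a : E →L[𝕜] E) (b : E) (t : ℝ) : L2 E :=
  if ht : 0 < t then (exists_coef_eq_modeExp_sineAmp a b ht).choose else 0

theorem coef_boundaryKernel (a : E →L[𝕜] E) (b : E) {t : ℝ} (ht : 0 < t) (k : ℕ) :
    coef 𝕜 k (boundaryKernel a b t) = modeExp a k t (sineAmp k • b) := by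
  rw [boundaryKernel, dif_pos ht]
  exact (exists_coef_eq_modeExp_sineAmp a b ht).choose_spec k

theorem exists_norm_boundaryKernel_le (a : E →L[𝕜] E) (b : E) {θ : ℝ} (hθ : θ ∈ Ioo (0 : ℝ) (1 / 4))
    (T : ℝ) : ∃ M : ℝ, ∀ t ∈ Ioo 0 T, ‖boundaryKernel a b t‖ ≤ M * t ^ (-(1 - θ)) := by
  set C := Real.exp (T * ‖a‖) * √(2 / Real.pi) * ‖b‖
  refine ⟨√(∑' k, (C * modeWeight θ k) ^ 2), fun t ht => ?_⟩
  have hpow : (0 : ℝ) ≤ t ^ (-(1 - θ)) := Real.rpow_nonneg ht.1.le _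
  have hcoef : ∀ k, ‖coef 𝕜 k (boundaryKernel a b t)‖ ≤ C * t ^ (-(1 - θ)) * modeWeight θ k :=
    fun k => by
      rw [coef_boundaryKernel a b ht.1]
      exact norm_modeExp_sineAmp_le a b hθ.1.le (by linarith [hθ.2]) k ht.1 ht.2.le
  refine le_of_sq_le_sq ?_ (by positivity)
  calc ‖boundaryKernel a b t‖ ^ 2
      ≤ ∑' k, (C * t ^ (-(1 - θ)) * modeWeight θ k) ^ 2 :=
        norm_sq_le_tsum_of_norm_coef_le 𝕜 (summable_mul_modeWeight_sq hθ.2 _) hcoef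
    _ = (∑' k, (C * modeWeight θ k) ^ 2) * (t ^ (-(1 - θ))) ^ 2 := by
        rw [← tsum_mul_right]
        exact tsum_congr fun k => by ring
    _ = (√(∑' k, (C * modeWeight θ k) ^ 2) * t ^ (-(1 - θ))) ^ 2 := by
        rw [mul_pow, Real.sq_sqrt (tsum_nonneg fun k => sq_nonneg _)]

theorem continuousOn_boundaryKernel (a : E →L[𝕜] E) (b : E) :
    ContinuousOn (boundaryKernel a b) (Ioi 0) := by
  intro t₀ (ht₀ : 0 < t₀)
  refine ContinuousAt.continuousWithinAt ?_
  set C := Real.exp (2 * t₀ * ‖a‖) * √(2 / Real.pi) * ‖b‖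
  have hnear : ∀ t ∈ Ioo (t₀ / 2) (2 * t₀), ∀ k,
      ‖modeExp a k t (sineAmp k • b)‖ ≤
        C * (t₀ / 2) ^ (-(1 - 0) : ℝ) * modeWeight 0 k := fun t ht k => by
    have htpos : 0 < t := by linarith [ht.1]
    refine (norm_modeExp_sineAmp_le a b le_rfl zero_le_one k htpos ht.2.le).trans ?_
    have hpow : t ^ (-(1 - 0) : ℝ) ≤ (t₀ / 2) ^ (-(1 - 0) : ℝ) :=
      Real.rpow_le_rpow_of_nonpos (by linarith) ht.1.le (by norm_num)
    have hweight := modeWeight_nonneg 0 k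
    gcongr
  have hev : ∀ᶠ t in 𝓝 t₀, t ∈ Ioo (t₀ / 2) (2 * t₀) := Ioo_mem_nhds (by linarith) (by linarith)
  refine tendsto_of_tendsto_coef 𝕜
    (b := fun k => 2 * (C * (t₀ / 2) ^ (-(1 - 0) : ℝ)) * modeWeight 0 k)
    (summable_mul_modeWeight_sq (by norm_num) _) ?_ fun k => ?_
  · filter_upwards [hev] with t ht k
    rw [coef_boundaryKernel a b (by linarith [ht.1]), coef_boundaryKernel a b ht₀]
    refine (norm_sub_le _ _).trans ?_
    linarith [hnear t ht k, hnear t₀ hev.self_of_nhds k]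
  · rw [coef_boundaryKernel a b ht₀]
    refine ((continuous_modeExp_apply a k _).tendsto t₀).congr' ?_
    filter_upwards [hev] with t ht
    rw [coef_boundaryKernel a b (by linarith [ht.1])]

theorem integrableOn_boundaryKernel (a : E →L[𝕜] E) (b : E) (T : ℝ) :
    IntegrableOn (boundaryKernel a b) (Ioo 0 T) := by
  obtain ⟨M, hM⟩ := exists_norm_boundaryKernel_le a b (θ := 1 / 8) (by norm_num) T
  have hpow : IntegrableOn (fun t : ℝ => M * t ^ (-(1 - 1 / 8) : ℝ)) (Ioo 0 T) :=
    (((intervalIntegral.intervalIntegrable_rpow' (by norm_num)).1).mono_set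
      Ioo_subset_Ioc_self).const_mul M
  refine Integrable.mono' hpow (((continuousOn_boundaryKernel a b).mono fun t ht =>
    ht.1).aestronglyMeasurable measurableSet_Ioo) ?_
  filter_upwards [ae_restrict_mem measurableSet_Ioo] with t ht using hM t ht

end Kernel

/-! ## Young's inequality `L¹ * L² ⊆ L²` -/

section Young

open scoped ENNReal

theorem sq_lintegral_mul_le {α : Type*} [MeasurableSpace α] {μ : Measure α} {υ κ : α → ℝ≥0∞}
    (hυ : AEMeasurable υ μ) (hκ : AEMeasurable κ μ) :
    (∫⁻ s, υ s * κ s ∂μ) ^ 2 ≤ (∫⁻ s, κ s ∂μ) * ∫⁻ s, υ s ^ 2 * κ s ∂μ := by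
  have hsq : ∀ x : ℝ≥0∞, (x ^ (1 / 2 : ℝ)) ^ 2 = x := fun x => by
    rw [← ENNReal.rpow_natCast, ← ENNReal.rpow_mul]
    norm_num
  have hsqrt : ∀ x : ℝ≥0∞, (x ^ 2) ^ (1 / 2 : ℝ) = x := fun x => by
    rw [← ENNReal.rpow_natCast, ← ENNReal.rpow_mul]
    norm_num
  have hsplit : ∀ s, κ s ^ (1 / 2 : ℝ) * (υ s ^ 2 * κ s) ^ (1 / 2 : ℝ) = υ s * κ s := fun s => by
    rw [ENNReal.mul_rpow_of_nonneg _ _ (by norm_num), hsqrt, mul_left_comm, ← sq, hsq]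
  have hcs := ENNReal.lintegral_mul_norm_pow_le hκ ((hυ.pow_const 2).mul hκ)
    (p := 1 / 2) (q := 1 / 2) (by norm_num) (by norm_num) (by norm_num)
  simp only [Pi.mul_apply, hsplit] at hcs
  calc (∫⁻ s, υ s * κ s ∂μ) ^ 2 ≤ _ := pow_le_pow_left₀ zero_le hcs 2
    _ = _ := by rw [mul_pow, hsq, hsq]

theorem lintegral_sq_lintegral_le {υ κ : ℝ → ℝ≥0∞} (hυ : AEMeasurable υ) (hκ : AEMeasurable κ) :
    ∫⁻ t, (∫⁻ s, υ s * κ (t - s)) ^ 2 ≤ (∫⁻ s, κ s) ^ 2 * ∫⁻ s, υ s ^ 2 := by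
  have hmeas : AEMeasurable (fun p : ℝ × ℝ => υ p.2 ^ 2 * κ (p.1 - p.2)) (volume.prod volume) :=
    (hυ.pow_const 2).comp_snd.mul (hκ.comp_quasiMeasurePreserving
      (quasiMeasurePreserving_sub_of_right_invariant volume volume))
  calc ∫⁻ t, (∫⁻ s, υ s * κ (t - s)) ^ 2
      ≤ ∫⁻ t, (∫⁻ s, κ s) * ∫⁻ s, υ s ^ 2 * κ (t - s) := by
        refine lintegral_mono fun t => ?_
        rw [← lintegral_sub_left_eq_self κ t]
        exact sq_lintegral_mul_le hυ (hκ.comp_quasiMeasurePreserving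
          (quasiMeasurePreserving_sub_left_of_right_invariant volume t))
    _ = (∫⁻ s, κ s) * ∫⁻ t, ∫⁻ s, υ s ^ 2 * κ (t - s) :=
        lintegral_const_mul'' _ hmeas.lintegral_prod_right'
    _ = (∫⁻ s, κ s) * ∫⁻ s, ∫⁻ t, υ s ^ 2 * κ (t - s) := by
        rw [lintegral_lintegral_swap hmeas]
    _ = (∫⁻ s, κ s) * ∫⁻ s, (∫⁻ s, κ s) * υ s ^ 2 := by
        congr 1
        refine lintegral_congr fun s => ?_
        have hs : AEMeasurable fun t => κ (t - s) := hκ.comp_quasiMeasurePreserving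
          (measurePreserving_sub_right volume s).quasiMeasurePreserving
        rw [lintegral_const_mul'' _ hs, lintegral_sub_right_eq_self κ s, mul_comm]
    _ = _ := by
        rw [lintegral_const_mul'' _ (hυ.pow_const 2), sq, mul_assoc]

theorem eLpNorm_two_sq {α F : Type*} [MeasurableSpace α] [NormedAddCommGroup F] {μ : Measure α}
    (f : α → F) : eLpNorm f 2 μ ^ 2 = ∫⁻ s, ‖f s‖ₑ ^ 2 ∂μ := by
  rw [eLpNorm_eq_lintegral_rpow_enorm_toReal (by norm_num) (by norm_num),
    ← ENNReal.rpow_natCast, ← ENNReal.rpow_mul]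
  simp

variable {𝕜 : Type*} [RCLike 𝕜] {X : Type*} [NormedAddCommGroup X] [NormedSpace 𝕜 X]
  {K : ℝ → X} {u : ℝ → 𝕜}

theorem aestronglyMeasurable_conv_integrand (hK : AEStronglyMeasurable K)
    (hu : AEStronglyMeasurable u) :
    AEStronglyMeasurable (fun p : ℝ × ℝ => u p.2 • K (p.1 - p.2)) (volume.prod volume) :=
  hu.comp_snd.smul (hK.comp_quasiMeasurePreserving
    (quasiMeasurePreserving_sub_of_right_invariant volume volume))

theorem lintegral_sq_lintegral_enorm_le (hK : AEStronglyMeasurable K)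
    (hu : AEStronglyMeasurable u) :
    ∫⁻ t, (∫⁻ s, ‖u s • K (t - s)‖ₑ) ^ 2 ≤ ((∫⁻ s, ‖K s‖ₑ) * eLpNorm u 2) ^ 2 := by
  simp_rw [enorm_smul]
  rw [mul_pow, eLpNorm_two_sq]
  exact lintegral_sq_lintegral_le hu.enorm hK.enorm

theorem ae_integrable_conv (hK : Integrable K) (hu : MemLp u 2) :
    ∀ᵐ t : ℝ, Integrable fun s => u s • K (t - s) := by
  have hfinite : ∫⁻ t, (∫⁻ s, ‖u s • K (t - s)‖ₑ) ^ 2 ≠ ∞ :=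
    ne_top_of_le_ne_top (ENNReal.pow_ne_top (ENNReal.mul_ne_top hK.2.ne hu.2.ne))
      (lintegral_sq_lintegral_enorm_le hK.1 hu.1)
  have hmeas : AEMeasurable fun t => (∫⁻ s, ‖u s • K (t - s)‖ₑ) ^ 2 :=
    (aestronglyMeasurable_conv_integrand hK.1 hu.1).enorm.lintegral_prod_right'.pow_const 2
  filter_upwards [ae_lt_top' hmeas hfinite] with t ht
  exact ⟨hu.1.smul (hK.1.comp_quasiMeasurePreserving
    (quasiMeasurePreserving_sub_left_of_right_invariant volume t)),
    (ENNReal.pow_lt_top_iff.1 ht).resolve_right two_ne_zero⟩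

theorem indicator_smul_indicator (K : ℝ → X) (u : ℝ → 𝕜) {t T : ℝ} (ht : t ∈ Ioo 0 T) (s : ℝ) :
    (Ioo 0 T).indicator u s • (Ioo 0 T).indicator K (t - s) =
      (Ioo 0 t).indicator (fun s => u s • K (t - s)) s := by
  by_cases hs : s ∈ Ioo 0 t
  · have hsT : s ∈ Ioo 0 T := ⟨hs.1, hs.2.trans ht.2⟩
    have htsT : t - s ∈ Ioo 0 T := ⟨sub_pos.2 hs.2, by linarith [hs.1, ht.2]⟩
    rw [indicator_of_mem hs, indicator_of_mem hsT, indicator_of_mem htsT]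
  · rw [indicator_of_notMem hs]
    by_cases hs₀ : 0 < s
    · have hts : t - s ∉ Ioo 0 T := fun h => hs ⟨hs₀, sub_pos.1 h.1⟩
      rw [indicator_of_notMem hts, smul_zero]
    · have hsT : s ∉ Ioo 0 T := fun h => hs₀ h.1
      rw [indicator_of_notMem hsT, zero_smul]

variable {T : ℝ}

theorem ae_intervalIntegrable_causalConv (hK : IntegrableOn K (Ioo 0 T))
    (hu : MemLp u 2 (volume.restrict (Ioo 0 T))) :
    ∀ᵐ t ∂(volume.restrict (Ioo 0 T)),
      IntervalIntegrable (fun s => u s • K (t - s)) volume 0 t := by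
  have hline : ∀ᵐ t : ℝ, Integrable fun s =>
      (Ioo 0 T).indicator u s • (Ioo 0 T).indicator K (t - s) :=
    ae_integrable_conv ((integrable_indicator_iff measurableSet_Ioo).2 hK)
      ((memLp_indicator_iff_restrict measurableSet_Ioo).2 hu)
  filter_upwards [ae_restrict_of_ae hline, ae_restrict_mem measurableSet_Ioo] with t hint ht
  simp_rw [indicator_smul_indicator K u ht] at hint
  rw [intervalIntegrable_iff_integrableOn_Ioo_of_le ht.1.le]
  exact (integrable_indicator_iff measurableSet_Ioo).1 hint

variable [NormedSpace ℝ X]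

theorem aestronglyMeasurable_conv (hK : AEStronglyMeasurable K) (hu : AEStronglyMeasurable u) :
    AEStronglyMeasurable fun t => ∫ s, u s • K (t - s) :=
  (aestronglyMeasurable_conv_integrand hK hu).integral_prod_right'

theorem eLpNorm_conv_le (hK : AEStronglyMeasurable K) (hu : AEStronglyMeasurable u) :
    eLpNorm (fun t => ∫ s, u s • K (t - s)) 2 ≤ (∫⁻ s, ‖K s‖ₑ) * eLpNorm u 2 := by
  refine (ENNReal.pow_le_pow_left_iff two_ne_zero).1 ?_
  rw [eLpNorm_two_sq]
  refine le_trans (lintegral_mono fun t => ?_) (lintegral_sq_lintegral_enorm_le hK hu)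
  exact pow_le_pow_left₀ zero_le (enorm_integral_le_lintegral_enorm _) 2

/-- The causal convolution `t ↦ ∫₀ᵗ u(s) K(t-s) ds`. -/
def causalConv (K : ℝ → X) (u : ℝ → 𝕜) (t : ℝ) : X := ∫ s in (0)..t, u s • K (t - s)

theorem integral_indicator_smul_indicator {t : ℝ} (ht : t ∈ Ioo 0 T) :
    ∫ s, (Ioo 0 T).indicator u s • (Ioo 0 T).indicator K (t - s) = causalConv K u t := by
  simp_rw [indicator_smul_indicator K u ht]
  rw [integral_indicator measurableSet_Ioo, integral_Ioo_eq_intervalIntegral ht.1.le, causalConv]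

theorem aestronglyMeasurable_causalConv (hK : IntegrableOn K (Ioo 0 T))
    (hu : MemLp u 2 (volume.restrict (Ioo 0 T))) :
    AEStronglyMeasurable (causalConv K u) (volume.restrict (Ioo 0 T)) := by
  refine (aestronglyMeasurable_conv ((integrable_indicator_iff measurableSet_Ioo).2 hK).1
    ((memLp_indicator_iff_restrict measurableSet_Ioo).2 hu).1).restrict.congr ?_
  filter_upwards [ae_restrict_mem measurableSet_Ioo] with t ht using
    integral_indicator_smul_indicator ht

theorem eLpNorm_causalConv_le (hK : IntegrableOn K (Ioo 0 T))
    (hu : MemLp u 2 (volume.restrict (Ioo 0 T))) :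
    eLpNorm (causalConv K u) 2 (volume.restrict (Ioo 0 T)) ≤
      (∫⁻ s in Ioo 0 T, ‖K s‖ₑ) * eLpNorm u 2 (volume.restrict (Ioo 0 T)) := by
  have hline := eLpNorm_conv_le ((integrable_indicator_iff measurableSet_Ioo).2 hK).1
    ((memLp_indicator_iff_restrict measurableSet_Ioo).2 hu).1
  simp_rw [eLpNorm_indicator_eq_eLpNorm_restrict measurableSet_Ioo,
    enorm_indicator_eq_indicator_enorm, lintegral_indicator measurableSet_Ioo] at hline
  refine le_trans (le_trans (eLpNorm_congr_ae ?_).le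
    (eLpNorm_mono_measure _ Measure.restrict_le_self)) hline
  filter_upwards [ae_restrict_mem measurableSet_Ioo] with t ht using
    (integral_indicator_smul_indicator ht).symm

theorem memLp_causalConv (hK : IntegrableOn K (Ioo 0 T))
    (hu : MemLp u 2 (volume.restrict (Ioo 0 T))) :
    MemLp (causalConv K u) 2 (volume.restrict (Ioo 0 T)) :=
  ⟨aestronglyMeasurable_causalConv hK hu, (eLpNorm_causalConv_le hK hu).trans_lt
    (ENNReal.mul_lt_top hK.2 hu.2)⟩

theorem causalConv_add {v : ℝ → 𝕜} {t : ℝ}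
    (hu : IntervalIntegrable (fun s => u s • K (t - s)) volume 0 t)
    (hv : IntervalIntegrable (fun s => v s • K (t - s)) volume 0 t) :
    causalConv K (u + v) t = causalConv K u t + causalConv K v t := by
  simp only [causalConv, Pi.add_apply, add_smul]
  exact intervalIntegral.integral_add hu hv

theorem causalConv_smul [SMulCommClass ℝ 𝕜 X] (c : 𝕜) (t : ℝ) :
    causalConv K (c • u) t = c • causalConv K u t := by
  simp only [causalConv, Pi.smul_apply, smul_assoc, intervalIntegral.integral_smul]

theorem causalConv_congr {v : ℝ → 𝕜} (huv : u =ᵐ[volume.restrict (Ioo 0 T)] v) {t : ℝ}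
    (ht : t ∈ Ioo 0 T) : causalConv K u t = causalConv K v t := by
  rw [causalConv, causalConv, ← integral_Ioo_eq_intervalIntegral ht.1.le,
    ← integral_Ioo_eq_intervalIntegral ht.1.le]
  refine integral_congr_ae ?_
  filter_upwards [ae_restrict_of_ae_restrict_of_subset (Ioo_subset_Ioo_right ht.2.le) huv]
    with s hs
  rw [hs]

/-- Causal convolution with an integrable kernel, as a linear operator on `L²(0, T)`. -/
def causalConvₗ [SMulCommClass ℝ 𝕜 X] (hK : IntegrableOn K (Ioo 0 T)) :
    Lp 𝕜 2 (volume.restrict (Ioo 0 T)) →ₗ[𝕜] Lp X 2 (volume.restrict (Ioo 0 T)) where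
  toFun u := (memLp_causalConv hK (Lp.memLp u)).toLp (causalConv K u)
  map_add' u v := by
    rw [← MemLp.toLp_add, MemLp.toLp_eq_toLp_iff]
    filter_upwards [ae_intervalIntegrable_causalConv hK (Lp.memLp u),
      ae_intervalIntegrable_causalConv hK (Lp.memLp v), ae_restrict_mem measurableSet_Ioo]
      with t hut hvt ht
    rw [causalConv_congr (Lp.coeFn_add u v) ht, causalConv_add hut hvt, Pi.add_apply]
  map_smul' c u := by
    rw [RingHom.id_apply, ← MemLp.toLp_const_smul, MemLp.toLp_eq_toLp_iff]
    filter_upwards [ae_restrict_mem measurableSet_Ioo] with t ht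
    rw [causalConv_congr (Lp.coeFn_smul c u) ht, causalConv_smul, Pi.smul_apply]

theorem exists_causalConv_clm [SMulCommClass ℝ 𝕜 X] (hK : IntegrableOn K (Ioo 0 T)) :
    ∃ L : Lp 𝕜 2 (volume.restrict (Ioo 0 T)) →L[𝕜] Lp X 2 (volume.restrict (Ioo 0 T)),
      ∀ u, L u =ᵐ[volume.restrict (Ioo 0 T)] causalConv K u := by
  refine ⟨(causalConvₗ hK).mkContinuous (∫⁻ s in Ioo 0 T, ‖K s‖ₑ).toReal fun u => ?_,
    fun u => (memLp_causalConv hK (Lp.memLp u)).coeFn_toLp⟩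
  change ‖(memLp_causalConv hK (Lp.memLp u)).toLp _‖ ≤ _
  rw [Lp.norm_toLp, Lp.norm_def, ← ENNReal.toReal_mul]
  exact ENNReal.toReal_mono (ENNReal.mul_ne_top hK.2.ne (Lp.memLp u).2.ne)
    (eLpNorm_causalConv_le hK (Lp.memLp u))

end Young

/-! ## The control operator and mild solutions -/

section Control

variable {A₀ : Matrix (Fin 2) (Fin 2) ℝ} {B₀ : EuclideanSpace ℝ (Fin 2)} {ω ω' : ℂ}
  {D D' : ℂ →L[ℂ] StateC}

/-- The response in `H = L²(0,π;ℂ)²` to a unit impulse of the control. -/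
abbrev kernelC (A₀ : Matrix (Fin 2) (Fin 2) ℝ) (B₀ : EuclideanSpace ℝ (Fin 2)) : ℝ → StateC :=
  boundaryKernel (opC A₀) (vecC B₀)

theorem IsDirichletMap.shift_comp_eq (hD : IsDirichletMap A₀ B₀ ω D)
    (hD' : IsDirichletMap A₀ B₀ ω' D') :
    (shift (parabolicOp A₀) ω).comp D = (shift (parabolicOp A₀) ω').comp D' := by
  ext1
  obtain ⟨hdom, hA⟩ := exists_mem_domain (A₀ := A₀) (x := D 1 - D' 1) (y := ω • D 1 - ω' • D' 1)
    fun k => by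
      simp only [map_sub, map_smul]
      exact sub_eq_sub_iff_sub_eq_sub.1 ((hD 1 k).trans (hD' 1 k).symm)
  have hextend := extend_eq_embed dense_domain_parabolicOp ⟨_, hdom⟩
  simp only [hA, map_sub, map_smul] at hextend
  simp only [ContinuousLinearMap.comp_apply, shift, sub_apply, smul_apply]
  exact sub_eq_sub_iff_sub_eq_sub.2 hextend.symm

theorem IsDirichletMap.exists_heatSemigroup_mem_domain (hD : IsDirichletMap A₀ B₀ ω D) {t : ℝ}
    (ht : 0 < t) (a : ℂ) :
    ∃ hx : (heatSemigroup A₀).op t (D a) ∈ (parabolicOp A₀).domain,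
      parabolicOp A₀ ⟨_, hx⟩ = ω • (heatSemigroup A₀).op t (D a) - a • kernelC A₀ B₀ t := by
  refine exists_mem_domain fun k => ?_
  have hcoef : coef ℂ k ((heatSemigroup A₀).op t (D a)) =
      modeExp (opC A₀) k t (coef ℂ k (D a)) := coef_heatOp _ ht.le k _
  have heq := congrArg (modeExp (opC A₀) k t) (hD a k)
  simp only [map_sub, map_smul] at heq
  rw [map_sub, map_smul, map_smul, coef_boundaryKernel _ _ ht, hcoef,
    modeOp_modeExp_comm, ← heq, sub_sub_cancel]

theorem IsDirichletMap.exists_norm_le (hD : IsDirichletMap A₀ B₀ ω D) {θ : ℝ}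
    (hθ : θ ∈ Ioo (0 : ℝ) (1 / 4)) (T : ℝ) :
    ∃ M : ℝ, ∀ t ∈ Ioo 0 T, ∀ a : ℂ,
      ∃ hx : (heatSemigroup A₀).op t (D a) ∈ (parabolicOp A₀).domain,
        ‖parabolicOp A₀ ⟨_, hx⟩‖ ≤ M * ‖a‖ / t ^ (1 - θ) := by
  obtain ⟨M, hkernel⟩ := exists_norm_boundaryKernel_le (opC A₀) (vecC B₀) hθ T
  set C := ‖ω‖ * (Real.exp (T * ‖opC A₀‖) * ‖D‖) with hC
  refine ⟨C * T ^ (1 - θ) + M, fun t ht a => ?_⟩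
  obtain ⟨hx, hA⟩ := hD.exists_heatSemigroup_mem_domain ht.1 a
  refine ⟨hx, ?_⟩
  have hpow : 0 < t ^ (1 - θ) := Real.rpow_pos_of_pos ht.1 _
  have hpow_le : t ^ (1 - θ) ≤ T ^ (1 - θ) :=
    Real.rpow_le_rpow ht.1.le ht.2.le (by linarith [hθ.2])
  have hflow : ‖ω • (heatSemigroup A₀).op t (D a)‖ ≤ C * ‖a‖ := by
    rw [norm_smul, hC, mul_assoc, mul_assoc]
    gcongr
    refine (norm_heatOp_apply_le (opC A₀) (N := 0) (by simp) ht.1.le).trans ?_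
    gcongr
    · rw [Nat.cast_zero, zero_sub, neg_mul, neg_neg, mul_comm]
      gcongr
      exact ht.2.le
    · exact D.le_opNorm a
  have himpulse : ‖a • kernelC A₀ B₀ t‖ * t ^ (1 - θ) ≤ M * ‖a‖ := by
    have hkt := hkernel t ht
    rw [Real.rpow_neg ht.1.le, ← div_eq_mul_inv, le_div_iff₀ hpow] at hkt
    rw [norm_smul, mul_assoc, mul_comm M]
    gcongr
  rw [hA, le_div_iff₀ hpow]
  calc ‖ω • (heatSemigroup A₀).op t (D a) - a • kernelC A₀ B₀ t‖ * t ^ (1 - θ)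
      ≤ (‖ω • (heatSemigroup A₀).op t (D a)‖ + ‖a • kernelC A₀ B₀ t‖) * t ^ (1 - θ) := by
        gcongr
        exact norm_sub_le _ _
    _ ≤ C * ‖a‖ * T ^ (1 - θ) + M * ‖a‖ := by
        rw [add_mul]
        gcongr
    _ = _ := by ring

variable {R : StateC →L[ℂ] StateC}

/-- The semigroup `e^{𝒜t}` of the parabolic system, transported from `H` by `ω - 𝒜`. -/
def extrapSemigroup (hR : IsResolventAt (parabolicOp A₀) ω R) :
    C0Semigroup (Extrap (parabolicOp A₀)) :=
  (heatSemigroup A₀).conj (shiftEquiv dense_domain_parabolicOp hR)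

theorem IsDirichletMap.extrapSemigroup_apply (hD : IsDirichletMap A₀ B₀ ω D)
    (hR : IsResolventAt (parabolicOp A₀) ω R) {t : ℝ} (ht : 0 < t) (a : ℂ) :
    (extrapSemigroup hR).op t ((shift (parabolicOp A₀) ω).comp D a) =
      embed (parabolicOp A₀) (a • kernelC A₀ B₀ t) := by
  obtain ⟨hx, hA⟩ := hD.exists_heatSemigroup_mem_domain ht a
  refine ((heatSemigroup A₀).conj_op_apply (shiftEquiv dense_domain_parabolicOp hR) t
    (D a)).trans ?_
  rw [shiftEquiv_apply, shift_eq_embed dense_domain_parabolicOp ⟨_, hx⟩, hA, sub_sub_cancel]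

theorem IsDirichletMap.integral_extrapSemigroup (hD : IsDirichletMap A₀ B₀ ω D)
    (hR : IsResolventAt (parabolicOp A₀) ω R) {t : ℝ} (ht : 0 < t) {u : ℝ → ℂ}
    (hu : IntervalIntegrable (fun s => u s • kernelC A₀ B₀ (t - s)) volume 0 t) :
    IntervalIntegrable (fun s => (extrapSemigroup hR).op (t - s)
        ((shift (parabolicOp A₀) ω).comp D (u s))) volume 0 t ∧
      embed (parabolicOp A₀) (causalConv (kernelC A₀ B₀) u t) =
        ∫ s in (0)..t, (extrapSemigroup hR).op (t - s)
          ((shift (parabolicOp A₀) ω).comp D (u s)) := by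
  have hembed : ∀ s ∈ Ioo 0 t, embed (parabolicOp A₀) (u s • kernelC A₀ B₀ (t - s)) =
      (extrapSemigroup hR).op (t - s) ((shift (parabolicOp A₀) ω).comp D (u s)) := fun s hs =>
    (hD.extrapSemigroup_apply hR (sub_pos.2 hs.2) (u s)).symm
  constructor
  · rw [intervalIntegrable_iff_integrableOn_Ioo_of_le ht.le] at hu ⊢
    exact ((embed (parabolicOp A₀)).integrable_comp hu).congr
      ((ae_restrict_mem measurableSet_Ioo).mono fun s hs => hembed s hs)
  · rw [causalConv, ← ContinuousLinearMap.intervalIntegral_comp_comm _ hu,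
      ← integral_Ioo_eq_intervalIntegral ht.le, ← integral_Ioo_eq_intervalIntegral ht.le]
    exact setIntegral_congr_fun measurableSet_Ioo hembed

theorem IsDirichletMap.regularityHypothesis (hD : IsDirichletMap A₀ B₀ ω D)
    (hR : IsResolventAt (parabolicOp A₀) ω R) :
    RegularityHypothesis (parabolicOp A₀) (extrapSemigroup hR)
      ((shift (parabolicOp A₀) ω).comp D) := by
  intro T _
  have hK := integrableOn_boundaryKernel (opC A₀) (vecC B₀) T
  obtain ⟨L, hL⟩ := exists_causalConv_clm (𝕜 := ℂ) hK
  refine ⟨L, fun u => ?_⟩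
  filter_upwards [hL u, ae_intervalIntegrable_causalConv hK (Lp.memLp u),
    ae_restrict_mem measurableSet_Ioo] with t hLt hint ht
  rw [hLt]
  exact hD.integral_extrapSemigroup hR ht.1 hint

end Control

/-! ## The real system -/

section RealSystem

variable {A₀ : Matrix (Fin 2) (Fin 2) ℝ} {B₀ : EuclideanSpace ℝ (Fin 2)}

/-- The response in `L²(0,π)²` to a unit impulse of the control. -/
abbrev kernelR (A₀ : Matrix (Fin 2) (Fin 2) ℝ) (B₀ : EuclideanSpace ℝ (Fin 2)) : ℝ → StateR :=
  boundaryKernel (matOp A₀) B₀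

/-- The variation-of-constants formula for the boundary control system, with the control entering
through the impulse response. -/
def controlState (A₀ : Matrix (Fin 2) (Fin 2) ℝ) (B₀ : EuclideanSpace ℝ (Fin 2)) (y₀ : StateR)
    (u : ℝ → ℝ) (t : ℝ) : StateR :=
  heatOp (matOp A₀) t y₀ + causalConv (kernelR A₀ B₀) u t

theorem vecC_matOp (A₀ : Matrix (Fin 2) (Fin 2) ℝ) (c : EuclideanSpace ℝ (Fin 2)) :
    vecC (matOp A₀ c) = opC A₀ (vecC c) := by
  ext i
  fin_cases i <;> simp [vecC, matOp, opC, matC, Matrix.mulVec, dotProduct]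

theorem vecC_modeExp (A₀ : Matrix (Fin 2) (Fin 2) ℝ) (k : ℕ) (t : ℝ)
    (c : EuclideanSpace ℝ (Fin 2)) :
    vecC (modeExp (matOp A₀) k t c) = modeExp (opC A₀) k t (vecC c) := by
  rw [modeExp_apply, modeExp_apply, map_smul, map_expOp_of_intertwine (vecC_matOp A₀)]

theorem stateC_heatOp (A₀ : Matrix (Fin 2) (Fin 2) ℝ) {t : ℝ} (ht : 0 ≤ t) (f : StateR) :
    stateC (heatOp (matOp A₀) t f) = heatOp (opC A₀) t (stateC f) := by
  refine L2_ext_coef ℂ fun k => ?_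
  rw [coef_stateC, coef_heatOp _ ht, coef_heatOp _ ht, vecC_modeExp, coef_stateC]

theorem stateC_kernelR (A₀ : Matrix (Fin 2) (Fin 2) ℝ) (B₀ : EuclideanSpace ℝ (Fin 2)) {t : ℝ}
    (ht : 0 < t) : stateC (kernelR A₀ B₀ t) = kernelC A₀ B₀ t := by
  refine L2_ext_coef ℂ fun k => ?_
  rw [coef_stateC, coef_boundaryKernel _ _ ht, coef_boundaryKernel _ _ ht, vecC_modeExp, map_smul]

theorem stateC_causalConv {t : ℝ} (ht : 0 < t) {u : ℝ → ℝ}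
    (hu : IntervalIntegrable (fun s => u s • kernelR A₀ B₀ (t - s)) volume 0 t) :
    stateC (causalConv (kernelR A₀ B₀) u t) =
      causalConv (kernelC A₀ B₀) (fun s => (u s : ℂ)) t := by
  rw [causalConv, ← ContinuousLinearMap.intervalIntegral_comp_comm _ hu, causalConv,
    ← integral_Ioo_eq_intervalIntegral ht.le, ← integral_Ioo_eq_intervalIntegral ht.le]
  refine setIntegral_congr_fun measurableSet_Ioo fun s hs => ?_
  change stateC (u s • kernelR A₀ B₀ (t - s)) = (u s : ℂ) • kernelC A₀ B₀ (t - s)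
  rw [map_smul, stateC_kernelR _ _ (sub_pos.2 hs.2)]
  rfl

variable {T : ℝ} {u : ℝ → ℝ} {ω : ℂ} {D : ℂ →L[ℂ] StateC} {R : StateC →L[ℂ] StateC}

theorem memLp_controlState (y₀ : StateR) (hu : MemLp u 2 (volume.restrict (Ioo 0 T))) :
    MemLp (controlState A₀ B₀ y₀ u) 2 (volume.restrict (Ioo 0 T)) :=
  (memLp_of_continuousOn_Icc
    ((continuousOn_heatOp_apply (matOp A₀) y₀).mono Icc_subset_Ici_self)).add
    (memLp_causalConv (integrableOn_boundaryKernel (matOp A₀) B₀ T) hu)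

theorem IsDirichletMap.isMildSolution (hD : IsDirichletMap A₀ B₀ ω D)
    (hR : IsResolventAt (parabolicOp A₀) ω R) (y₀ : StateR)
    (hu : MemLp u 2 (volume.restrict (Ioo 0 T))) :
    IsMildSolution (parabolicOp A₀) (heatSemigroup A₀) (extrapSemigroup hR)
      ((shift (parabolicOp A₀) ω).comp D) T (stateC y₀) (fun t => (u t : ℂ))
      (fun t => stateC (controlState A₀ B₀ y₀ u t)) := by
  refine ⟨stateC.comp_memLp' (memLp_controlState y₀ hu), ?_⟩
  have huC : MemLp (fun t => (u t : ℂ)) 2 (volume.restrict (Ioo 0 T)) := hu.ofReal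
  filter_upwards [ae_intervalIntegrable_causalConv
      (integrableOn_boundaryKernel (opC A₀) (vecC B₀) T) huC,
    ae_intervalIntegrable_causalConv (integrableOn_boundaryKernel (matOp A₀) B₀ T) hu,
    ae_restrict_mem measurableSet_Ioo] with t hintC hintR ht
  obtain ⟨hint, hconv⟩ := hD.integral_extrapSemigroup hR ht.1 hintC
  refine ⟨hint, ?_⟩
  rw [controlState, map_add, map_add, stateC_heatOp _ ht.1.le, stateC_causalConv ht.1 hintR, hconv]
  rfl

end RealSystem

/-! ## Duality on a single mode -/

section ModeDuality

variable {E : Type*} [NormedAddCommGroup E]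

theorem hasDerivAt_modeExp [NormedSpace ℝ E] [CompleteSpace E] (a : E →L[ℝ] E) (k : ℕ) (t : ℝ) :
    HasDerivAt (modeExp a k) (modeOp a k * modeExp a k t) t := by
  have hexp : HasDerivAt (expOp a) (a * expOp a t) t := hasDerivAt_exp_smul_const' a t
  have hdecay : HasDerivAt (fun t => Real.exp (-(freqSq k * t)))
      (Real.exp (-(freqSq k * t)) * -(freqSq k * 1)) t :=
    (((hasDerivAt_id t).const_mul (freqSq k)).neg).exp
  refine (hdecay.smul hexp).congr_deriv ?_
  simp only [modeOp, modeExp, RCLike.ofReal_real_eq_id, id, sub_mul, mul_smul_comm, smul_mul_assoc,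
    one_mul, mul_one]
  rw [smul_sub, smul_smul, mul_neg, neg_smul, ← sub_eq_add_neg]

theorem continuous_modeExp [NormedSpace ℝ E] [CompleteSpace E] (a : E →L[ℝ] E) (k : ℕ) :
    Continuous (modeExp a k) :=
  continuous_iff_continuousAt.2 fun t => (hasDerivAt_modeExp a k t).continuousAt

theorem IsPrimitiveOn.modeExp_apply [NormedSpace ℝ E] [CompleteSpace E] {φ φ' : ℝ → E} {T : ℝ}
    (hφ : IsPrimitiveOn φ φ' 0 T) (a : E →L[ℝ] E) (k : ℕ) :
    IsPrimitiveOn (fun t => modeExp a k t (φ t))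
      (fun t => modeExp a k t (modeOp a k (φ t) + φ' t)) 0 T := by
  have hexp : IsPrimitiveOn (modeExp a k) (fun t => modeOp a k * modeExp a k t) 0 T :=
    .of_hasDerivAt (hasDerivAt_modeExp a k) ((continuous_modeExp a k).const_mul _)
  refine (hexp.bilin hφ (ContinuousLinearMap.id ℝ (E →L[ℝ] E))).congr_ae (ae_of_all _ fun t => ?_)
  simp only [ContinuousLinearMap.id_apply, map_add, mul_apply_eq_comp, modeOp_modeExp_comm]

variable [InnerProductSpace ℝ E] [CompleteSpace E]

theorem IsPrimitiveOn.inner {f f' g g' : ℝ → E} {α β : ℝ} (hf : IsPrimitiveOn f f' α β)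
    (hg : IsPrimitiveOn g g' α β) :
    IsPrimitiveOn (fun t => inner ℝ (f t) (g t))
      (fun t => inner ℝ (f' t) (g t) + inner ℝ (f t) (g' t)) α β :=
  hf.bilin hg (innerSL ℝ)

theorem modeExp_adjoint (a : E →L[ℝ] E) (k : ℕ) (t : ℝ) :
    (modeExp a k t).adjoint = modeExp a.adjoint k t := by
  have hexp : star (expOp a t) = expOp (star a) t := by
    rw [expOp, expOp, NormedSpace.star_exp, star_smul, RCLike.star_def, RCLike.conj_ofReal]
  rw [← ContinuousLinearMap.star_eq_adjoint, ← ContinuousLinearMap.star_eq_adjoint, modeExp,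
    star_smul, hexp, RCLike.star_def, RCLike.conj_ofReal, modeExp]

theorem inner_modeExp_left (a : E →L[ℝ] E) (k : ℕ) (t : ℝ) (x y : E) :
    inner ℝ (modeExp a k t x) y = inner ℝ x (modeExp a.adjoint k t y) := by
  rw [← modeExp_adjoint, ContinuousLinearMap.adjoint_inner_right]

theorem integral_inner_modeExp_of_backward_eqn (a : E →L[ℝ] E) (k : ℕ) {T : ℝ} (x₀ b : E)
    {u : ℝ → ℝ} (hu : IntervalIntegrable u volume 0 T) {φ φ' γ : ℝ → E}
    (hφ : IsPrimitiveOn φ φ' 0 T) (hφT : φ T = 0)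
    (hγ : ∀ᵐ t ∂(volume.restrict (uIoc 0 T)), modeOp a.adjoint k (φ t) + φ' t = -γ t) :
    ∫ t in (0)..T, inner ℝ (modeExp a k t (x₀ + ∫ s in (0)..t, u s • modeExp a k (-s) b)) (γ t) =
      inner ℝ x₀ (φ 0) + ∫ t in (0)..T, u t * inner ℝ b (φ t) := by
  have hforce : IntervalIntegrable (fun s => u s • modeExp a k (-s) b) volume 0 T :=
    hu.smul_continuousOn ((continuous_modeExp_apply a k b).comp continuous_neg).continuousOn
  -- `⟨e^{-tm} y, e^{tm*} φ⟩` has a derivative from which the homogeneous dynamics has cancelled.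
  have hr := isPrimitiveOn_const_add_integral hforce x₀
  have hq : IsPrimitiveOn (fun t => modeExp a.adjoint k t (φ t))
      (fun t => -modeExp a.adjoint k t (γ t)) 0 T :=
    (hφ.modeExp_apply a.adjoint k).congr_ae (hγ.mono fun t ht => by simp only [ht, map_neg])
  have hcontrol : ∀ t, inner ℝ (u t • modeExp a k (-t) b) (modeExp a.adjoint k t (φ t)) =
      u t * inner ℝ b (φ t) := fun t => by
    rw [real_inner_smul_left, inner_modeExp_left, ← modeExp_add_apply, neg_add_cancel,
      modeExp_zero, one_apply_eq_self]
  have hsource : ∀ t x, inner ℝ x (-modeExp a.adjoint k t (γ t)) =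
      -inner ℝ (modeExp a k t x) (γ t) := fun t x => by
    rw [inner_neg_right, inner_modeExp_left]
  have hcontrol_int : IntervalIntegrable (fun t => u t * inner ℝ b (φ t)) volume 0 T :=
    hu.mul_continuousOn (continuousOn_const.inner hφ.continuousOn)
  have hpair := hr.inner hq
  simp only [hcontrol, hsource] at hpair
  have hsource_int := (hpair.intervalIntegrable.sub hcontrol_int).congr_ae
    (ae_of_all _ fun t => add_sub_cancel_left _ _)
  have hparts := hpair.integral_eq_sub
  rw [intervalIntegral.integral_add hcontrol_int hsource_int, intervalIntegral.integral_neg, hφT]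
    at hparts
  simp only [map_zero, inner_zero_right, intervalIntegral.integral_same, add_zero, modeExp_zero,
    one_apply_eq_self] at hparts
  linarith

end ModeDuality

/-! ## Existence of the solution by transposition -/

section Parseval

variable {E : Type*} [NormedAddCommGroup E] [InnerProductSpace ℝ E]

theorem integrable_inner_of_memLp {α : Type*} [MeasurableSpace α] {μ : Measure α} {X Y : α → E}
    (hY : MemLp Y 2 μ) (hX : MemLp X 2 μ) : Integrable (fun t => inner ℝ (Y t) (X t)) μ :=
  (hY.norm.integrable_mul hX.norm).mono' (hY.1.inner hX.1)
    (Eventually.of_forall fun t => norm_inner_le_norm (Y t) (X t))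

variable [CompleteSpace E]

theorem memLp_coef {α : Type*} [MeasurableSpace α] {μ : Measure α} {X : α → L2 E}
    (hX : MemLp X 2 μ) (k : ℕ) : MemLp (fun t => coef ℝ k (X t)) 2 μ :=
  ContinuousLinearMap.comp_memLp' (coef ℝ k : L2 E →L[ℝ] E) hX

theorem inner_cutoff (N : ℕ) (f g : L2 E) :
    inner ℝ f (cutoff ℝ N g) = ∑ k ∈ Finset.range N, inner ℝ (coef ℝ k f) (coef ℝ k g) := by
  rw [cutoff_apply, inner_sum]
  exact Finset.sum_congr rfl fun k _ => inner_sineEmb_right ℝ k _ _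

theorem tendsto_sum_integral_inner_coef {α : Type*} [MeasurableSpace α] {μ : Measure α}
    {X Y : α → L2 E} (hY : MemLp Y 2 μ) (hX : MemLp X 2 μ) :
    Tendsto (fun N => ∑ k ∈ Finset.range N, ∫ t, inner ℝ (coef ℝ k (Y t)) (coef ℝ k (X t)) ∂μ)
      atTop (𝓝 (∫ t, inner ℝ (Y t) (X t) ∂μ)) := by
  have hcutoff : ∀ N, MemLp (fun t => cutoff ℝ N (X t)) 2 μ := fun N =>
    ContinuousLinearMap.comp_memLp' (cutoff ℝ N : L2 E →L[ℝ] L2 E) hX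
  have hlim : Tendsto (fun N => ∫ t, inner ℝ (Y t) (cutoff ℝ N (X t)) ∂μ) atTop
      (𝓝 (∫ t, inner ℝ (Y t) (X t) ∂μ)) :=
    tendsto_integral_of_dominated_convergence (fun t => ‖Y t‖ * ‖X t‖)
      (fun N => hY.1.inner (hcutoff N).1) (hY.norm.integrable_mul hX.norm)
      (fun N => Eventually.of_forall fun t => (norm_inner_le_norm _ _).trans
        (mul_le_mul_of_nonneg_left (norm_cutoff_apply_le ℝ N _) (norm_nonneg _)))
      (Eventually.of_forall fun t => tendsto_const_nhds.inner (tendsto_cutoff ℝ (X t)))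
  refine hlim.congr fun N => ?_
  simp_rw [inner_cutoff]
  exact integral_finsetSum _ fun k _ =>
    integrable_inner_of_memLp (memLp_coef hY k) (memLp_coef hX k)

end Parseval

section AffineLift

variable {E : Type*} [NormedAddCommGroup E] [InnerProductSpace ℝ E]

/-- The affine profile `(1 - x/π) c`, with boundary values `c` and `0`. Pairing it with `φ_xx`
produces the boundary term `φ_x(0)` of the transposition identity. -/
def affineLift (c : E) : L2 E := smulConst ℝ (fun x => 1 - x / Real.pi) (by fun_prop) c

variable [CompleteSpace E]

theorem freqSq_smul_coef_affineLift (c : E) (k : ℕ) :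
    freqSq k • coef ℝ k (affineLift c) = sineAmp k • c := by
  have hprofile : IsPrimitiveOn (fun x : ℝ => (1 - x / Real.pi) • c)
      (fun _ => -(1 / Real.pi) • c) 0 Real.pi :=
    .of_hasDerivAt
      (fun x => (((hasDerivAt_id x).div_const Real.pi).const_sub 1).smul_const c)
      continuous_const
  have hslope : IsPrimitiveOn (fun _ : ℝ => -(1 / Real.pi) • c) (fun _ => 0) 0 Real.pi :=
    .of_hasDerivAt (fun x => hasDerivAt_const x _) continuous_const
  have hcoef := hprofile.coef_add_freqSq_smul_coef (𝕜 := ℝ) hslope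
    (by rw [div_self Real.pi_ne_zero, sub_self, zero_smul]) (f := affineLift c) (g := 0)
    (coeFn_smulConst ℝ _ c) (Lp.coeFn_zero _ _ _) k
  rwa [map_zero, zero_add, zero_div, sub_zero, one_smul] at hcoef

theorem inner_coef_smul_affineLift (r : ℝ) (b c : E) (k : ℕ) :
    inner ℝ (coef ℝ k (r • affineLift b)) (-(freqSq k • c)) =
      -(r * inner ℝ (sineAmp k • b) c) := by
  rw [map_smul, real_inner_smul_left, inner_neg_right, real_inner_smul_right,
    ← real_inner_smul_left, freqSq_smul_coef_affineLift, mul_neg]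

theorem IsH2H10.inner_affineLift {f f' f'' : L2 E} (h : IsH2H10 f f' f'') {p : E}
    (hp : HasTrace f' 0 p) (c : E) : inner ℝ (affineLift c) f'' = -inner ℝ c p := by
  rw [affineLift, inner_smulConst_left, h.trace_deriv_eq hp, inner_neg_right, neg_neg]

end AffineLift

section Transposition

theorem matOp_transpose (A₀ : Matrix (Fin 2) (Fin 2) ℝ) :
    matOp A₀.transpose = (matOp A₀).adjoint := by
  rw [← ContinuousLinearMap.star_eq_adjoint, matOp, matOp, ← map_star, Matrix.star_eq_conjTranspose,
    Matrix.conjTranspose_eq_transpose_of_trivial]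

variable {A₀ : Matrix (Fin 2) (Fin 2) ℝ} {T : ℝ} {g φ φx φxx φt : ℝ → StateR}

theorem IsStrongAdjointSolution.isH2H10 (h : IsStrongAdjointSolution A₀ T g φ φx)
    (hφxx : ∀ᵐ t ∂(volume.restrict (Ioo 0 T)), IsWeakDeriv (φx t) (φxx t)) :
    ∀ᵐ t ∂(volume.restrict (Ioo 0 T)), IsH2H10 (φ t) (φx t) (φxx t) := by
  filter_upwards [hφxx, ae_restrict_mem measurableSet_Ioo] with t hxx ht
  have ht' := Ioo_subset_Icc_self ht
  exact ⟨h.deriv_x t ht', hxx, h.trace_zero t ht', h.trace_pi t ht'⟩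

theorem IsH2H10.modeOp_coef_add_coef {f f' f'' ft G : StateR} (h : IsH2H10 f f' f'')
    (heq : -ft - f'' = matMul A₀.transpose f + G) (k : ℕ) :
    modeOp (matOp A₀).adjoint k (coef ℝ k f) + coef ℝ k ft = -coef ℝ k G := by
  have hcoef := congrArg (coef ℝ k) heq
  rw [map_sub, map_neg, map_add, h.coef_deriv₂, coef_matMul, matOp_transpose] at hcoef
  rw [modeOp_apply, ← sub_eq_iff_eq_add'.2 hcoef]
  abel

variable {B₀ : EuclideanSpace ℝ (Fin 2)} {u : ℝ → ℝ} {y₀ : StateR}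

variable (A₀ B₀ y₀) in
theorem ae_coef_controlState (hu : MemLp u 2 (volume.restrict (Ioo 0 T))) (k : ℕ) :
    ∀ᵐ t ∂(volume.restrict (Ioo 0 T)), coef ℝ k (controlState A₀ B₀ y₀ u t) =
      modeExp (matOp A₀) k t (coef ℝ k y₀ +
        ∫ s in (0)..t, u s • modeExp (matOp A₀) k (-s) (sineAmp k • B₀)) := by
  filter_upwards [ae_intervalIntegrable_causalConv
    (integrableOn_boundaryKernel (matOp A₀) B₀ T) hu, ae_restrict_mem measurableSet_Ioo]
    with t hconv ht
  have hut : IntervalIntegrable u volume 0 t := intervalIntegrable_of_integrableOn_Ioo ht.1.le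
    (IntegrableOn.mono_set (hu.integrable one_le_two) (Ioo_subset_Ioo_right ht.2.le))
  have hforce : IntervalIntegrable (fun s => u s • modeExp (matOp A₀) k (-s) (sineAmp k • B₀))
      volume 0 t :=
    hut.smul_continuousOn
      ((continuous_modeExp_apply (matOp A₀) k _).comp continuous_neg).continuousOn
  rw [controlState, map_add, coef_heatOp _ ht.1.le, map_add]
  congr 1
  rw [causalConv, ← ContinuousLinearMap.intervalIntegral_comp_comm _ hconv,
    ← ContinuousLinearMap.intervalIntegral_comp_comm _ hforce,
    ← integral_Ioo_eq_intervalIntegral ht.1.le, ← integral_Ioo_eq_intervalIntegral ht.1.le]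
  refine setIntegral_congr_fun measurableSet_Ioo fun s hs => ?_
  simp only [map_smul]
  rw [coef_boundaryKernel _ _ (sub_pos.2 hs.2), sub_eq_add_neg, modeExp_add_apply, map_smul,
    map_smul]

theorem integral_inner_coef_controlState (hT : 0 ≤ T) (hu : MemLp u 2 (volume.restrict (Ioo 0 T)))
    (hφ : IsPrimitiveOn φ φt 0 T) (hφT : φ T = 0)
    (hH2 : ∀ᵐ t ∂(volume.restrict (Ioo 0 T)), IsH2H10 (φ t) (φx t) (φxx t))
    (heq : ∀ᵐ t ∂(volume.restrict (Ioo 0 T)), -φt t - φxx t = matMul A₀.transpose (φ t) + g t)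
    (k : ℕ) :
    (∫ t in Ioo 0 T, inner ℝ (coef ℝ k (controlState A₀ B₀ y₀ u t)) (coef ℝ k (g t))) +
      (∫ t in Ioo 0 T, inner ℝ (coef ℝ k (u t • affineLift B₀)) (coef ℝ k (φxx t))) =
      inner ℝ (coef ℝ k y₀) (coef ℝ k (φ 0)) := by
  have hbackward : ∀ᵐ t ∂(volume.restrict (Ioo 0 T)),
      modeOp (matOp A₀).adjoint k (coef ℝ k (φ t)) + coef ℝ k (φt t) = -coef ℝ k (g t) := by
    filter_upwards [hH2, heq] with t hφ_t heq_t
    exact hφ_t.modeOp_coef_add_coef heq_t k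
  have hduality := integral_inner_modeExp_of_backward_eqn (matOp A₀) k (coef ℝ k y₀)
    (sineAmp k • B₀) (intervalIntegrable_of_integrableOn_Ioo hT (hu.integrable one_le_two))
    (hφ.clm_comp (coef ℝ k)) (by rw [hφT, map_zero]) (γ := fun t => coef ℝ k (g t))
  have hstate : ∫ t in Ioo 0 T, inner ℝ (coef ℝ k (controlState A₀ B₀ y₀ u t)) (coef ℝ k (g t)) =
      ∫ t in Ioo 0 T, inner ℝ (modeExp (matOp A₀) k t (coef ℝ k y₀ +
        ∫ s in (0)..t, u s • modeExp (matOp A₀) k (-s) (sineAmp k • B₀))) (coef ℝ k (g t)) :=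
    integral_congr_ae <| (ae_coef_controlState A₀ B₀ y₀ hu k).mono fun t ht => by simp only [ht]
  have hboundary : ∫ t in Ioo 0 T, inner ℝ (coef ℝ k (u t • affineLift B₀)) (coef ℝ k (φxx t)) =
      -∫ t in Ioo 0 T, u t * inner ℝ (sineAmp k • B₀) (coef ℝ k (φ t)) := by
    rw [← integral_neg]
    refine integral_congr_ae (hH2.mono fun t ht => ?_)
    simp only [ht.coef_deriv₂, inner_coef_smul_affineLift]
  rw [uIoc_of_le hT, ← restrict_Ioo_eq_restrict_Ioc] at hduality
  rw [hstate, hboundary, integral_Ioo_eq_intervalIntegral hT,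
    integral_Ioo_eq_intervalIntegral hT, hduality hbackward, add_neg_cancel_right]

theorem integral_inner_affineLift (h : IsStrongAdjointSolution A₀ T g φ φx)
    (hφxx : ∀ᵐ t ∂(volume.restrict (Ioo 0 T)), IsWeakDeriv (φx t) (φxx t))
    {p : ℝ → EuclideanSpace ℝ (Fin 2)}
    (hp : ∀ᵐ t ∂(volume.restrict (Ioo 0 T)), HasTrace (φx t) 0 (p t)) :
    ∫ t in Ioo 0 T, inner ℝ (u t • affineLift B₀) (φxx t) =
      -∫ t in Ioo 0 T, inner ℝ B₀ (p t) * u t := by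
  rw [← integral_neg]
  refine integral_congr_ae ?_
  filter_upwards [h.isH2H10 hφxx, hp] with t hφ_t hp_t
  rw [real_inner_smul_left, hφ_t.inner_affineLift hp_t, mul_neg, mul_comm]

theorem isTranspositionSolution_controlState (hT : 0 ≤ T)
    (hu : MemLp u 2 (volume.restrict (Ioo 0 T))) :
    IsTranspositionSolution A₀ B₀ T y₀ u (controlState A₀ B₀ y₀ u) := by
  refine ⟨memLp_controlState y₀ hu, fun g hg φ φx p h hp => ?_⟩
  obtain ⟨φxx, φt, hφxx, hφt, hxx, hφ_eq, heq⟩ := h.eqn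
  have hφ : IsPrimitiveOn φ φt 0 T :=
    ⟨intervalIntegrable_of_integrableOn_Ioo hT (hφt.integrable one_le_two),
      by rwa [uIcc_of_le hT]⟩
  have hlift : MemLp (fun t => u t • affineLift B₀) 2 (volume.restrict (Ioo 0 T)) :=
    ((ContinuousLinearMap.id ℝ ℝ).smulRight (affineLift B₀)).comp_memLp' hu
  have hmodes := (tendsto_sum_integral_inner_coef
    (memLp_controlState (A₀ := A₀) (B₀ := B₀) y₀ hu) hg).add
    (tendsto_sum_integral_inner_coef hlift hφxx)
  simp_rw [← Finset.sum_add_distrib,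
    integral_inner_coef_controlState hT hu hφ h.final (h.isH2H10 hxx) heq] at hmodes
  have hparseval := tendsto_nhds_unique hmodes (hasSum_inner_coef ℝ y₀ (φ 0)).tendsto_sum_nat
  rw [integral_inner_affineLift h hxx hp] at hparseval
  linarith

end Transposition

/-! ## Uniqueness of the solution by transposition -/

section SmulConst

variable {E : Type*} [NormedAddCommGroup E] [InnerProductSpace ℝ E]

theorem hasTrace_smulConst {η : ℝ → ℝ} (hη : Continuous η) (c : E) (x : ℝ) :
    HasTrace (smulConst ℝ η hη c) x (η x • c) :=
  ⟨fun x => η x • c, (hη.smul continuous_const).continuousOn, coeFn_smulConst ℝ hη c, rfl⟩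

theorem smulConst_const_mul (r : ℝ) {η : ℝ → ℝ} (hη : Continuous η) (c : E) :
    smulConst ℝ (fun x => r * η x) (hη.const_mul r) c = r • smulConst ℝ η hη c := by
  refine Lp.ext ?_
  filter_upwards [coeFn_smulConst ℝ (hη.const_mul r) c, coeFn_smulConst ℝ hη c,
    Lp.coeFn_smul r (smulConst ℝ η hη c)] with x hmul hη_x hsmul
  rw [hmul, hsmul, Pi.smul_apply, hη_x, mul_smul]

theorem isWeakDeriv_smulConst [CompleteSpace E] {η η' : ℝ → ℝ} (hη : Continuous η)
    (hη' : Continuous η') (hderiv : ∀ x, HasDerivAt η (η' x) x) (c : E) :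
    IsWeakDeriv (smulConst ℝ η hη c) (smulConst ℝ η' hη' c) := by
  have hprim : IsPrimitiveOn (fun x => η x • c) (fun x => η' x • c) 0 Real.pi :=
    .of_hasDerivAt (fun x => (hderiv x).smul_const c) (hη'.smul continuous_const)
  have hcoe : smulConst ℝ η' hη' c =ᵐ[volume.restrict (uIoc 0 Real.pi)] fun x => η' x • c := by
    rw [uIoc_of_le Real.pi_pos.le, ← restrict_Ioo_eq_restrict_Ioc]
    exact coeFn_smulConst ℝ hη' c
  exact (hprim.congr_ae hcoe.symm).isWeakDeriv (coeFn_smulConst ℝ hη c)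

end SmulConst

section Modes

/-- The derivative of `sineFun k`. -/
def cosineFun (k : ℕ) (x : ℝ) : ℝ :=
  √(2 / Real.pi) * ((k + 1 : ℕ) * Real.cos ((k + 1 : ℕ) * x))

theorem continuous_cosineFun (k : ℕ) : Continuous (cosineFun k) := by
  unfold cosineFun
  fun_prop

theorem hasDerivAt_sineFun (k : ℕ) (x : ℝ) : HasDerivAt (sineFun k) (cosineFun k x) x :=
  (hasDerivAt_sin_const_mul _ x).const_mul _

theorem hasDerivAt_cosineFun (k : ℕ) (x : ℝ) :
    HasDerivAt (cosineFun k) (-freqSq k * sineFun k x) x := by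
  refine ((hasDerivAt_const_mul_cos_const_mul _ x).const_mul _).congr_deriv ?_
  rw [sineFun, freqSq, Nat.cast_succ]
  ring

variable {E : Type*} [NormedAddCommGroup E] [InnerProductSpace ℝ E] [CompleteSpace E]

/-- The derivative of `sineEmb ℝ k c`. -/
def cosineEmb (k : ℕ) : E →ₗ[ℝ] L2 E := smulConst ℝ (cosineFun k) (continuous_cosineFun k)

theorem isH2H10_sineEmb (k : ℕ) (c : E) :
    IsH2H10 (sineEmb ℝ k c) (cosineEmb k c) (-freqSq k • sineEmb ℝ k c) where
  deriv₁ :=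
    isWeakDeriv_smulConst (continuous_sineFun k) (continuous_cosineFun k) (hasDerivAt_sineFun k) c
  deriv₂ := by
    have hderiv := isWeakDeriv_smulConst (continuous_cosineFun k)
      ((continuous_sineFun k).const_mul (-freqSq k)) (hasDerivAt_cosineFun k) c
    rwa [smulConst_const_mul _ (continuous_sineFun k)] at hderiv
  trace_zero := by
    have htrace := hasTrace_smulConst (continuous_sineFun k) c 0
    rwa [sineFun, mul_zero, Real.sin_zero, mul_zero, zero_smul] at htrace
  trace_pi := by
    have htrace := hasTrace_smulConst (continuous_sineFun k) c Real.pi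
    rwa [sineFun, Real.sin_nat_mul_pi, mul_zero, zero_smul] at htrace

theorem exists_backward_mode (a : E →L[ℝ] E) (k : ℕ) {η : ℝ → ℝ} (hη : Continuous η) (c : E)
    (T : ℝ) : ∃ q : ℝ → E, q T = 0 ∧ ∀ t, HasDerivAt q (-(modeOp a k (q t)) - η t • c) t := by
  have hsource : Continuous fun s => (-η s) • modeExp a k s c :=
    hη.neg.smul (continuous_modeExp_apply a k c)
  refine ⟨fun t => modeExp a k (-t) (∫ s in T..t, (-η s) • modeExp a k s c), ?_, fun t => ?_⟩
  · simp only [intervalIntegral.integral_same, map_zero]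
  have hexp : HasDerivAt (fun t => modeExp a k (-t)) (-(modeOp a k * modeExp a k (-t))) t :=
    ((hasDerivAt_modeExp a k (-t)).scomp t (hasDerivAt_neg t)).congr_deriv (neg_one_smul _ _)
  have hprim := (hsource.integral_hasStrictDerivAt T t).hasDerivAt
  refine (hexp.clm_apply hprim).congr_deriv ?_
  rw [map_smul, ← modeExp_add_apply, neg_add_cancel, modeExp_zero, sub_eq_add_neg, neg_smul]
  rfl

theorem integral_inner_smul_sineEmb {α : Type*} [MeasurableSpace α] {μ : Measure α}
    {z : α → L2 E} {η : α → ℝ} (k : ℕ) (hz : Integrable (fun t => η t • coef ℝ k (z t)) μ) (c : E) :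
    ∫ t, inner ℝ (z t) (η t • sineEmb ℝ k c) ∂μ = inner ℝ c (∫ t, η t • coef ℝ k (z t) ∂μ) := by
  rw [← integral_inner hz]
  refine integral_congr_ae (ae_of_all _ fun t => ?_)
  simp only [real_inner_smul_right, inner_sineEmb_right]
  rw [real_inner_comm]

end Modes

section Uniqueness

theorem matMul_sineEmb (M : Matrix (Fin 2) (Fin 2) ℝ) (k : ℕ) (c : EuclideanSpace ℝ (Fin 2)) :
    matMul M (sineEmb ℝ k c) = sineEmb ℝ k (matOp M c) := by
  refine L2_ext_coef ℝ fun j => ?_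
  rw [coef_matMul, coef_sineEmb, coef_sineEmb]
  split_ifs
  · rfl
  · rw [map_zero]

variable {A₀ : Matrix (Fin 2) (Fin 2) ℝ} {B₀ : EuclideanSpace ℝ (Fin 2)} {T : ℝ} {u : ℝ → ℝ}
  {y₀ : StateR} {η : ℝ → ℝ} {y y' : ℝ → StateR}

theorem isStrongAdjointSolution_mode (k : ℕ) (hη : Continuous η) (c : EuclideanSpace ℝ (Fin 2))
    {q : ℝ → EuclideanSpace ℝ (Fin 2)} (hqT : q T = 0)
    (hq : ∀ t, HasDerivAt q (-(modeOp (matOp A₀.transpose) k (q t)) - η t • c) t) :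
    IsStrongAdjointSolution A₀ T (fun t => η t • sineEmb ℝ k c) (fun t => sineEmb ℝ k (q t))
      (fun t => cosineEmb k (q t)) := by
  have hq_cont : Continuous q := continuous_iff_continuousAt.2 fun t => (hq t).continuousAt
  have hsine : Continuous fun t => sineEmb ℝ k (q t) := (sineEmb ℝ k).continuous.comp hq_cont
  have hcosine : Continuous fun t => (cosineEmb k (q t) : StateR) :=
    (LinearMap.continuous_of_finiteDimensional (cosineEmb k)).comp hq_cont
  have hq' : Continuous fun t => -(modeOp (matOp A₀.transpose) k (q t)) - η t • c :=
    ((modeOp (matOp A₀.transpose) k).continuous.comp hq_cont).neg.sub (hη.smul continuous_const)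
  have hq_prim (t : ℝ) : IsPrimitiveOn (fun t => sineEmb ℝ k (q t))
      (fun t => sineEmb ℝ k (-(modeOp (matOp A₀.transpose) k (q t)) - η t • c)) 0 t :=
    (IsPrimitiveOn.of_hasDerivAt hq hq').clm_comp (sineEmb ℝ k).toContinuousLinearMap
  exact
    { deriv_x := fun t _ => (isH2H10_sineEmb k (q t)).deriv₁
      trace_zero := fun t _ => (isH2H10_sineEmb k (q t)).trace_zero
      trace_pi := fun t _ => (isH2H10_sineEmb k (q t)).trace_pi
      cont := hsine.continuousOn
      cont_x := hcosine.continuousOn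
      eqn := by
        refine ⟨fun t => -freqSq k • sineEmb ℝ k (q t), _,
          memLp_of_continuousOn_Icc (hsine.const_smul (-freqSq k)).continuousOn,
          memLp_of_continuousOn_Icc ((sineEmb ℝ k).continuous.comp hq').continuousOn,
          ae_of_all _ fun t => (isH2H10_sineEmb k (q t)).deriv₂,
          fun t _ => (hq_prim t).eq_add_integral t right_mem_uIcc, ae_of_all _ fun t => ?_⟩
        simp only [Function.comp_apply, matMul_sineEmb, modeOp_apply, map_sub, map_neg, map_smul,
          neg_smul]
        abel
      final := by rw [hqT, map_zero] }

theorem IsTranspositionSolution.integral_smul_coef_congr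
    (hy : IsTranspositionSolution A₀ B₀ T y₀ u y) (hy' : IsTranspositionSolution A₀ B₀ T y₀ u y')
    (k : ℕ) (hη : Continuous η) :
    ∫ t in Ioo 0 T, η t • coef ℝ k (y' t) = ∫ t in Ioo 0 T, η t • coef ℝ k (y t) := by
  refine ext_inner_left ℝ fun c => ?_
  obtain ⟨q, hqT, hq⟩ := exists_backward_mode (matOp A₀.transpose) k hη c T
  have hadjoint := isStrongAdjointSolution_mode (A₀ := A₀) k hη c hqT hq
  have hsource : MemLp (fun t => η t • sineEmb ℝ k c) 2 (volume.restrict (Ioo 0 T)) :=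
    memLp_of_continuousOn_Icc (hη.smul continuous_const).continuousOn
  have htrace : ∀ᵐ t ∂(volume.restrict (Ioo 0 T)),
      HasTrace (cosineEmb k (q t)) 0 (cosineFun k 0 • q t) :=
    ae_of_all _ fun t => hasTrace_smulConst (continuous_cosineFun k) (q t) 0
  have hcoef {z : ℝ → StateR} (hz : MemLp z 2 (volume.restrict (Ioo 0 T))) :
      IntegrableOn (fun t => η t • coef ℝ k (z t)) (Ioo 0 T) :=
    integrableOn_Ioo_smul hη.continuousOn ((memLp_coef hz k).integrable one_le_two)
  rw [← integral_inner_smul_sineEmb k (hcoef hy'.1), ← integral_inner_smul_sineEmb k (hcoef hy.1),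
    hy'.2 _ hsource _ _ _ hadjoint htrace, hy.2 _ hsource _ _ _ hadjoint htrace]

theorem IsTranspositionSolution.ae_eq (hy : IsTranspositionSolution A₀ B₀ T y₀ u y)
    (hy' : IsTranspositionSolution A₀ B₀ T y₀ u y') :
    y' =ᵐ[volume.restrict (Ioo 0 T)] y := by
  have hcoef : ∀ k, ∀ᵐ t ∂(volume.restrict (Ioo 0 T)), coef ℝ k (y' t) = coef ℝ k (y t) :=
    fun k => ae_eq_of_integral_contDiff_smul_eq
      ((memLp_coef hy'.1 k).integrable one_le_two).locallyIntegrable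
      ((memLp_coef hy.1 k).integrable one_le_two).locallyIntegrable
      fun _ hη _ => hy.integral_smul_coef_congr hy' k hη.continuous
  filter_upwards [ae_all_iff.2 hcoef] with t ht using L2_ext_coef ℝ ht

end Uniqueness

end BoundaryControl

end

open BoundaryControl in
theorem mainTheorem8 (A₀ : Matrix (Fin 2) (Fin 2) ℝ) (B₀ : EuclideanSpace ℝ (Fin 2)) :
    ∃ (S : C0Semigroup StateC) (S' : C0Semigroup (Extrap (parabolicOp A₀)))
      (B : ℂ →L[ℂ] Extrap (parabolicOp A₀)),
      -- `A` generates `S = e^{At}` on `H`, and `𝒜` generates `S' = e^{𝒜t}` on `(dom A^*)'`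
      S.HasGenerator (parabolicOp A₀).graph ∧
      S'.HasGenerator (extendGraph (parabolicOp A₀)) ∧
      -- the control operator is `B = (ω I - 𝒜) D_ω`, `D_ω` the Dirichlet map
      -- (so `B = -𝒜 C` with `C = D_0` if `ω = 0` is admissible), with the singular estimate
      (∀ ω : ℂ, NonResonant A₀ ω →
        ω ∈ resolventSet (parabolicOp A₀) ∧
        (∀ a : ℂ, ∃ h, IsDirichletLift A₀ B₀ ω a h ∧
          ∀ h', IsDirichletLift A₀ B₀ ω a h' → Set.EqOn h' h (Set.Icc 0 Real.pi)) ∧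
        ∃ D : ℂ →L[ℂ] StateC,
          (∀ a h, IsDirichletLift A₀ B₀ ω a h →
            D a =ᵐ[volume.restrict (Set.Ioo 0 Real.pi)] h) ∧
          B = (ω • embed (parabolicOp A₀) - extend (parabolicOp A₀)).comp D ∧
          ∀ θ ∈ Set.Ioo (0 : ℝ) (1 / 4), ∀ T : ℝ, 0 < T → ∃ M : ℝ, ∀ t ∈ Set.Ioo 0 T, ∀ a : ℂ,
            ∃ hd : S.op t (D a) ∈ (parabolicOp A₀).domain,
              ‖parabolicOp A₀ ⟨S.op t (D a), hd⟩‖ ≤ M * ‖a‖ / t ^ (1 - θ)) ∧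
      -- the solution by transposition exists, is unique and solves `ẏ = 𝒜 y + B u`, `y(0) = y₀`
      (∀ T : ℝ, 0 < T → ∀ (y₀ : StateR) (u : ℝ → ℝ),
        MemLp u 2 (volume.restrict (Set.Ioo 0 T)) →
        ∃ y : ℝ → StateR,
          IsTranspositionSolution A₀ B₀ T y₀ u y ∧
          (∀ y', IsTranspositionSolution A₀ B₀ T y₀ u y' →
            y' =ᵐ[volume.restrict (Set.Ioo 0 T)] y) ∧
          IsMildSolution (parabolicOp A₀) S S' B T (stateC y₀) (fun t => (u t : ℂ))
            (fun t => stateC (y t))) ∧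
      RegularityHypothesis (parabolicOp A₀) S' B ∧
      HasCompactResolvent (parabolicOp A₀) ∧
      SpectralHypothesis (parabolicOp A₀) S := by
  obtain ⟨ω₀, hω₀⟩ := exists_nonResonant A₀
  obtain ⟨R, hR, -⟩ := hω₀.exists_resolvent
  obtain ⟨D₀, -, hD₀⟩ := hω₀.exists_dirichletMap B₀
  refine ⟨heatSemigroup A₀, extrapSemigroup hR, (shift (parabolicOp A₀) ω₀).comp D₀,
    heatSemigroup_hasGenerator A₀,
    (heatSemigroup_hasGenerator A₀).conj _
      (mem_extendGraph_shiftEquiv_iff dense_domain_parabolicOp hR),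
    fun ω hω => ?_, fun T hT y₀ u hu => ?_, hD₀.regularityHypothesis hR,
    hasCompactResolvent_parabolicOp A₀, spectralHypothesis_parabolicOp A₀⟩
  · obtain ⟨D, hDlift, hD⟩ := hω.exists_dirichletMap B₀
    refine ⟨hω.exists_resolvent.imp fun _ h => h.1, fun a => ?_, D, hDlift,
      hD₀.shift_comp_eq hD, fun θ hθ T _ => hD.exists_norm_le hθ T⟩
    obtain ⟨h, hh⟩ := hω.exists_isDirichletLift B₀ a
    exact ⟨h, hh, fun h' hh' => hω.eqOn_of_isDirichletLift hh hh'⟩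
  · have hy := isTranspositionSolution_controlState (A₀ := A₀) (B₀ := B₀) (y₀ := y₀) hT.le hu
    exact ⟨controlState A₀ B₀ y₀ u, hy, fun y' hy' => hy.ae_eq hy', hD₀.isMildSolution hR y₀ hu⟩
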